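/- **Setting.** A latent MDP (LMDP) with $S$ states, $A$ actions, $L$ instances and horizon $H$ consists of finite sets $\mathcal S,\mathcal A$ with $|\mathcal S|=S\ge 1$, $|\mathcal A|=A\ge 1$, a mixing distribution $\rho\in\Delta([L])$, for each $m\in[L]$ an initial distribution $\nu_m\in\Delta(\mathcal S)$ and transition probabilities $\mathbb T_m(\cdot\mid s,a)\in\Delta(\mathcal S)$, and a known deterministic reward $R_h:\mathcal S\times\mathcal A\to[0,1]$ ($h\in[H]$) with $\sum_{h=1}^H\sup_{s,a}R_h(s,a)\le 1$. In each episode a latent index $m^\star\sim\rho$ is drawn and never observed, $s_1\sim\nu_{m^\star}$, and $s_{h+1}\sim\mathbb T_{m^\star}(\cdot\mid s_h,a_h)$ after the action $a_h$; the episode ends after $a_H$. A policy chooses $a_h$ at random depending on $(s_1,a_1,\dots,s_{h-1},a_{h-1},s_h)$; its value is $V(\pi)=\mathbb E^\pi\big[\sum_{h=1}^H R_h(s_h,a_h)\big]$, and $\pi$ is $\varepsilon$-optimal if $\sup_{\pi'}V(\pi')-V(\pi)\le\varepsilon$. The LMDP is $\delta$-strongly separated if $D_{\mathrm{TV}}(\mathbb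 T_m(\cdot\mid s,a),\mathbb T_l(\cdot\mid s,a))\ge\delta$ for all $m\ne l$ in $\mathrm{supp}(\rho)$ and all $s\in\mathcal S$, $a\in\mathcal A$, where $D_{\mathrm{TV}}(p,q)=\frac12\sum_x|p(x)-q(x)|$. An algorithm, given $S,A,H,L,\varepsilon,\delta$ and $R$, plays a number of episodes (its sample complexity), choosing the policy of each episode from the trajectories of the earlier ones and internal randomness, and then outputs a policy. **Theorem 3.1.** There is an absolute constant $\delta_0>0$ and, for each integer $\mathsf d\ge 1$, there are constants $c_{\mathsf d}>0$, $\varepsilon_{\mathsf d}>0$ and $L_{\mathsf d}$ depending only on $\mathsf d$ such that the following holds. Let $H_{\rm thre}(L,\varepsilon,\delta)\in[-\infty,\infty]$ be a function, and suppose that there is an algorithm which, for all $S,A,H,L\ge1$ and $\varepsilon,\delta>0$ with $H\ge H_{\rm thre}(L,\varepsilon,\delta)$ and for every $\delta$-strongly separated LMDP with these parameters, uses at most $\max\{S,A,H,L,\varepsilon^{-1},\delta^{-1}\}^{\mathsf d}$ episodes and outputs an $\varepsilon$-optimal policy with probability at least $3/4$. Then $$H_{\rm thre}(L,\varepsilon,\delta)\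 \ge\ \frac{c_{\mathsf d}\log(L/\varepsilon)}{\delta^2}\qquad\text{for all } 0<\delta\le\delta_0,\ 0<\varepsilon\le\varepsilon_{\mathsf d},\ L\ge\max(L_{\mathsf d},\delta^{-1}).$$ -/

import Mathlib

open MeasureTheory

noncomputable section

namespace LatentMDP

/-- A trajectory `(s_1, a_1, …, s_H, a_H)` of an episode of length `H`. -/
abbrev Trajectory (𝒮 𝒜 : Type) (H : ℕ) : Type := Fin H → 𝒮 × 𝒜

/-- The part of a sequence of length `n` that comes strictly before index `i`. -/
def before {α : Type} {n : ℕ} (x : Fin n → α) (i : Fin n) : Fin i → α :=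
  fun j => x (Fin.castLE i.isLt.le j)

/-- A randomized history-dependent policy: at each step, the past state-action pairs and the
current state are mapped to a distribution over actions. -/
abbrev Policy (𝒮 𝒜 : Type) [Fintype 𝒜] (H : ℕ) : Type :=
  (h : Fin H) → (Fin h → 𝒮 × 𝒜) → 𝒮 → stdSimplex ℝ 𝒜

/-- Total variation distance between two distributions on a finite set. -/
def tv {X : Type} [Fintype X] (p q : stdSimplex ℝ X) : ℝ :=
  (1 / 2) * ∑ x, |p x - q x|

/-- A deterministic reward function `R_h : 𝒮 × 𝒜 → [0, 1]`, normalized by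
`∑_h sup_{s, a} R_h(s, a) ≤ 1`. -/
structure Reward (𝒮 𝒜 : Type) (H : ℕ) where
  R : Fin H → 𝒮 → 𝒜 → ℝ
  mem_Icc : ∀ h s a, R h s a ∈ Set.Icc (0 : ℝ) 1
  sum_sup_le_one : ∑ h, ⨆ p : 𝒮 × 𝒜, R h p.1 p.2 ≤ 1

/-- A latent MDP: `L` MDP instances with joint state and action spaces, horizon `H`, mixing
distribution `ρ`, initial distributions `ν m`, transitions `T m`, and a common reward. -/
structure LMDP (𝒮 𝒜 : Type) [Fintype 𝒮] (L H : ℕ) where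
  ρ : stdSimplex ℝ (Fin L)
  ν : Fin L → stdSimplex ℝ 𝒮
  T : Fin L → 𝒮 → 𝒜 → stdSimplex ℝ 𝒮
  reward : Reward 𝒮 𝒜 H

namespace LMDP

variable {𝒮 𝒜 : Type} [Fintype 𝒮] [Fintype 𝒜] {L H : ℕ}

/-- `δ`-strong separation: any two distinct instances in the support of `ρ` have transition
distributions at total variation distance at least `δ`, at every state-action pair. -/
def StronglySeparated (M : LMDP 𝒮 𝒜 L H) (δ : ℝ) : Prop :=
  ∀ m l : Fin L, M.ρ m ≠ 0 → M.ρ l ≠ 0 → m ≠ l → ∀ s a, δ ≤ tv (M.T m s a) (M.T l s a)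

/-- Conditional probability, in instance `m`, of the state at step `h` given the preceding part
of the trajectory. -/
def stateProb (M : LMDP 𝒮 𝒜 L H) (m : Fin L) (τ : Trajectory 𝒮 𝒜 H) : Fin H → ℝ
  | ⟨0, h0⟩ => M.ν m (τ ⟨0, h0⟩).1
  | ⟨k + 1, hk⟩ =>
      M.T m (τ ⟨k, k.lt_succ_self.trans hk⟩).1 (τ ⟨k, k.lt_succ_self.trans hk⟩).2
        (τ ⟨k + 1, hk⟩).1

/-- The probability `ℙ^π(τ)` of a trajectory when the policy `π` interacts with the LMDP. -/
def trajProb (M : LMDP 𝒮 𝒜 L H) (π : Policy 𝒮 𝒜 H) (τ : Trajectory 𝒮 𝒜 H) : ℝ :=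
  ∑ m, M.ρ m * ∏ h, (M.stateProb m τ h * π h (before τ h) (τ h).1 (τ h).2)

/-- The value of a policy: its expected total reward. -/
def value (M : LMDP 𝒮 𝒜 L H) (π : Policy 𝒮 𝒜 H) : ℝ :=
  ∑ τ, M.trajProb π τ * ∑ h, M.reward.R h (τ h).1 (τ h).2

/-- The optimal value over all history-dependent policies. -/
def optValue (M : LMDP 𝒮 𝒜 L H) : ℝ := ⨆ π : Policy 𝒮 𝒜 H, M.value π

/-- `ε`-optimality of a policy. -/
def IsOptimal (M : LMDP 𝒮 𝒜 L H) (ε : ℝ) (π : Policy 𝒮 𝒜 H) : Prop :=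
  M.optValue - M.value π ≤ ε

end LMDP

/-- An episodic interaction protocol. A random seed `ω` is drawn; in each of `episodes` episodes
the policy to execute is chosen from the seed and the trajectories of the earlier episodes;
finally a policy is output on the basis of the seed and all trajectories. -/
structure Protocol (𝒮 𝒜 : Type) [Fintype 𝒜] (H : ℕ) where
  Ω : Type
  mΩ : MeasurableSpace Ω
  seed : Measure Ω
  isProb : IsProbabilityMeasure seed
  episodes : ℕ
  explore : (t : Fin episodes) → (Fin t → Trajectory 𝒮 𝒜 H) → Ω → Policy 𝒮 𝒜 H
  output : (Fin episodes → Trajectory 𝒮 𝒜 H) → Ω → Policy 𝒮 𝒜 H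
  measurable_explore : ∀ t D, Measurable (explore t D)
  measurable_output : ∀ D, Measurable (output D)

namespace Protocol

variable {𝒮 𝒜 : Type} [Fintype 𝒮] [Fintype 𝒜] {L H : ℕ}

/-- Conditional probability, given the seed `ω`, that the episodes played in `M` yield the
trajectories `D`. -/
def dataProb (P : Protocol 𝒮 𝒜 H) (M : LMDP 𝒮 𝒜 L H) (ω : P.Ω)
    (D : Fin P.episodes → Trajectory 𝒮 𝒜 H) : ℝ :=
  ∏ t, M.trajProb (P.explore t (before D t) ω) (D t)

/-- The probability, over the seed and the interaction with `M`, that the output policy is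
`ε`-optimal in `M`. -/
def successProb (P : Protocol 𝒮 𝒜 H) (M : LMDP 𝒮 𝒜 L H) (ε : ℝ) : ℝ :=
  letI := P.mΩ
  ∫ ω, ∑ D, {D' | M.IsOptimal ε (P.output D' ω)}.indicator (P.dataProb M ω) D ∂P.seed

end Protocol

/-- A learning algorithm: it is given the numbers of states and actions, the horizon, the number
of MDP instances, the accuracy, the separation and the (known) reward function, and then runs an
interaction protocol. -/
abbrev Algorithm : Type 1 :=
  (S A H L : ℕ) → [NeZero S] → [NeZero A] → (ε δ : ℝ) → Reward (Fin S) (Fin A) H →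
    Protocol (Fin S) (Fin A) H

/-- The algorithm `𝔄` uses at most `max {S, A, H, L, ε⁻¹, δ⁻¹} ^ d` episodes and, with probability
at least `3/4`, outputs an `ε`-optimal policy in every `δ`-strongly separated LMDP with horizon
`H ≥ Hthre(L, ε, δ)`. The threshold may be infinite where no horizon is claimed to suffice. -/
def LearnsSeparated (𝔄 : Algorithm) (d : ℕ) (Hthre : ℕ → ℝ → ℝ → EReal) : Prop :=
  ∀ (S A H L : ℕ) [NeZero S] [NeZero A] (ε δ : ℝ), 1 ≤ H → 0 < ε → 0 < δ →
    Hthre L ε δ ≤ ((H : ℝ) : EReal) →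
    ∀ M : LMDP (Fin S) (Fin A) L H, M.StronglySeparated δ →
      ((𝔄 S A H L ε δ M.reward).episodes : ℝ) ≤
          (max (S : ℝ) (max (A : ℝ) (max (H : ℝ) (max (L : ℝ) (max ε⁻¹ δ⁻¹))))) ^ d ∧
        3 / 4 ≤ (𝔄 S A H L ε δ M.reward).successProb M ε

end LatentMDP

end

open MeasureTheory

noncomputable section

set_option linter.unusedSectionVars false

namespace LatentMDP

/-! The hard instances hide a secret action sequence `v` of length `n = d + 1`. Instance `m` carries
a codeword `x m` in `{±1}^K` and a role `u m` in `{±1}^n` of product one. Each state shows a random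
coordinate of the codeword with bias `b = 16δ`; since distinct codewords differ in a fraction `1/16`
of the coordinates, this alone gives `δ`-separation. Behind an open gate, the `i`-th secret action
forces the `i`-th coin to equal `u m i`, and any other action leaves it fair; the reward is paid
when the coins have product one. The whole secret therefore always wins behind the gate, while
without a lock every policy wins half the time.

Expanding the likelihood in characters of the roles compares the two models. The empty set of steps
gives the model without a lock, the full set contributes only if the whole secret was played, and a
proper set `J` contributes the correlation `leak J` of `∏_{i ∈ J} u m i` with the observations
(`abs_stateWeight_sub_le`). If the leaks are negligible, an episode is useful only when it plays the
secret. With `A` dominating all other parameters there are `A ^ (d + 1)` secrets and at most `A ^ d`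
episodes, a contradiction (`card_le_of_successProb`, `card_le_of_learns`, `not_learns`).

Leaks are controlled by making the roles uncorrelated with all monomials of degree at most `K / s`
in the codeword, where `s` depends only on `d`. An iterated Radon partition of the moment vectors of
a Gilbert–Varshamov code gives `2 ^ d` disjoint weighted groups of codewords with identical low
moments, one for each role (`exists_role_code`).

Since `log (L / ε)` is at most twice the larger of `log L` and `log ε⁻¹`, two regimes suffice. If `L
≥ ε⁻¹`, take `K` about `log₂ L` and an open gate: only degrees above `K / s` survive in the second
moment, so the leak is smaller than a prescribed power of `L⁻¹` while `H` is at most a small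
multiple of `log L / δ²` (`not_learns_of_many_instances`). If `ε⁻¹ ≥ L`, take `K` depending on `d`
only and a gate that opens with probability inversely proportional to the likelihood of the past.
Given an open gate the past is uninformative, and the remaining `n + 1` observations have too low a
degree to leak anything. The price is an opening probability of at least `2^{-K} (1 - b²)^{H₁}`,
still above `8ε` for `H` up to a small multiple of `log ε⁻¹ / δ²` (`not_learns_of_high_accuracy`).
-/

lemma sum_simplex {X : Type} [Fintype X] (p : stdSimplex ℝ X) : ∑ x, p x = 1 := p.2.2

/-! ### Sums over paths generated by history-dependent kernels -/

section PathSums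

variable {α : Type} [Fintype α]

/-- The weight of a path when each coordinate is drawn from a kernel that sees the past. -/
def pathWeight {n : ℕ} (k : (i : Fin n) → (Fin i → α) → α → ℝ) (x : Fin n → α) : ℝ :=
  ∏ i, k i (before x i) (x i)

lemma before_snoc_castSucc {n : ℕ} (x : Fin n → α) (a : α) (i : Fin n) :
    before (Fin.snoc x a : Fin (n + 1) → α) i.castSucc = before x i := by
  funext j
  exact Fin.snoc_castSucc (α := fun _ => α) a x (Fin.castLE i.isLt.le j)

lemma before_snoc_last {n : ℕ} (x : Fin n → α) (a : α) :
    before (Fin.snoc x a : Fin (n + 1) → α) (Fin.last n) = x := by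
  funext j
  exact Fin.snoc_castSucc (α := fun _ => α) a x j

lemma pathWeight_snoc {n : ℕ} (k : (i : Fin (n + 1)) → (Fin i → α) → α → ℝ)
    (x : Fin n → α) (a : α) :
    pathWeight k (Fin.snoc x a) =
      pathWeight (fun i : Fin n => k i.castSucc) x * k (Fin.last n) x a := by
  unfold pathWeight
  rw [Fin.prod_univ_castSucc]
  congr 1
  · refine Finset.prod_congr rfl fun i _ => ?_
    rw [before_snoc_castSucc, Fin.snoc_castSucc]
  · rw [before_snoc_last, Fin.snoc_last]

lemma sum_snoc {n : ℕ} (f : (Fin (n + 1) → α) → ℝ) :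
    ∑ x, f x = ∑ x : Fin n → α, ∑ a, f (Fin.snoc x a) := by
  rw [← (Fin.snocEquiv (fun _ : Fin (n + 1) => α)).sum_comp, Fintype.sum_prod_type,
    Finset.sum_comm]
  rfl

lemma sum_pathWeight {n : ℕ} (k : (i : Fin n) → (Fin i → α) → α → ℝ)
    (hk : ∀ i h, ∑ a, k i h a = 1) : ∑ x, pathWeight k x = 1 := by
  induction n with
  | zero => simp [pathWeight]
  | succ n ih =>
    rw [sum_snoc]
    simp_rw [pathWeight_snoc, ← Finset.mul_sum, hk, mul_one]
    exact ih _ fun i h => hk i.castSucc h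

lemma pathWeight_nonneg {n : ℕ} (k : (i : Fin n) → (Fin i → α) → α → ℝ)
    (hk : ∀ i h a, 0 ≤ k i h a) (x : Fin n → α) : 0 ≤ pathWeight k x :=
  Finset.prod_nonneg fun i _ => hk i _ _

/-- The total variation between two path measures is at most the expected sum of the total
variations of the kernels. -/
lemma sum_abs_pathWeight_sub_le {n : ℕ} (k k' : (i : Fin n) → (Fin i → α) → α → ℝ)
    (hk0 : ∀ i h a, 0 ≤ k i h a) (hk'0 : ∀ i h a, 0 ≤ k' i h a)
    (hk : ∀ i h, ∑ a, k i h a = 1) (hk' : ∀ i h, ∑ a, k' i h a = 1) :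
    ∑ x, |pathWeight k' x - pathWeight k x| ≤
      ∑ x, pathWeight k x * ∑ i, ∑ a, |k' i (before x i) a - k i (before x i) a| := by
  induction n with
  | zero => simp [pathWeight]
  | succ n ih =>
    have ih' := ih (fun i => k i.castSucc) (fun i => k' i.castSucc)
      (fun i => hk0 i.castSucc) (fun i => hk'0 i.castSucc)
      (fun i => hk i.castSucc) (fun i => hk' i.castSucc)
    rw [sum_snoc, sum_snoc]
    simp_rw [pathWeight_snoc, Fin.sum_univ_castSucc, before_snoc_castSucc, before_snoc_last]
    -- Hybrid step: in `w'k' - wk = (w' - w)k' + w(k' - k)` the kernel `k'` sums out of the first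
    -- term, so kernel errors are weighted by the reference `w` only.
    have h1 : ∀ x : Fin n → α,
        ∑ a, |pathWeight (fun i : Fin n => k' i.castSucc) x * k' (Fin.last n) x a -
          pathWeight (fun i : Fin n => k i.castSucc) x * k (Fin.last n) x a| ≤
        |pathWeight (fun i : Fin n => k' i.castSucc) x -
          pathWeight (fun i : Fin n => k i.castSucc) x| +
        pathWeight (fun i : Fin n => k i.castSucc) x *
          ∑ a, |k' (Fin.last n) x a - k (Fin.last n) x a| := by
      intro x
      set w := pathWeight (fun i : Fin n => k i.castSucc) x
      set w' := pathWeight (fun i : Fin n => k' i.castSucc) x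
      have hw : 0 ≤ w := pathWeight_nonneg _ (fun i => hk0 i.castSucc) x
      calc _ ≤ ∑ a, (|w' - w| * k' (Fin.last n) x a +
              w * |k' (Fin.last n) x a - k (Fin.last n) x a|) := by
            refine Finset.sum_le_sum fun a _ => ?_
            have e : w' * k' (Fin.last n) x a - w * k (Fin.last n) x a =
              (w' - w) * k' (Fin.last n) x a +
                w * (k' (Fin.last n) x a - k (Fin.last n) x a) := by ring
            rw [e]
            refine (abs_add_le _ _).trans (le_of_eq ?_)
            rw [abs_mul, abs_mul, abs_of_nonneg (hk'0 _ _ _), abs_of_nonneg hw]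
        _ = _ := by rw [Finset.sum_add_distrib, ← Finset.mul_sum, hk', mul_one,
                      Finset.mul_sum]
    refine (Finset.sum_le_sum fun x _ => h1 x).trans ?_
    rw [Finset.sum_add_distrib]
    refine (add_le_add_left ih' _).trans (le_of_eq ?_)
    rw [← Finset.sum_add_distrib]
    refine Finset.sum_congr rfl fun x _ => ?_
    simp_rw [mul_assoc]
    rw [← Finset.mul_sum, ← Finset.sum_mul, hk, one_mul, ← mul_add]

end PathSums

/-! ### Trajectory probabilities -/

section Trajectories

variable {𝒮 𝒜 : Type} [Fintype 𝒮] [Fintype 𝒜] {L H : ℕ}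

/-- The probability that a policy chooses the actions of a trajectory along its states. -/
def Policy.weight (π : Policy 𝒮 𝒜 H) (τ : Trajectory 𝒮 𝒜 H) : ℝ :=
  ∏ h, π h (before τ h) (τ h).1 (τ h).2

lemma Policy.weight_nonneg (π : Policy 𝒮 𝒜 H) (τ : Trajectory 𝒮 𝒜 H) : 0 ≤ π.weight τ :=
  Finset.prod_nonneg fun h _ => (π h (before τ h) (τ h).1).2.1 _

/-- Averaging a function of the states over the actions chosen by a policy. -/
lemma Policy.sum_weight_mul (π : Policy 𝒮 𝒜 H) (f : (Fin H → 𝒮) → ℝ) :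
    ∑ τ : Trajectory 𝒮 𝒜 H, π.weight τ * f (fun h => (τ h).1) = ∑ s, f s := by
  induction H with
  | zero =>
    rw [Fintype.sum_unique, Fintype.sum_unique]
    simp only [Policy.weight, Finset.univ_eq_empty, Finset.prod_empty, one_mul]
    congr 1
    exact Subsingleton.elim _ _
  | succ n ih =>
    have hw : ∀ (τ : Fin n → 𝒮 × 𝒜) (p : 𝒮 × 𝒜), π.weight (Fin.snoc τ p) =
        Policy.weight (fun h : Fin n => π h.castSucc) τ * π (Fin.last n) τ p.1 p.2 :=
      fun τ p => pathWeight_snoc (fun h hist (p : 𝒮 × 𝒜) => (π h hist p.1 p.2 : ℝ)) τ p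
    have hs : ∀ (τ : Fin n → 𝒮 × 𝒜) (p : 𝒮 × 𝒜),
        (fun h => ((Fin.snoc τ p : Fin (n + 1) → 𝒮 × 𝒜) h).1) =
          (Fin.snoc (fun h => (τ h).1) p.1 : Fin (n + 1) → 𝒮) := by
      intro τ p
      funext h
      refine Fin.lastCases ?_ (fun i => ?_) h
      · simp
      · simp
    rw [sum_snoc (α := 𝒮 × 𝒜), sum_snoc (α := 𝒮)]
    rw [← ih (fun h : Fin n => π h.castSucc) (fun s => ∑ a, f (Fin.snoc s a))]
    refine Finset.sum_congr rfl fun τ _ => ?_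
    rw [Fintype.sum_prod_type, Finset.mul_sum]
    refine Finset.sum_congr rfl fun s _ => ?_
    simp_rw [hw, hs, mul_assoc, ← Finset.mul_sum, ← Finset.sum_mul]
    rw [sum_simplex, one_mul]

namespace LMDP

/-- The likelihood of the states of a trajectory given its actions. -/
def stateWeight (M : LMDP 𝒮 𝒜 L H) (τ : Trajectory 𝒮 𝒜 H) : ℝ :=
  ∑ m, M.ρ m * ∏ h, M.stateProb m τ h

lemma stateProb_nonneg (M : LMDP 𝒮 𝒜 L H) (m : Fin L) (τ : Trajectory 𝒮 𝒜 H) (h : Fin H) :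
    0 ≤ M.stateProb m τ h := by
  rcases h with ⟨_ | k, hk⟩
  · exact (M.ν m).2.1 _
  · exact (M.T m _ _).2.1 _

lemma stateWeight_nonneg (M : LMDP 𝒮 𝒜 L H) (τ : Trajectory 𝒮 𝒜 H) : 0 ≤ M.stateWeight τ :=
  Finset.sum_nonneg fun m _ =>
    mul_nonneg (M.ρ.2.1 m) (Finset.prod_nonneg fun h _ => M.stateProb_nonneg m τ h)

lemma trajProb_eq (M : LMDP 𝒮 𝒜 L H) (π : Policy 𝒮 𝒜 H) (τ : Trajectory 𝒮 𝒜 H) :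
    M.trajProb π τ = π.weight τ * M.stateWeight τ := by
  simp only [trajProb, Policy.weight, stateWeight, Finset.prod_mul_distrib, Finset.mul_sum]
  refine Finset.sum_congr rfl fun m _ => ?_
  ring

lemma trajProb_nonneg (M : LMDP 𝒮 𝒜 L H) (π : Policy 𝒮 𝒜 H) (τ : Trajectory 𝒮 𝒜 H) :
    0 ≤ M.trajProb π τ := by
  rw [trajProb_eq]
  exact mul_nonneg (π.weight_nonneg τ) (M.stateWeight_nonneg τ)

/-- The law of the next state given the history, in instance `m`. -/
def nextProb (M : LMDP 𝒮 𝒜 L H) (m : Fin L) : (h : Fin H) → (Fin h → 𝒮 × 𝒜) → 𝒮 → ℝ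
  | ⟨0, _⟩, _, s => M.ν m s
  | ⟨k + 1, _⟩, hist, s => M.T m (hist (Fin.last k)).1 (hist (Fin.last k)).2 s

lemma stateProb_eq_nextProb (M : LMDP 𝒮 𝒜 L H) (m : Fin L) (τ : Trajectory 𝒮 𝒜 H)
    (h : Fin H) : M.stateProb m τ h = M.nextProb m h (before τ h) (τ h).1 := by
  rcases h with ⟨_ | k, hk⟩ <;> rfl

lemma sum_nextProb (M : LMDP 𝒮 𝒜 L H) (m : Fin L) (h : Fin H) (hist : Fin h → 𝒮 × 𝒜) :
    ∑ s, M.nextProb m h hist s = 1 := by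
  rcases h with ⟨_ | k, hk⟩
  · exact (M.ν m).2.2
  · exact (M.T m _ _).2.2

lemma sum_trajProb (M : LMDP 𝒮 𝒜 L H) (π : Policy 𝒮 𝒜 H) : ∑ τ, M.trajProb π τ = 1 := by
  have key : ∀ m, ∑ τ : Trajectory 𝒮 𝒜 H,
      ∏ h, (M.stateProb m τ h * π h (before τ h) (τ h).1 (τ h).2) = 1 := by
    intro m
    have h := sum_pathWeight (α := 𝒮 × 𝒜) (n := H)
      (fun h hist p => M.nextProb m h hist p.1 * π h hist p.1 p.2) (fun h hist => by
        rw [Fintype.sum_prod_type]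
        simp_rw [← Finset.mul_sum]
        rw [← M.sum_nextProb m h hist]
        refine Finset.sum_congr rfl fun s _ => ?_
        rw [sum_simplex, mul_one])
    simpa only [pathWeight, ← stateProb_eq_nextProb] using h
  simp only [trajProb]
  rw [Finset.sum_comm]
  simp_rw [← Finset.mul_sum, key, mul_one]
  exact M.ρ.2.2

/-- Any bound would do: it makes the supremum defining `optValue` a genuine one. -/
lemma value_le (M : LMDP 𝒮 𝒜 L H) (π : Policy 𝒮 𝒜 H) : M.value π ≤ H := by
  calc M.value π ≤ ∑ τ, M.trajProb π τ * (H : ℝ) := by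
        refine Finset.sum_le_sum fun τ _ =>
          mul_le_mul_of_nonneg_left ?_ (M.trajProb_nonneg π τ)
        calc ∑ h, M.reward.R h (τ h).1 (τ h).2 ≤ ∑ _h : Fin H, (1 : ℝ) :=
              Finset.sum_le_sum fun h _ => (M.reward.mem_Icc h _ _).2
          _ = H := by simp
    _ = H := by rw [← Finset.sum_mul, sum_trajProb, one_mul]

lemma value_le_optValue (M : LMDP 𝒮 𝒜 L H) (π : Policy 𝒮 𝒜 H) : M.value π ≤ M.optValue :=
  le_ciSup (f := fun π => M.value π) ⟨H, by rintro _ ⟨π, rfl⟩; exact M.value_le π⟩ π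

end LMDP

end Trajectories

/-! ### Testing against a reference model -/

section Testing

variable {𝒮 𝒜 : Type} [Fintype 𝒮] [Fintype 𝒜] {L H : ℕ}

namespace Protocol

lemma sum_dataProb (P : Protocol 𝒮 𝒜 H) (M : LMDP 𝒮 𝒜 L H) (ω : P.Ω) :
    ∑ D, P.dataProb M ω D = 1 :=
  sum_pathWeight (α := Trajectory 𝒮 𝒜 H)
    (fun t hist τ => M.trajProb (P.explore t hist ω) τ) fun _ _ => M.sum_trajProb _

lemma dataProb_nonneg (P : Protocol 𝒮 𝒜 H) (M : LMDP 𝒮 𝒜 L H) (ω : P.Ω)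
    (D : Fin P.episodes → Trajectory 𝒮 𝒜 H) : 0 ≤ P.dataProb M ω D :=
  Finset.prod_nonneg fun _ _ => M.trajProb_nonneg _ _

variable {ι : Type} [Fintype ι]

/-- Summed over a family of models, the total variation of the data from that in a reference model
is at most the number of episodes times the worst sum of one-episode total variations. -/
lemma sum_sum_abs_dataProb_sub_le (P : Protocol 𝒮 𝒜 H) (M₀ : LMDP 𝒮 𝒜 L H)
    (M : ι → LMDP 𝒮 𝒜 L H) (ω : P.Ω) {B : ℝ}
    (hB : ∀ π, ∑ i, ∑ τ, |(M i).trajProb π τ - M₀.trajProb π τ| ≤ B) :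
    ∑ i, ∑ D, |P.dataProb (M i) ω D - P.dataProb M₀ ω D| ≤ P.episodes * B := by
  calc ∑ i, ∑ D, |P.dataProb (M i) ω D - P.dataProb M₀ ω D|
      ≤ ∑ i, ∑ D, P.dataProb M₀ ω D * ∑ t : Fin P.episodes, ∑ τ,
          |(M i).trajProb (P.explore t (before D t) ω) τ -
            M₀.trajProb (P.explore t (before D t) ω) τ| := by
        refine Finset.sum_le_sum fun i _ => ?_
        exact sum_abs_pathWeight_sub_le (α := Trajectory 𝒮 𝒜 H)
          (fun t hist τ => M₀.trajProb (P.explore t hist ω) τ)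
          (fun t hist τ => (M i).trajProb (P.explore t hist ω) τ)
          (fun _ _ _ => M₀.trajProb_nonneg _ _) (fun _ _ _ => (M i).trajProb_nonneg _ _)
          (fun _ _ => M₀.sum_trajProb _) (fun _ _ => (M i).sum_trajProb _)
    -- The reference weights do not depend on `i`, so the sum over models moves inside, where `hB`
    -- applies to the policy in play.
    _ = ∑ D, P.dataProb M₀ ω D * ∑ t : Fin P.episodes, ∑ i, ∑ τ,
          |(M i).trajProb (P.explore t (before D t) ω) τ -
            M₀.trajProb (P.explore t (before D t) ω) τ| := by
        rw [Finset.sum_comm]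
        refine Finset.sum_congr rfl fun D _ => ?_
        rw [← Finset.mul_sum, Finset.sum_comm]
    _ ≤ ∑ D, P.dataProb M₀ ω D * (P.episodes * B) := by
        refine Finset.sum_le_sum fun D _ =>
          mul_le_mul_of_nonneg_left ?_ (P.dataProb_nonneg M₀ ω D)
        refine (Finset.sum_le_sum fun t _ => hB _).trans (le_of_eq ?_)
        simp
    _ = P.episodes * B := by rw [← Finset.sum_mul, sum_dataProb, one_mul]

open Classical in
/-- If no policy is near-optimal in more than `C` models of a family, and one episode barely
distinguishes the models from a reference model, then learning all of them takes many episodes. -/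
theorem card_le_of_successProb (P : Protocol 𝒮 𝒜 H) (M₀ : LMDP 𝒮 𝒜 L H)
    (M : ι → LMDP 𝒮 𝒜 L H) {ε B C : ℝ}
    (hB : ∀ π, ∑ i, ∑ τ, |(M i).trajProb π τ - M₀.trajProb π τ| ≤ B)
    (hC : ∀ π, ((Finset.univ.filter fun i => (M i).IsOptimal ε π).card : ℝ) ≤ C)
    (hs : ∀ i, 3 / 4 ≤ P.successProb (M i) ε) :
    3 / 4 * (Fintype.card ι : ℝ) ≤ C + P.episodes * B := by
  let _ := P.mΩ
  have := P.isProb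
  set f : ι → P.Ω → ℝ := fun i ω =>
    ∑ D, {D' | (M i).IsOptimal ε (P.output D' ω)}.indicator (P.dataProb (M i) ω) D with hf
  -- The integral of a non-integrable function is zero by convention, which `hs` excludes.
  have hinteg : ∀ i, Integrable (f i) P.seed := by
    intro i
    by_contra hni
    have h0 : P.successProb (M i) ε = 0 := integral_undef hni
    have := hs i
    rw [h0] at this
    norm_num at this
  have hpt : ∀ ω, ∑ i, f i ω ≤ C + P.episodes * B := by
    intro ω
    -- Success is charged to the reference law plus the variation. Under the reference law the data
    -- do not depend on `i`, so `hC` counts the models that one output serves.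
    have h1 : ∀ i, f i ω ≤ ∑ D, P.dataProb M₀ ω D *
          (if (M i).IsOptimal ε (P.output D ω) then 1 else 0) +
        ∑ D, |P.dataProb (M i) ω D - P.dataProb M₀ ω D| := by
      intro i
      rw [hf, ← Finset.sum_add_distrib]
      refine Finset.sum_le_sum fun D _ => ?_
      by_cases hD : (M i).IsOptimal ε (P.output D ω)
      · rw [Set.indicator_of_mem (by exact hD), if_pos hD, mul_one]
        linarith [le_abs_self (P.dataProb (M i) ω D - P.dataProb M₀ ω D)]
      · rw [Set.indicator_of_notMem (by exact hD), if_neg hD, mul_zero, zero_add]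
        exact abs_nonneg _
    refine (Finset.sum_le_sum fun i _ => h1 i).trans ?_
    rw [Finset.sum_add_distrib]
    refine add_le_add ?_ (P.sum_sum_abs_dataProb_sub_le M₀ M ω hB)
    rw [Finset.sum_comm]
    calc _ ≤ ∑ D, P.dataProb M₀ ω D * C := by
          refine Finset.sum_le_sum fun D _ => ?_
          rw [← Finset.mul_sum]
          refine mul_le_mul_of_nonneg_left ?_ (P.dataProb_nonneg M₀ ω D)
          rw [Finset.sum_boole]
          exact hC _
      _ = C := by rw [← Finset.sum_mul, sum_dataProb, one_mul]
  calc 3 / 4 * (Fintype.card ι : ℝ) = ∑ _i : ι, (3 / 4 : ℝ) := by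
        rw [Finset.sum_const, nsmul_eq_mul, Finset.card_univ, mul_comm]
    _ ≤ ∑ i, ∫ ω, f i ω ∂P.seed := Finset.sum_le_sum fun i _ => hs i
    _ = ∫ ω, ∑ i, f i ω ∂P.seed := (integral_finsetSum _ fun i _ => hinteg i).symm
    _ ≤ ∫ _ω, (C + P.episodes * B) ∂P.seed :=
        integral_mono (integrable_finsetSum _ fun i _ => hinteg i) (integrable_const _) hpt
    _ = C + P.episodes * B := by simp

end Protocol

end Testing

/-! ### Signs -/

/-- The sign as a real number. -/
def sgn : ℤˣ →* ℝ := (Int.castRingHom ℝ : ℤ →* ℝ).comp (Units.coeHom ℤ)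

@[simp] lemma sgn_neg_one : sgn (-1) = -1 := by simp [sgn]

lemma sgn_eq_or (y : ℤˣ) : sgn y = 1 ∨ sgn y = -1 := by
  rcases Int.units_eq_one_or y with rfl | rfl <;> simp

lemma abs_sgn (y : ℤˣ) : |sgn y| = 1 := by
  rcases sgn_eq_or y with h | h <;> simp [h]

lemma sum_units (f : ℤˣ → ℝ) : ∑ y, f y = f 1 + f (-1) := by
  rw [show (Finset.univ : Finset ℤˣ) = {1, -1} from rfl, Finset.sum_pair (by decide)]

lemma abs_sgn_mul_le {y : ℤˣ} {t : ℝ} (ht : |t| ≤ 1) : |sgn y * t| ≤ 1 := by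
  rwa [abs_mul, abs_sgn, one_mul]

lemma one_add_sgn_mul_nonneg {y : ℤˣ} {t : ℝ} (ht : |t| ≤ 1) : 0 ≤ 1 + sgn y * t := by
  linarith [(abs_le.mp (abs_sgn_mul_le (y := y) ht)).1]

/-- The noisy observation of a uniformly random coordinate of a sign vector, with bias `b`. -/
def obsDist {K : ℕ} [NeZero K] (b : ℝ) (hb : |b| ≤ 1) (x : Fin K → ℤˣ) :
    stdSimplex ℝ (Fin K × ℤˣ) :=
  ⟨fun o => (1 + sgn (x o.1 * o.2) * b) / (2 * K),
    fun o => div_nonneg (one_add_sgn_mul_nonneg hb) (by positivity), by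
      have hK : (K : ℝ) ≠ 0 := NeZero.ne _
      rw [Fintype.sum_prod_type]
      have : ∀ j : Fin K, ∑ y, (1 + sgn (x j * y) * b) / (2 * (K : ℝ)) = 1 / K := by
        intro j
        rw [sum_units, map_mul, map_mul]
        simp only [map_one, sgn_neg_one]
        field_simp
        ring
      simp only [this]
      simp [hK]⟩

lemma obsDist_apply {K : ℕ} [NeZero K] (b : ℝ) (hb : |b| ≤ 1) (x : Fin K → ℤˣ)
    (o : Fin K × ℤˣ) : obsDist b hb x o = (1 + sgn (x o.1 * o.2) * b) / (2 * K) := rfl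

/-- An observation together with an independent coin of mean `β`. -/
def withCoin {O : Type} [Fintype O] (p : stdSimplex ℝ O) (β : ℝ) (hβ : |β| ≤ 1) :
    stdSimplex ℝ (O × ℤˣ) :=
  ⟨fun w => p w.1 * ((1 + sgn w.2 * β) / 2),
    fun w => mul_nonneg (p.2.1 _) (div_nonneg (one_add_sgn_mul_nonneg hβ) zero_le_two), by
      rw [Fintype.sum_prod_type]
      refine (Finset.sum_congr rfl fun o _ => ?_).trans (sum_simplex p)
      rw [sum_units]
      simp only [map_one, sgn_neg_one]
      ring⟩

lemma withCoin_apply {O : Type} [Fintype O] (p : stdSimplex ℝ O) (β : ℝ) (hβ : |β| ≤ 1)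
    (w : O × ℤˣ) : withCoin p β hβ w = p w.1 * ((1 + sgn w.2 * β) / 2) := rfl

/-- The distribution on an encoded product whose first component is deterministic. -/
def withMemory {𝒮 C W : Type} [Fintype 𝒮] [Fintype C] [Fintype W] (enc : 𝒮 ≃ C × W) (c : C)
    (p : stdSimplex ℝ W) : stdSimplex ℝ 𝒮 := by
  classical
  exact ⟨fun s => if (enc s).1 = c then p (enc s).2 else 0, fun s => by
    change (0 : ℝ) ≤ if (enc s).1 = c then p (enc s).2 else 0
    split_ifs
    · exact p.2.1 _
    · exact le_rfl, by
    rw [enc.sum_comp (fun q : C × W => if q.1 = c then p q.2 else 0), Fintype.sum_prod_type,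
      Finset.sum_comm]
    refine (Finset.sum_congr rfl fun w _ => ?_).trans (sum_simplex p)
    simp⟩

open Classical in
lemma withMemory_apply {𝒮 C W : Type} [Fintype 𝒮] [Fintype C] [Fintype W] (enc : 𝒮 ≃ C × W) (c : C)
    (p : stdSimplex ℝ W) (s : 𝒮) :
    withMemory enc c p s = if (enc s).1 = c then p (enc s).2 else 0 := rfl

/-! ### Splitting finite sequences into three phases -/

lemma prod_three {a n : ℕ} (f : Fin (a + 1 + n) → ℝ) :
    ∏ h, f h = (∏ i : Fin a, f ⟨i, by omega⟩) * f ⟨a, by omega⟩ *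
      ∏ i : Fin n, f ⟨a + 1 + i, by omega⟩ := by
  rw [Fin.prod_univ_add, Fin.prod_univ_castSucc]
  rfl

lemma sum_three {α : Type} [Fintype α] {a n : ℕ} (f : (Fin (a + 1 + n) → α) → ℝ) :
    ∑ x, f x = ∑ x₁ : Fin a → α, ∑ y, ∑ x₂ : Fin n → α,
      f (Fin.append (Fin.snoc x₁ y : Fin (a + 1) → α) x₂) := by
  rw [← (Fin.appendEquiv (a + 1) n).sum_comp, Fintype.sum_prod_type, sum_snoc]
  rfl

/-- The law of the parity of independent coins, via its mean. -/
lemma sum_coins_parity {n : ℕ} (c : Fin n → ℝ) :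
    ∑ e : Fin n → ℤˣ, (∏ i, (1 + sgn (e i) * c i) / 2) * (if ∏ i, e i = 1 then 1 else 0) =
      (1 + ∏ i, c i) / 2 := by
  -- The indicator is affine in the sign, and the mean of a product of independent signs is the
  -- product of the means.
  have h1 : ∀ y : ℤˣ, (if y = 1 then (1 : ℝ) else 0) = (1 + sgn y) / 2 := by
    intro y
    rcases Int.units_eq_one_or y with rfl | rfl
    · simp
    · rw [if_neg (by decide)]; simp
  have h2 : ∀ e : Fin n → ℤˣ,
      (∏ i, (1 + sgn (e i) * c i) / 2) * (if ∏ i, e i = 1 then 1 else 0) =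
      (1 / 2) * ∏ i, (1 + sgn (e i) * c i) / 2 +
        (1 / 2) * ∏ i, (1 + sgn (e i) * c i) / 2 * sgn (e i) := by
    intro e
    rw [h1, map_prod, Finset.prod_mul_distrib]
    ring
  have h3 : ∀ φ : Fin n → ℤˣ → ℝ, ∑ e : Fin n → ℤˣ, ∏ i, φ i (e i) = ∏ i, ∑ y, φ i y := by
    intro φ
    rw [Finset.prod_univ_sum, Fintype.piFinset_univ]
  simp_rw [h2]
  rw [Finset.sum_add_distrib, ← Finset.mul_sum, ← Finset.mul_sum,
    h3 (fun i y => (1 + sgn y * c i) / 2), h3 (fun i y => (1 + sgn y * c i) / 2 * sgn y)]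
  simp_rw [sum_units, map_one, sgn_neg_one]
  have h4 : ∀ i, (1 + 1 * c i) / 2 + (1 + -1 * c i) / 2 = 1 := fun i => by ring
  have h5 : ∀ i, (1 + 1 * c i) / 2 * 1 + (1 + -1 * c i) / 2 * -1 = c i := fun i => by ring
  simp_rw [h4, h5]
  rw [Finset.prod_const_one]
  ring

/-! ### A latent combination lock behind a gate -/

/-- The data of a family of hard instances. Instance `m` has a codeword `x m`, of which a noisy
coordinate is observed at every step, and a role `u m`. A memory of type `𝓝` is updated by the
observations; with probability `g m` of the memory after `H₁` steps, a gate opens, behind which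
there is a lock of length `n`. -/
structure LockData (L K n H₁ : ℕ) (𝓝 : Type) where
  ρ : stdSimplex ℝ (Fin L)
  x : Fin L → Fin K → ℤˣ
  u : Fin L → Fin n → ℤˣ
  b : ℝ
  abs_b_le : |b| ≤ 1
  init : 𝓝
  upd : ℕ → 𝓝 → Fin K × ℤˣ → 𝓝
  g : Fin L → 𝓝 → ℝ
  g_mem : ∀ m ν, g m ν ∈ Set.Icc (0 : ℝ) 1

/-- The deterministic part of a state: the time, the memory, the gate and the parity of the coins
tossed behind the gate. -/
abbrev Core (n H₁ : ℕ) (𝓝 : Type) : Type := Fin (H₁ + 1 + n) × 𝓝 × ℤˣ × ℤˣ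

/-- The random part of a state: an observation and a coin. -/
abbrev Innov (K : ℕ) : Type := (Fin K × ℤˣ) × ℤˣ

/-- The time at which the gate opens or stays shut. -/
abbrev gateTime (n H₁ : ℕ) : Fin (H₁ + 1 + n) := ⟨H₁, by omega⟩

/-- The time at which the outcome of the `i`-th lock step is observed. -/
abbrev lockTime {n : ℕ} (H₁ : ℕ) (i : Fin n) : Fin (H₁ + 1 + n) := ⟨H₁ + 1 + i, by omega⟩

/-- The time at which the action of the `i`-th lock step is chosen. -/
abbrev actTime {n : ℕ} (H₁ : ℕ) (i : Fin n) : Fin (H₁ + 1 + n) := ⟨H₁ + i, by omega⟩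

/-- The last time. -/
abbrev lastTime (n H₁ : ℕ) : Fin (H₁ + 1 + n) := ⟨H₁ + n, by omega⟩

namespace LockData

variable {L K n H₁ : ℕ} {𝓝 𝒮 𝒜 : Type} [NeZero K] [Fintype 𝓝] [Fintype 𝒮] [Fintype 𝒜]

/-- The mean of the coin tossed on arrival at time `h`; `χ i` is the set of actions that activate
the `i`-th step of the lock. -/
def bias (Q : LockData L K n H₁ 𝓝) (χ : Fin n → 𝒜 → Bool) (m : Fin L) (h : ℕ) (ν : 𝓝)
    (gate : ℤˣ) (a : 𝒜) : ℝ :=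
  if h < H₁ then 0
  else if h = H₁ then 2 * Q.g m ν - 1
  else if hn : h - (H₁ + 1) < n then
    if gate = 1 ∧ χ ⟨h - (H₁ + 1), hn⟩ a = true then sgn (Q.u m ⟨h - (H₁ + 1), hn⟩) else 0
  else 0

lemma abs_bias_le (Q : LockData L K n H₁ 𝓝) (χ : Fin n → 𝒜 → Bool) (m : Fin L) (h : ℕ) (ν : 𝓝)
    (gate : ℤˣ) (a : 𝒜) : |Q.bias χ m h ν gate a| ≤ 1 := by
  unfold bias
  have := Q.g_mem m ν
  split_ifs
  · simp
  · rw [abs_le]; constructor <;> linarith [this.1, this.2]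
  · rw [abs_sgn]
  · simp
  · simp

/-- The distribution of the observations. -/
def obs (Q : LockData L K n H₁ 𝓝) (m : Fin L) : stdSimplex ℝ (Fin K × ℤˣ) :=
  obsDist Q.b Q.abs_b_le (Q.x m)

/-- The deterministic update of the core. -/
def nextCore (Q : LockData L K n H₁ 𝓝) (c : Core n H₁ 𝓝) (w : Innov K) : Core n H₁ 𝓝 :=
  -- The clock wraps only to make the update total; no episode reaches the wrap.
  (⟨(c.1 + 1) % (H₁ + 1 + n), Nat.mod_lt _ (by omega)⟩, Q.upd c.1 c.2.1 w.1,
    if (c.1 : ℕ) = H₁ then w.2 else c.2.2.1,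
    if H₁ < (c.1 : ℕ) then c.2.2.2 * w.2 else c.2.2.2)

/-- The reward: one unit at the end of the episode if the gate is open and the lock coins have
parity one. -/
def lockReward (enc : 𝒮 ≃ Core n H₁ 𝓝 × Innov K) : Reward 𝒮 𝒜 (H₁ + 1 + n) where
  -- The coin of the current state enters the stored parity only at the next update, so the last
  -- coin is multiplied in here.
  R h s _ := if h = lastTime n H₁ ∧ (enc s).1.2.2.1 = 1 ∧
    (enc s).1.2.2.2 * (enc s).2.2 = 1 then 1 else 0
  mem_Icc h s a := by split_ifs <;> simp
  sum_sup_le_one := by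
    calc _ ≤ ∑ h : Fin (H₁ + 1 + n), (if h = lastTime n H₁ then (1 : ℝ) else 0) := by
          refine Finset.sum_le_sum fun h _ => ?_
          refine Real.iSup_le (fun p => ?_) (by split_ifs <;> simp)
          by_cases hh : h = lastTime n H₁
          · rw [if_pos hh]; split_ifs <;> simp
          · rw [if_neg hh, if_neg (fun H => hh H.1)]
      _ = 1 := by simp

/-- The latent MDP given by lock data, an encoding of its states, and the activating actions. -/
def model (Q : LockData L K n H₁ 𝓝) (enc : 𝒮 ≃ Core n H₁ 𝓝 × Innov K)
    (χ : Fin n → 𝒜 → Bool) : LMDP 𝒮 𝒜 L (H₁ + 1 + n) where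
  ρ := Q.ρ
  ν m := withMemory enc (⟨0, by omega⟩, Q.init, 1, 1) (withCoin (Q.obs m) 0 (by simp))
  T m s a :=
    withMemory enc (Q.nextCore (enc s).1 (enc s).2)
      (withCoin (Q.obs m)
        (Q.bias χ m (Q.nextCore (enc s).1 (enc s).2).1 (Q.nextCore (enc s).1 (enc s).2).2.1
          (Q.nextCore (enc s).1 (enc s).2).2.2.1 a)
        (Q.abs_bias_le χ m _ _ _ a))
  reward := lockReward enc

/-! #### Separation -/

/-- Coordinates of agreement cancel; each other one contributes `2b / K` to the `ℓ¹` distance. -/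
lemma tv_obsDist {b : ℝ} (hb : |b| ≤ 1) (hb0 : 0 ≤ b) (x y : Fin K → ℤˣ) :
    tv (obsDist b hb x) (obsDist b hb y) = b * hammingDist x y / K := by
  have hK : (0 : ℝ) < K := Nat.cast_pos.mpr (NeZero.pos K)
  have h1 : ∀ j : Fin K, ∑ z : ℤˣ, |obsDist b hb x (j, z) - obsDist b hb y (j, z)| =
      if x j ≠ y j then 2 * b / K else 0 := by
    intro j
    rw [sum_units]
    simp only [obsDist_apply, ← sub_div, map_mul, sgn_neg_one, map_one]
    have h2 : ∀ t : ℝ, |t / (2 * (K : ℝ))| = |t| / (2 * K) := fun t => by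
      rw [abs_div, abs_of_pos (by positivity : (0 : ℝ) < 2 * K)]
    rw [h2, h2]
    rcases Int.units_eq_one_or (x j) with hx | hx <;>
      rcases Int.units_eq_one_or (y j) with hy | hy <;> rw [hx, hy]
    · simp
    · rw [if_pos (by decide), map_one, sgn_neg_one,
        show 1 + 1 * 1 * b - (1 + -1 * 1 * b) = 2 * b by ring,
        show 1 + 1 * -1 * b - (1 + -1 * -1 * b) = -(2 * b) by ring, abs_neg,
        abs_of_nonneg (by positivity)]
      field_simp; ring
    · rw [if_pos (by decide), map_one, sgn_neg_one,
        show 1 + -1 * 1 * b - (1 + 1 * 1 * b) = -(2 * b) by ring,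
        show 1 + -1 * -1 * b - (1 + 1 * -1 * b) = (2 * b) by ring, abs_neg,
        abs_of_nonneg (by positivity)]
      field_simp; ring
    · simp
  rw [tv, Fintype.sum_prod_type]
  simp_rw [h1]
  rw [← Finset.sum_filter, Finset.sum_const, nsmul_eq_mul]
  rw [show (Finset.univ.filter fun j => x j ≠ y j).card = hammingDist x y from rfl]
  ring

/-- Forgetting the coin cannot increase total variation. -/
lemma tv_withCoin {O : Type} [Fintype O] (p q : stdSimplex ℝ O) {β γ : ℝ} (hβ : |β| ≤ 1)
    (hγ : |γ| ≤ 1) : tv p q ≤ tv (withCoin p β hβ) (withCoin q γ hγ) := by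
  unfold tv
  rw [Fintype.sum_prod_type]
  refine mul_le_mul_of_nonneg_left (Finset.sum_le_sum fun o _ => ?_) (by norm_num)
  refine le_trans (le_of_eq ?_) (Finset.abs_sum_le_sum_abs _ _)
  rw [sum_units]
  change _ = |p o * ((1 + sgn 1 * β) / 2) - q o * ((1 + sgn 1 * γ) / 2) +
    (p o * ((1 + sgn (-1) * β) / 2) - q o * ((1 + sgn (-1) * γ) / 2))|
  rw [map_one, sgn_neg_one]
  congr 1
  ring

lemma tv_withMemory {C W : Type} [Fintype C] [Fintype W] (enc : 𝒮 ≃ C × W) (c : C)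
    (p q : stdSimplex ℝ W) : tv (withMemory enc c p) (withMemory enc c q) = tv p q := by
  classical
  unfold tv
  simp only [withMemory_apply]
  congr 1
  rw [enc.sum_comp (fun r : C × W => |(if r.1 = c then p r.2 else 0) -
    (if r.1 = c then q r.2 else 0)|), Fintype.sum_prod_type, Finset.sum_comm]
  refine Finset.sum_congr rfl fun w _ => ?_
  rw [Finset.sum_eq_single c]
  · simp
  · intro c' _ hc; simp [hc]
  · simp

/-- Every state, reachable or not, emits a fresh observation whatever the action, and the next core
is the same in all instances; so the observations alone separate. -/
lemma model_stronglySeparated (Q : LockData L K n H₁ 𝓝) (enc : 𝒮 ≃ Core n H₁ 𝓝 × Innov K)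
    (χ : Fin n → 𝒜 → Bool) {δ : ℝ} (hb : 0 ≤ Q.b)
    (hsep : ∀ m l, Q.ρ m ≠ 0 → Q.ρ l ≠ 0 → m ≠ l →
      δ ≤ Q.b * hammingDist (Q.x m) (Q.x l) / K) :
    (Q.model enc χ).StronglySeparated δ := by
  intro m l hm hl hml s a
  refine (hsep m l hm hl hml).trans ?_
  rw [← tv_obsDist Q.abs_b_le hb]
  refine (tv_withCoin _ _ _ _).trans (le_of_eq (tv_withMemory enc _ _ _).symm)

/-! #### The state sequence determined by the observations and coins -/

/-- The memory after `k` steps. -/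
def obsMem (Q : LockData L K n H₁ 𝓝) (o : Fin (H₁ + 1 + n) → Fin K × ℤˣ) : ℕ → 𝓝
  | 0 => Q.init
  | k + 1 => if hk : k < H₁ + 1 + n then Q.upd k (obsMem Q o k) (o ⟨k, hk⟩) else obsMem Q o k

/-- The core at time `h`. -/
def coreAt (Q : LockData L K n H₁ 𝓝) (w : Fin (H₁ + 1 + n) → Innov K) (h : Fin (H₁ + 1 + n)) :
    Core n H₁ 𝓝 :=
  (h, Q.obsMem (fun h => (w h).1) h, if H₁ < (h : ℕ) then (w (gateTime n H₁)).2 else 1,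
    ∏ k ∈ Finset.univ.filter (fun k : Fin (H₁ + 1 + n) => H₁ < (k : ℕ) ∧ k < h), (w k).2)

lemma nextCore_coreAt (Q : LockData L K n H₁ 𝓝) (w : Fin (H₁ + 1 + n) → Innov K) (k : ℕ)
    (hk : k + 1 < H₁ + 1 + n) :
    Q.nextCore (Q.coreAt w ⟨k, by omega⟩) (w ⟨k, by omega⟩) = Q.coreAt w ⟨k + 1, hk⟩ := by
  have hk' : k < H₁ + 1 + n := by omega
  unfold nextCore coreAt
  refine Prod.ext ?_ (Prod.ext ?_ (Prod.ext ?_ ?_))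
  · simp [Nat.mod_eq_of_lt hk]
  · simp [obsMem, hk']
  · by_cases h1 : k = H₁
    · subst h1; simp
    · simp only [h1, if_false]
      by_cases h2 : H₁ < k
      · rw [if_pos h2, if_pos (by omega)]
      · rw [if_neg h2, if_neg (by omega)]
  · dsimp only
    by_cases h2 : H₁ < k
    · rw [if_pos h2]
      have : Finset.univ.filter (fun j : Fin (H₁ + 1 + n) => H₁ < (j : ℕ) ∧ j < ⟨k + 1, hk⟩) =
          insert ⟨k, hk'⟩
            (Finset.univ.filter fun j : Fin (H₁ + 1 + n) => H₁ < (j : ℕ) ∧ j < ⟨k, hk'⟩) := by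
        ext j
        simp only [Finset.mem_filter, Finset.mem_univ, true_and, Finset.mem_insert, Fin.ext_iff,
          Fin.lt_def]
        omega
      rw [this, Finset.prod_insert (by simp), mul_comm]
    · rw [if_neg h2]
      refine Finset.prod_congr ?_ fun _ _ => rfl
      ext j
      simp only [Finset.mem_filter, Finset.mem_univ, true_and, Fin.lt_def]
      omega

/-- The states determined by the observations and coins. -/
def path (Q : LockData L K n H₁ 𝓝) (enc : 𝒮 ≃ Core n H₁ 𝓝 × Innov K)
    (w : Fin (H₁ + 1 + n) → Innov K) : Fin (H₁ + 1 + n) → 𝒮 :=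
  fun h => enc.symm (Q.coreAt w h, w h)

/-- The observations and coins of a sequence of states. -/
def innov (enc : 𝒮 ≃ Core n H₁ 𝓝 × Innov K) (s : Fin (H₁ + 1 + n) → 𝒮) :
    Fin (H₁ + 1 + n) → Innov K :=
  fun h => (enc (s h)).2

lemma innov_path (Q : LockData L K n H₁ 𝓝) (enc : 𝒮 ≃ Core n H₁ 𝓝 × Innov K)
    (w : Fin (H₁ + 1 + n) → Innov K) : innov enc (Q.path enc w) = w := by
  funext h
  simp [innov, path]

/-- Each factor contains the indicator that the core is the prescribed one, so a single wrong core
kills the product. -/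
lemma eq_path_of_prod_ne_zero (Q : LockData L K n H₁ 𝓝) (enc : 𝒮 ≃ Core n H₁ 𝓝 × Innov K)
    (χ : Fin n → 𝒜 → Bool) (m : Fin L) (τ : Trajectory 𝒮 𝒜 (H₁ + 1 + n))
    (h : ∏ h, (Q.model enc χ).stateProb m τ h ≠ 0) :
    (fun h => (τ h).1) = Q.path enc (innov enc fun h => (τ h).1) := by
  have hne : ∀ h, (Q.model enc χ).stateProb m τ h ≠ 0 := fun h' =>
    Finset.prod_ne_zero_iff.mp h h' (Finset.mem_univ _)
  set w := innov enc fun h => (τ h).1 with hw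
  have key : ∀ k (hk : k < H₁ + 1 + n), (enc (τ ⟨k, hk⟩).1).1 = Q.coreAt w ⟨k, hk⟩ := by
    intro k
    induction k with
    | zero =>
      intro hk
      have h0 := hne ⟨0, hk⟩
      have h1 : (enc (τ ⟨0, hk⟩).1).1 = (⟨0, hk⟩, Q.init, 1, 1) := by
        by_contra hc
        apply h0
        simp only [LMDP.stateProb, model]
        rw [withMemory_apply, if_neg hc]
      rw [h1]
      simp [coreAt, obsMem]
    | succ k ih =>
      intro hk
      have h0 := hne ⟨k + 1, hk⟩
      have h1 : (enc (τ ⟨k + 1, hk⟩).1).1 = Q.nextCore (enc (τ ⟨k, by omega⟩).1).1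
          (enc (τ ⟨k, by omega⟩).1).2 := by
        by_contra hc
        apply h0
        simp only [LMDP.stateProb, model]
        rw [withMemory_apply, if_neg hc]
      rw [h1, ih (by omega), ← nextCore_coreAt Q w k hk]
      rfl
  funext h
  simp only [path, Equiv.eq_symm_apply]
  exact Prod.ext (key h h.2) rfl

lemma stateWeight_eq_zero (Q : LockData L K n H₁ 𝓝) (enc : 𝒮 ≃ Core n H₁ 𝓝 × Innov K)
    (χ : Fin n → 𝒜 → Bool) (τ : Trajectory 𝒮 𝒜 (H₁ + 1 + n))
    (h : (fun h => (τ h).1) ≠ Q.path enc (innov enc fun h => (τ h).1)) :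
    (Q.model enc χ).stateWeight τ = 0 := by
  refine Finset.sum_eq_zero fun m _ => ?_
  rw [not_ne_iff.mp fun h0 => h (Q.eq_path_of_prod_ne_zero enc χ m τ h0), mul_zero]

open Classical in
/-- Summing over consistent state sequences is summing over observations and coins. -/
lemma sum_path (Q : LockData L K n H₁ 𝓝) (enc : 𝒮 ≃ Core n H₁ 𝓝 × Innov K)
    (f : (Fin (H₁ + 1 + n) → 𝒮) → ℝ)
    (hf : ∀ s, s ≠ Q.path enc (innov enc s) → f s = 0) :
    ∑ s, f s = ∑ w, f (Q.path enc w) := by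
  symm
  refine Finset.sum_of_injOn (Q.path enc) ?_ (fun _ _ => Finset.mem_univ _) ?_ (fun _ _ => rfl)
  · intro w _ w' _ hww
    rw [← Q.innov_path enc w, hww, Q.innov_path enc w']
  · intro s _ hs
    refine hf s fun h => hs ?_
    exact ⟨innov enc s, Finset.mem_univ _, h.symm⟩

/-- The initial coin is fair, which agrees with `bias` at time zero because the gate time is
positive. At time zero the truncated `h - 1` names an action that `bias` ignores. -/
lemma stateProb_of_path (Q : LockData L K n H₁ 𝓝) (enc : 𝒮 ≃ Core n H₁ 𝓝 × Innov K)
    (χ : Fin n → 𝒜 → Bool) (m : Fin L) (hH : 1 ≤ H₁) (τ : Trajectory 𝒮 𝒜 (H₁ + 1 + n))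
    (w : Fin (H₁ + 1 + n) → Innov K) (hτ : ∀ h, (τ h).1 = Q.path enc w h)
    (h : Fin (H₁ + 1 + n)) :
    (Q.model enc χ).stateProb m τ h = Q.obs m (w h).1 * ((1 + sgn (w h).2 *
      Q.bias χ m h (Q.obsMem (fun h => (w h).1) h)
        (if H₁ < (h : ℕ) then (w (gateTime n H₁)).2 else 1)
        (τ ⟨h - 1, by omega⟩).2) / 2) := by
  have henc : ∀ h, enc (τ h).1 = (Q.coreAt w h, w h) := fun h => by
    rw [hτ]; simp [path]
  rcases h with ⟨_ | k, hk⟩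
  · simp only [LMDP.stateProb, model]
    rw [withMemory_apply, henc, if_pos (by simp [coreAt, obsMem])]
    rw [bias, if_pos (by omega)]
    rfl
  · have hnext : Q.nextCore (enc (τ ⟨k, by omega⟩).1).1 (enc (τ ⟨k, by omega⟩).1).2 =
        Q.coreAt w ⟨k + 1, hk⟩ := by rw [henc, ← Q.nextCore_coreAt w k hk]
    simp only [LMDP.stateProb, model]
    rw [withMemory_apply, henc ⟨k + 1, hk⟩, if_pos hnext.symm, withCoin_apply, hnext]
    rfl

/-- The likelihood of the observations. -/
def obsWeight (Q : LockData L K n H₁ 𝓝) (m : Fin L) (o : Fin (H₁ + 1 + n) → Fin K × ℤˣ) : ℝ :=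
  ∏ h, Q.obs m (o h)

/-- The probability that the gate opens after the given observations. -/
def gateProb (Q : LockData L K n H₁ 𝓝) (m : Fin L) (o : Fin (H₁ + 1 + n) → Fin K × ℤˣ) : ℝ :=
  Q.g m (Q.obsMem o H₁)

lemma gateProb_mem (Q : LockData L K n H₁ 𝓝) (m : Fin L)
    (o : Fin (H₁ + 1 + n) → Fin K × ℤˣ) : Q.gateProb m o ∈ Set.Icc (0 : ℝ) 1 := Q.g_mem _ _

lemma obsWeight_nonneg (Q : LockData L K n H₁ 𝓝) (m : Fin L)
    (o : Fin (H₁ + 1 + n) → Fin K × ℤˣ) : 0 ≤ Q.obsWeight m o :=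
  Finset.prod_nonneg fun _ _ => (Q.obs m).2.1 _

/-- The likelihood of a consistent trajectory in instance `m`. -/
lemma prod_stateProb_of_path (Q : LockData L K n H₁ 𝓝) (enc : 𝒮 ≃ Core n H₁ 𝓝 × Innov K)
    (χ : Fin n → 𝒜 → Bool) (m : Fin L) (hH : 1 ≤ H₁) (τ : Trajectory 𝒮 𝒜 (H₁ + 1 + n))
    (w : Fin (H₁ + 1 + n) → Innov K) (hτ : ∀ h, (τ h).1 = Q.path enc w h) :
    ∏ h, (Q.model enc χ).stateProb m τ h =
      Q.obsWeight m (fun h => (w h).1) * ((1 / 2) ^ H₁ *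
        ((1 + sgn (w (gateTime n H₁)).2 * (2 * Q.gateProb m (fun h => (w h).1) - 1)) / 2) *
        ∏ i : Fin n, (1 + sgn (w (lockTime H₁ i)).2 *
          (if (w (gateTime n H₁)).2 = 1 ∧ χ i (τ (actTime H₁ i)).2 = true then sgn (Q.u m i)
            else 0)) / 2) := by
  simp_rw [Q.stateProb_of_path enc χ m hH τ w hτ, Finset.prod_mul_distrib]
  congr 1
  rw [prod_three]
  congr 1
  · congr 1
    · rw [Finset.prod_eq_pow_card (b := 1 / 2)]
      · simp
      · intro i _
        rw [bias, if_pos i.2]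
        simp
    · rw [bias, if_neg (lt_irrefl _), if_pos rfl]
      rfl
  · refine Finset.prod_congr rfl fun i _ => ?_
    have h1 : H₁ + 1 + (i : ℕ) - (H₁ + 1) = i := by omega
    have h2 : (⟨H₁ + 1 + (i : ℕ) - 1, by omega⟩ : Fin (H₁ + 1 + n)) = actTime H₁ i := by
      simp only [Fin.mk.injEq]; omega
    have h3 : H₁ + 1 + (i : ℕ) - (H₁ + 1) < n := by omega
    have h4 : (⟨H₁ + 1 + (i : ℕ) - (H₁ + 1), h3⟩ : Fin n) = i := Fin.ext h1
    rw [bias, if_neg (by dsimp only; omega), if_neg (by dsimp only; omega), dif_pos h3]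
    rw [h4, if_pos (show H₁ < H₁ + 1 + (i : ℕ) by omega), h2]

end LockData

namespace LockData

variable {L K n H₁ : ℕ} {𝓝 𝒮 𝒜 : Type} [NeZero K] [Fintype 𝓝] [Fintype 𝒮] [Fintype 𝒜]

/-! #### Values of the lock -/

/-- The lock opened by a secret sequence of actions. -/
def secretLock [DecidableEq 𝒜] (v : Fin n → 𝒜) : Fin n → 𝒜 → Bool := fun i a => decide (a = v i)

/-- The lock that no action sequence opens. -/
def noLock : Fin n → 𝒜 → Bool := fun _ _ => false

/-- The final reward as a function of the states. -/
def finalReward (enc : 𝒮 ≃ Core n H₁ 𝓝 × Innov K) (s : Fin (H₁ + 1 + n) → 𝒮) : ℝ :=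
  if (enc (s (lastTime n H₁))).1.2.2.1 = 1 ∧
    (enc (s (lastTime n H₁))).1.2.2.2 * (enc (s (lastTime n H₁))).2.2 = 1 then 1 else 0

lemma finalReward_mem (enc : 𝒮 ≃ Core n H₁ 𝓝 × Innov K) (s : Fin (H₁ + 1 + n) → 𝒮) :
    finalReward enc s ∈ Set.Icc (0 : ℝ) 1 := by
  unfold finalReward
  split_ifs <;> simp

/-- Since `n ≥ 1`, the last time lies past the gate and is the last lock time: the gate coin is
already stored, and only the last coin is missing from the stored parity. -/
lemma finalReward_path (Q : LockData L K n H₁ 𝓝) (enc : 𝒮 ≃ Core n H₁ 𝓝 × Innov K) (hn : 1 ≤ n)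
    (w : Fin (H₁ + 1 + n) → Innov K) :
    finalReward enc (Q.path enc w) =
      if (w (gateTime n H₁)).2 = 1 ∧ ∏ i : Fin n, (w (lockTime H₁ i)).2 = 1 then 1 else 0 := by
  have h1 : (∏ k ∈ Finset.univ.filter (fun k : Fin (H₁ + 1 + n) =>
      H₁ < (k : ℕ) ∧ k < lastTime n H₁), (w k).2) * (w (lastTime n H₁)).2 =
        ∏ i : Fin n, (w (lockTime H₁ i)).2 := by
    rw [mul_comm, ← Finset.prod_insert (f := fun k => (w k).2) (by simp)]
    symm
    refine Finset.prod_bij (fun i _ => lockTime H₁ i) ?_ ?_ ?_ ?_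
    · intro i _
      simp only [Finset.mem_insert, Finset.mem_filter, Finset.mem_univ, true_and, Fin.lt_def,
        Fin.ext_iff]
      omega
    · intro i _ j _ hij
      simp only [Fin.mk.injEq] at hij
      exact Fin.ext (by omega)
    · intro k hk
      simp only [Finset.mem_insert, Finset.mem_filter, Finset.mem_univ, true_and, Fin.lt_def,
        Fin.ext_iff] at hk
      refine ⟨⟨k - (H₁ + 1), by omega⟩, Finset.mem_univ _, ?_⟩
      ext
      simp only
      omega
    · intro i _
      rfl
  have h2 : H₁ < H₁ + n := by omega
  unfold finalReward path coreAt
  simp only [Equiv.apply_symm_apply, h2, if_true, h1]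

lemma value_model (Q : LockData L K n H₁ 𝓝) (enc : 𝒮 ≃ Core n H₁ 𝓝 × Innov K)
    (χ : Fin n → 𝒜 → Bool) (π : Policy 𝒮 𝒜 (H₁ + 1 + n)) :
    (Q.model enc χ).value π =
      ∑ τ, (Q.model enc χ).trajProb π τ * finalReward enc (fun h => (τ h).1) := by
  unfold LMDP.value
  refine Finset.sum_congr rfl fun τ _ => ?_
  congr 1
  simp only [model, lockReward, finalReward]
  rw [Finset.sum_eq_single (lastTime n H₁)]
  · simp
  · intro h _ hh
    simp [hh]
  · simp

/-- The probability that the gate opens. -/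
def openProb (Q : LockData L K n H₁ 𝓝) : ℝ :=
  ∑ m, Q.ρ m * ∑ o, Q.obsWeight m o * Q.gateProb m o

/-- Only an open gate counts, with probability `(1 + (2γ - 1)) / 2 = γ`. The `H₁` fair coins before
it sum out, and `sum_coins_parity` treats the rest. -/
lemma sum_coins (γ : ℝ) (c : Fin n → ℝ) :
    ∑ e : Fin (H₁ + 1 + n) → ℤˣ, ((1 / 2) ^ H₁ *
        ((1 + sgn (e (gateTime n H₁)) * (2 * γ - 1)) / 2) *
        ∏ i : Fin n, (1 + sgn (e (lockTime H₁ i)) *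
          (if e (gateTime n H₁) = 1 then c i else 0)) / 2) *
      (if e (gateTime n H₁) = 1 ∧ ∏ i : Fin n, e (lockTime H₁ i) = 1 then 1 else 0) =
    γ * ((1 + ∏ i, c i) / 2) := by
  have hg : ∀ (e₁ : Fin H₁ → ℤˣ) (y : ℤˣ) (e₂ : Fin n → ℤˣ),
      Fin.append (Fin.snoc e₁ y : Fin (H₁ + 1) → ℤˣ) e₂ (gateTime n H₁) = y := by
    intro e₁ y e₂
    have := Fin.append_left (Fin.snoc e₁ y : Fin (H₁ + 1) → ℤˣ) e₂ (Fin.last H₁)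
    rw [Fin.snoc_last] at this
    exact this
  have hl : ∀ (e₁ : Fin H₁ → ℤˣ) (y : ℤˣ) (e₂ : Fin n → ℤˣ) (i : Fin n),
      Fin.append (Fin.snoc e₁ y : Fin (H₁ + 1) → ℤˣ) e₂ (lockTime H₁ i) = e₂ i := by
    intro e₁ y e₂ i
    exact Fin.append_right (Fin.snoc e₁ y : Fin (H₁ + 1) → ℤˣ) e₂ i
  rw [sum_three]
  simp_rw [hg, hl, sum_units]
  have h1 : ((-1 : ℤˣ) = 1) = False := by simp
  simp only [h1, false_and, if_false, mul_zero, Finset.sum_const_zero, add_zero, true_and,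
    if_true, map_one, one_mul]
  simp_rw [mul_assoc, ← Finset.mul_sum]
  rw [sum_coins_parity, Finset.sum_const, nsmul_eq_mul]
  have h2 : ((Finset.univ : Finset (Fin H₁ → ℤˣ)).card : ℝ) * (1 / 2) ^ H₁ = 1 := by
    rw [Finset.card_univ, Fintype.card_fun, Fintype.card_fin, Fintype.card_units_int]
    push_cast
    rw [← mul_pow]
    norm_num
  linear_combination (γ * ((1 + ∏ i, c i) / 2)) * h2

/-- The mean reward when the action sequence is fixed. -/
lemma sum_stateWeight_mul_finalReward (Q : LockData L K n H₁ 𝓝)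
    (enc : 𝒮 ≃ Core n H₁ 𝓝 × Innov K) (χ : Fin n → 𝒜 → Bool) (hn : 1 ≤ n) (hH : 1 ≤ H₁)
    (a : Fin (H₁ + 1 + n) → 𝒜) :
    ∑ s, (Q.model enc χ).stateWeight (fun h => (s h, a h)) * finalReward enc s =
      ∑ m, Q.ρ m * ∑ o, Q.obsWeight m o * Q.gateProb m o *
        ((1 + ∏ i, if χ i (a (actTime H₁ i)) = true then sgn (Q.u m i) else 0) / 2) := by
  rw [Q.sum_path enc]
  swap
  · intro s hs
    rw [Q.stateWeight_eq_zero enc χ (fun h => (s h, a h)) hs, zero_mul]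
  have h1 : ∀ w : Fin (H₁ + 1 + n) → Innov K,
      (Q.model enc χ).stateWeight (fun h => (Q.path enc w h, a h)) *
        finalReward enc (Q.path enc w) =
      ∑ m, Q.ρ m * (Q.obsWeight m (fun h => (w h).1) * (((1 / 2) ^ H₁ *
        ((1 + sgn (w (gateTime n H₁)).2 * (2 * Q.gateProb m (fun h => (w h).1) - 1)) / 2) *
        ∏ i : Fin n, (1 + sgn (w (lockTime H₁ i)).2 *
          (if (w (gateTime n H₁)).2 = 1 then
            (if χ i (a (actTime H₁ i)) = true then sgn (Q.u m i) else 0) else 0)) / 2) *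
      (if (w (gateTime n H₁)).2 = 1 ∧ ∏ i : Fin n, (w (lockTime H₁ i)).2 = 1
        then 1 else 0))) := by
    intro w
    rw [Q.finalReward_path enc hn, LMDP.stateWeight, Finset.sum_mul]
    refine Finset.sum_congr rfl fun m _ => ?_
    rw [Q.prod_stateProb_of_path enc χ m hH _ w fun _ => rfl]
    simp_rw [ite_and]
    simp only [model]
    ring
  simp_rw [h1]
  rw [Finset.sum_comm]
  refine Finset.sum_congr rfl fun m _ => ?_
  rw [← Finset.mul_sum]
  congr 1
  rw [← (Equiv.arrowProdEquivProdArrow (Fin (H₁ + 1 + n)) (fun _ => Fin K × ℤˣ)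
    (fun _ => ℤˣ)).symm.sum_comp, Fintype.sum_prod_type]
  refine Finset.sum_congr rfl fun o _ => ?_
  rw [mul_assoc, ← sum_coins (H₁ := H₁) (Q.gateProb m o)
    (fun i => if χ i (a (actTime H₁ i)) = true then sgn (Q.u m i) else 0), Finset.mul_sum]
  rfl

/-- Without a lock, the likelihood of the states does not depend on the actions. -/
lemma stateWeight_noLock_congr (Q : LockData L K n H₁ 𝓝) (enc : 𝒮 ≃ Core n H₁ 𝓝 × Innov K)
    (hH : 1 ≤ H₁) (τ : Trajectory 𝒮 𝒜 (H₁ + 1 + n)) (a : Fin (H₁ + 1 + n) → 𝒜) :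
    (Q.model enc noLock).stateWeight τ =
      (Q.model enc noLock).stateWeight (fun h => ((τ h).1, a h)) := by
  by_cases hτ : (fun h => (τ h).1) = Q.path enc (innov enc fun h => (τ h).1)
  · unfold LMDP.stateWeight
    refine Finset.sum_congr rfl fun m _ => ?_
    rw [Q.prod_stateProb_of_path enc noLock m hH τ _ (fun h => congrFun hτ h),
      Q.prod_stateProb_of_path enc noLock m hH (fun h => ((τ h).1, a h)) _
        (fun h => congrFun hτ h)]
    simp [noLock]
  · rw [Q.stateWeight_eq_zero enc _ τ hτ,
      Q.stateWeight_eq_zero enc _ (fun h => ((τ h).1, a h)) hτ]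

/-- The likelihood ignores the actions, so the policy averages out, and behind an open gate the
parity of at least one fair coin is fair. -/
lemma value_noLock [Nonempty 𝒜] (Q : LockData L K n H₁ 𝓝) (enc : 𝒮 ≃ Core n H₁ 𝓝 × Innov K)
    (hn : 1 ≤ n) (hH : 1 ≤ H₁) (π : Policy 𝒮 𝒜 (H₁ + 1 + n)) :
    (Q.model enc noLock).value π = Q.openProb / 2 := by
  obtain ⟨a₀⟩ := ‹Nonempty 𝒜›
  rw [value_model]
  simp_rw [LMDP.trajProb_eq, Q.stateWeight_noLock_congr enc hH _ (fun _ => a₀), mul_assoc]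
  rw [π.sum_weight_mul (fun s => (Q.model enc noLock).stateWeight (fun h => (s h, a₀)) *
    finalReward enc s), Q.sum_stateWeight_mul_finalReward enc noLock hn hH (fun _ => a₀)]
  have h0 : (∏ _i : Fin n, (0 : ℝ)) = 0 := by
    rw [Finset.prod_const, Finset.card_univ, Fintype.card_fin, zero_pow (by omega)]
  simp only [noLock, Bool.false_eq_true, if_false, h0, openProb]
  rw [Finset.sum_div]
  refine Finset.sum_congr rfl fun m _ => ?_
  rw [← Finset.sum_mul]
  ring

/-- The policy that plays a fixed sequence of actions. -/
def fixedPolicy {H : ℕ} [DecidableEq 𝒜] (a : Fin H → 𝒜) : Policy 𝒮 𝒜 H :=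
  fun h _ _ => ⟨Pi.single (a h) 1, single_mem_stdSimplex ℝ (a h)⟩

lemma fixedPolicy_weight_mul {H : ℕ} [DecidableEq 𝒜] (a : Fin H → 𝒜)
    (F : Trajectory 𝒮 𝒜 H → ℝ) (τ : Trajectory 𝒮 𝒜 H) :
    (fixedPolicy a : Policy 𝒮 𝒜 H).weight τ * F τ =
      (fixedPolicy a : Policy 𝒮 𝒜 H).weight τ * F (fun h => ((τ h).1, a h)) := by
  by_cases h : ∀ h, (τ h).2 = a h
  · congr 2
    funext k
    exact Prod.ext rfl (h k)
  · push Not at h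
    obtain ⟨k, hk⟩ := h
    have : (fixedPolicy a : Policy 𝒮 𝒜 H).weight τ = 0 := by
      refine Finset.prod_eq_zero (Finset.mem_univ k) ?_
      change Pi.single (M := fun _ : 𝒜 => ℝ) (a k) 1 (τ k).2 = 0
      exact Pi.single_eq_of_ne hk _
    rw [this, zero_mul, zero_mul]

/-- Playing the secret earns the reward whenever the gate opens. -/
lemma openProb_le_optValue [Nonempty 𝒜] [DecidableEq 𝒜] (Q : LockData L K n H₁ 𝓝)
    (enc : 𝒮 ≃ Core n H₁ 𝓝 × Innov K) (hn : 1 ≤ n) (hH : 1 ≤ H₁)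
    (hu : ∀ m, Q.ρ m ≠ 0 → ∏ i, Q.u m i = 1) (v : Fin n → 𝒜) :
    Q.openProb ≤ (Q.model enc (secretLock v)).optValue := by
  obtain ⟨a₀⟩ := ‹Nonempty 𝒜›
  -- Only the values at `actTime` matter; before time `H₁` the truncated subtraction harmlessly
  -- plays `v 0`.
  set a : Fin (H₁ + 1 + n) → 𝒜 := fun h =>
    if hh : (h : ℕ) - H₁ < n then v ⟨h - H₁, hh⟩ else a₀ with ha
  have hav : ∀ i, a (actTime H₁ i) = v i := by
    intro i
    have h1 : H₁ + (i : ℕ) - H₁ = i := by omega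
    simp [ha, h1]
  refine le_trans (le_of_eq ?_) (LMDP.value_le_optValue _ (fixedPolicy a))
  rw [value_model]
  simp_rw [LMDP.trajProb_eq, mul_assoc]
  simp_rw [fixedPolicy_weight_mul a (fun τ => (Q.model enc (secretLock v)).stateWeight τ *
    finalReward enc fun h => (τ h).1)]
  rw [Policy.sum_weight_mul (fixedPolicy a) (fun s =>
    (Q.model enc (secretLock v)).stateWeight (fun h => (s h, a h)) * finalReward enc s),
    Q.sum_stateWeight_mul_finalReward enc _ hn hH a, openProb]
  refine Finset.sum_congr rfl fun m _ => ?_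
  by_cases hm : Q.ρ m = 0
  · rw [hm, zero_mul, zero_mul]
  · congr 1
    refine Finset.sum_congr rfl fun o _ => ?_
    simp only [secretLock, hav, decide_true, if_true, ← map_prod, hu m hm, map_one]
    ring

/-! #### Comparison with the model without a lock -/

/-- The correlation of the roles in `J` with the observations and the opening of the gate. -/
def leak (Q : LockData L K n H₁ 𝓝) (J : Finset (Fin n))
    (o : Fin (H₁ + 1 + n) → Fin K × ℤˣ) : ℝ :=
  ∑ m, Q.ρ m * (Q.obsWeight m o * Q.gateProb m o * ∏ i ∈ J, sgn (Q.u m i))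

/-- The nonempty proper subsets of `Fin n`. -/
def properSubsets (n : ℕ) : Finset (Finset (Fin n)) :=
  Finset.univ.filter fun J => J ≠ ∅ ∧ J ≠ Finset.univ

/-- Fourier expansion in the roles: each lock factor is half of `1 + coin · [correct action] ·
role`, and averaging the `J`-th term of the product over the instances produces `leak J`. -/
lemma stateWeight_secretLock_of_open [DecidableEq 𝒜] (Q : LockData L K n H₁ 𝓝)
    (enc : 𝒮 ≃ Core n H₁ 𝓝 × Innov K) (hH : 1 ≤ H₁) (v : Fin n → 𝒜)
    (τ : Trajectory 𝒮 𝒜 (H₁ + 1 + n)) (w : Fin (H₁ + 1 + n) → Innov K)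
    (hτ : ∀ h, (τ h).1 = Q.path enc w h) (hw : (w (gateTime n H₁)).2 = 1) :
    (Q.model enc (secretLock v)).stateWeight τ = (1 / 2) ^ (H₁ + n) *
      ∑ J : Finset (Fin n), (∏ i ∈ J, sgn (w (lockTime H₁ i)).2 *
        (if (τ (actTime H₁ i)).2 = v i then 1 else 0)) * Q.leak J (fun h => (w h).1) := by
  simp_rw [leak, Finset.mul_sum]
  rw [Finset.sum_comm, LMDP.stateWeight]
  refine Finset.sum_congr rfl fun m _ => ?_
  rw [Q.prod_stateProb_of_path enc _ m hH τ w hτ, hw, map_one]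
  have h1 : ∏ i : Fin n, (1 + sgn (w (lockTime H₁ i)).2 *
      (if (1 : ℤˣ) = 1 ∧ secretLock v i (τ (actTime H₁ i)).2 = true then sgn (Q.u m i)
        else 0)) / 2 = (1 / 2) ^ n * ∑ J : Finset (Fin n), (∏ i ∈ J, sgn (w (lockTime H₁ i)).2 *
        (if (τ (actTime H₁ i)).2 = v i then 1 else 0)) * ∏ i ∈ J, sgn (Q.u m i) := by
    simp_rw [div_eq_mul_inv]
    rw [Finset.prod_mul_distrib, Finset.prod_const, Finset.card_univ, Fintype.card_fin,
      Finset.prod_one_add, Finset.powerset_univ, mul_comm]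
    congr 1
    · simp
    refine Finset.sum_congr rfl fun J _ => ?_
    rw [← Finset.prod_mul_distrib]
    refine Finset.prod_congr rfl fun i _ => ?_
    simp [secretLock]
  rw [h1, Finset.mul_sum, Finset.mul_sum, Finset.mul_sum, Finset.mul_sum]
  refine Finset.sum_congr rfl fun J _ => ?_
  simp only [model]
  ring

lemma stateWeight_noLock_of_open (Q : LockData L K n H₁ 𝓝)
    (enc : 𝒮 ≃ Core n H₁ 𝓝 × Innov K) (hH : 1 ≤ H₁)
    (τ : Trajectory 𝒮 𝒜 (H₁ + 1 + n)) (w : Fin (H₁ + 1 + n) → Innov K)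
    (hτ : ∀ h, (τ h).1 = Q.path enc w h) (hw : (w (gateTime n H₁)).2 = 1) :
    (Q.model enc noLock).stateWeight τ = (1 / 2) ^ (H₁ + n) * Q.leak ∅ (fun h => (w h).1) := by
  rw [leak, Finset.mul_sum, LMDP.stateWeight]
  refine Finset.sum_congr rfl fun m _ => ?_
  rw [Q.prod_stateProb_of_path enc _ m hH τ w hτ, hw, map_one]
  simp only [noLock, Bool.false_eq_true, and_false, if_false, mul_zero, add_zero,
    Finset.prod_const, Finset.card_univ, Fintype.card_fin, Finset.prod_empty, model]
  ring

/-- Each lock factor is at most `1`, against exactly `1 / 2` without a lock. -/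
lemma stateWeight_secretLock_le [DecidableEq 𝒜] (Q : LockData L K n H₁ 𝓝)
    (enc : 𝒮 ≃ Core n H₁ 𝓝 × Innov K) (hH : 1 ≤ H₁) (v : Fin n → 𝒜)
    (τ : Trajectory 𝒮 𝒜 (H₁ + 1 + n)) (w : Fin (H₁ + 1 + n) → Innov K)
    (hτ : ∀ h, (τ h).1 = Q.path enc w h) (hw : (w (gateTime n H₁)).2 = 1) :
    (Q.model enc (secretLock v)).stateWeight τ ≤
      2 ^ n * (Q.model enc noLock).stateWeight τ := by
  rw [LMDP.stateWeight, LMDP.stateWeight, Finset.mul_sum]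
  refine Finset.sum_le_sum fun m _ => ?_
  rw [Q.prod_stateProb_of_path enc _ m hH τ w hτ, Q.prod_stateProb_of_path enc _ m hH τ w hτ]
  have h0 : ∏ i : Fin n, (1 + sgn (w (lockTime H₁ i)).2 *
      (if (w (gateTime n H₁)).2 = 1 ∧ secretLock v i (τ (actTime H₁ i)).2 = true
        then sgn (Q.u m i) else 0)) / 2 ≤ 1 := by
    refine Finset.prod_le_one (fun i _ => ?_) (fun i _ => ?_)
    · refine div_nonneg (one_add_sgn_mul_nonneg ?_) zero_le_two
      split_ifs <;> simp [abs_sgn]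
    · have : |sgn (w (lockTime H₁ i)).2 *
        (if (w (gateTime n H₁)).2 = 1 ∧ secretLock v i (τ (actTime H₁ i)).2 = true
          then sgn (Q.u m i) else 0)| ≤ 1 := by
        refine abs_sgn_mul_le ?_
        split_ifs <;> simp [abs_sgn]
      linarith [(abs_le.mp this).2]
  have h1 : ∏ i : Fin n, (1 + sgn (w (lockTime H₁ i)).2 *
      (if (w (gateTime n H₁)).2 = 1 ∧ noLock i (τ (actTime H₁ i)).2 = true
        then sgn (Q.u m i) else 0)) / 2 = (1 / 2) ^ n := by
    simp [noLock]
  rw [h1, hw, map_one]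
  rw [hw] at h0
  have hg := Q.gateProb_mem m (fun h => (w h).1)
  have hpos : 0 ≤ (Q.ρ m : ℝ) * (Q.obsWeight m (fun h => (w h).1) * ((1 / 2) ^ H₁ *
      ((1 + 1 * (2 * Q.gateProb m (fun h => (w h).1) - 1)) / 2))) := by
    refine mul_nonneg (Q.ρ.2.1 m) (mul_nonneg (Q.obsWeight_nonneg m _)
      (mul_nonneg (by positivity) ?_))
    linarith [hg.1]
  have h2 : (2 : ℝ) ^ n * (1 / 2) ^ n = 1 := by rw [← mul_pow]; norm_num
  have := mul_le_mul_of_nonneg_left h0 hpos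
  simp only [model]
  refine le_trans (le_of_eq ?_) (this.trans (le_of_eq ?_))
  · ring_nf
  · linear_combination (-((Q.ρ m : ℝ) * (Q.obsWeight m (fun h => (w h).1) * ((1 / 2) ^ H₁ *
      ((1 + 1 * (2 * Q.gateProb m (fun h => (w h).1) - 1)) / 2))))) * h2

open Classical in
/-- The part of the difference of likelihoods that is due to the leak. -/
def leakBound (Q : LockData L K n H₁ 𝓝) (enc : 𝒮 ≃ Core n H₁ 𝓝 × Innov K)
    (s : Fin (H₁ + 1 + n) → 𝒮) : ℝ :=
  if s = Q.path enc (innov enc s) then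
    (1 / 2) ^ (H₁ + n) * ∑ J ∈ properSubsets n, |Q.leak J fun h => (innov enc s h).1| else 0

lemma leakBound_nonneg (Q : LockData L K n H₁ 𝓝) (enc : 𝒮 ≃ Core n H₁ 𝓝 × Innov K)
    (s : Fin (H₁ + 1 + n) → 𝒮) : 0 ≤ Q.leakBound enc s := by
  unfold leakBound
  split_ifs
  · exact mul_nonneg (by positivity) (Finset.sum_nonneg fun _ _ => abs_nonneg _)
  · exact le_rfl

/-- Inconsistent states and a shut gate give no difference. If the whole secret is played, the crude
ratio `2 ^ n` is used. Otherwise a wrong action kills the full character, the empty one is the model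
without a lock, and only proper subsets remain. -/
lemma abs_stateWeight_sub_le [DecidableEq 𝒜] (Q : LockData L K n H₁ 𝓝)
    (enc : 𝒮 ≃ Core n H₁ 𝓝 × Innov K) (hn : 1 ≤ n) (hH : 1 ≤ H₁) (v : Fin n → 𝒜)
    (τ : Trajectory 𝒮 𝒜 (H₁ + 1 + n)) :
    |(Q.model enc (secretLock v)).stateWeight τ - (Q.model enc noLock).stateWeight τ| ≤
      Q.leakBound enc (fun h => (τ h).1) +
        2 ^ n * ((Q.model enc noLock).stateWeight τ *
          if (fun i => (τ (actTime H₁ i)).2) = v then 1 else 0) := by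
  have hlb := Q.leakBound_nonneg enc (fun h => (τ h).1)
  have hW0 := (Q.model enc noLock).stateWeight_nonneg τ
  have hrhs : 0 ≤ Q.leakBound enc (fun h => (τ h).1) +
        2 ^ n * ((Q.model enc noLock).stateWeight τ *
          if (fun i => (τ (actTime H₁ i)).2) = v then 1 else 0) :=
    add_nonneg hlb (mul_nonneg (by positivity)
      (mul_nonneg hW0 (by split_ifs <;> simp)))
  by_cases hτ : (fun h => (τ h).1) = Q.path enc (innov enc fun h => (τ h).1)
  swap
  · refine le_trans (le_of_eq ?_) hrhs
    rw [Q.stateWeight_eq_zero enc _ τ hτ, Q.stateWeight_eq_zero enc _ τ hτ, sub_zero, abs_zero]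
  set w := innov enc fun h => (τ h).1 with hwdef
  have hτ' : ∀ h, (τ h).1 = Q.path enc w h := fun h => congrFun hτ h
  by_cases hw : (w (gateTime n H₁)).2 = 1
  swap
  · have : (Q.model enc (secretLock v)).stateWeight τ = (Q.model enc noLock).stateWeight τ := by
      unfold LMDP.stateWeight
      refine Finset.sum_congr rfl fun m _ => ?_
      rw [Q.prod_stateProb_of_path enc _ m hH τ w hτ', Q.prod_stateProb_of_path enc _ m hH τ w hτ']
      simp [hw, model]
    rw [this, sub_self, abs_zero]
    exact hrhs
  by_cases hv : (fun i => (τ (actTime H₁ i)).2) = v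
  · rw [if_pos hv, mul_one]
    have h1 := Q.stateWeight_secretLock_le enc hH v τ w hτ' hw
    have h2 := (Q.model enc (secretLock v)).stateWeight_nonneg τ
    have h3 : (1 : ℝ) ≤ 2 ^ n := one_le_pow₀ (by norm_num)
    have h4 : (Q.model enc noLock).stateWeight τ ≤ 2 ^ n * (Q.model enc noLock).stateWeight τ :=
      le_mul_of_one_le_left hW0 h3
    rw [abs_le]
    constructor <;> linarith
  · rw [if_neg hv, mul_zero, mul_zero, add_zero, leakBound, if_pos hτ,
      Q.stateWeight_secretLock_of_open enc hH v τ w hτ' hw,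
      Q.stateWeight_noLock_of_open enc hH τ w hτ' hw, ← mul_sub, abs_mul,
      abs_of_nonneg (by positivity)]
    refine mul_le_mul_of_nonneg_left ?_ (by positivity)
    obtain ⟨j, hj⟩ : ∃ j, (τ (actTime H₁ j)).2 ≠ v j := by
      by_contra hc
      push Not at hc
      exact hv (funext hc)
    set t : Finset (Fin n) → ℝ := fun J => (∏ i ∈ J, sgn (w (lockTime H₁ i)).2 *
        (if (τ (actTime H₁ i)).2 = v i then 1 else 0)) * Q.leak J (fun h => (w h).1) with ht
    have ht0 : t ∅ = Q.leak ∅ (fun h => (w h).1) := by simp [ht]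
    have ht1 : t Finset.univ = 0 := by
      rw [ht]
      dsimp only
      rw [Finset.prod_eq_zero (Finset.mem_univ j) (by rw [if_neg hj, mul_zero]), zero_mul]
    have hne : (∅ : Finset (Fin n)) ≠ Finset.univ := by
      intro h
      have := congrArg Finset.card h
      simp at this
      omega
    have hsum : ∑ J, t J - Q.leak ∅ (fun h => (w h).1) = ∑ J ∈ properSubsets n, t J := by
      have h1 : ∑ J, t J = ∑ J ∈ properSubsets n, t J + t ∅ := by
        rw [properSubsets, Finset.sum_filter, ← Finset.sum_erase_add _ _ (Finset.mem_univ ∅),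
          ← Finset.sum_erase_add (Finset.univ : Finset (Finset (Fin n)))
            (fun J => if J ≠ ∅ ∧ J ≠ Finset.univ then t J else 0) (Finset.mem_univ ∅)]
        simp only [ne_eq, not_true_eq_false, false_and, if_false, add_zero]
        congr 1
        refine Finset.sum_congr rfl fun J hJ => ?_
        have hJ' : J ≠ ∅ := (Finset.mem_erase.mp hJ).1
        by_cases hJu : J = Finset.univ
        · simp [hJu, ht1]
        · simp [hJ', hJu]
      rw [h1, ht0]
      ring
    rw [hsum]
    refine (Finset.abs_sum_le_sum_abs _ _).trans (Finset.sum_le_sum fun J _ => ?_)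
    rw [ht, abs_mul]
    refine mul_le_of_le_one_left (abs_nonneg _) ?_
    rw [Finset.abs_prod]
    refine Finset.prod_le_one (fun _ _ => abs_nonneg _) fun i _ => ?_
    refine abs_sgn_mul_le ?_
    split_ifs <;> simp

lemma sum_leakBound_le (Q : LockData L K n H₁ 𝓝) (enc : 𝒮 ≃ Core n H₁ 𝓝 × Innov K) {η : ℝ}
    (hη : ∀ J ∈ properSubsets n, ∑ o, |Q.leak J o| ≤ η) (hη0 : 0 ≤ η) :
    ∑ s, Q.leakBound enc s ≤ 2 ^ (n + 1) * η := by
  rw [Q.sum_path enc _ fun s hs => by rw [leakBound, if_neg hs]]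
  have h1 : ∀ w, Q.leakBound enc (Q.path enc w) =
      (1 / 2) ^ (H₁ + n) * ∑ J ∈ properSubsets n, |Q.leak J fun h => (w h).1| := by
    intro w
    rw [leakBound, innov_path, if_pos rfl]
  simp_rw [h1]
  rw [← Finset.mul_sum, ← (Equiv.arrowProdEquivProdArrow (Fin (H₁ + 1 + n))
    (fun _ => Fin K × ℤˣ) (fun _ => ℤˣ)).symm.sum_comp, Fintype.sum_prod_type]
  have h2 : ∀ o : Fin (H₁ + 1 + n) → Fin K × ℤˣ, ∑ e : Fin (H₁ + 1 + n) → ℤˣ,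
      ∑ J ∈ properSubsets n, |Q.leak J fun h =>
        ((Equiv.arrowProdEquivProdArrow (Fin (H₁ + 1 + n))
          (fun _ => Fin K × ℤˣ) (fun _ => ℤˣ)).symm (o, e) h).1| =
      2 ^ (H₁ + 1 + n) * ∑ J ∈ properSubsets n, |Q.leak J o| := by
    intro o
    change ∑ _e : Fin (H₁ + 1 + n) → ℤˣ, ∑ J ∈ properSubsets n, |Q.leak J o| = _
    rw [Finset.sum_const, nsmul_eq_mul, Finset.card_univ, Fintype.card_fun, Fintype.card_fin,
      Fintype.card_units_int]
    push_cast
    rfl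
  simp_rw [h2]
  rw [← Finset.mul_sum, ← mul_assoc, Finset.sum_comm]
  -- `leakBound` puts no constraint or weight on the gate coin, hence a total of `2` instead of `1`.
  have h3 : (1 / 2 : ℝ) ^ (H₁ + n) * 2 ^ (H₁ + 1 + n) = 2 := by
    rw [show H₁ + 1 + n = (H₁ + n) + 1 by ring, pow_succ, ← mul_assoc, ← mul_pow]
    norm_num
  rw [h3, pow_succ, mul_comm ((2 : ℝ) ^ n) 2, mul_assoc]
  refine mul_le_mul_of_nonneg_left ?_ zero_le_two
  calc _ ≤ ∑ _J ∈ properSubsets n, η := Finset.sum_le_sum hη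
    _ = (properSubsets n).card * η := by rw [Finset.sum_const, nsmul_eq_mul]
    _ ≤ 2 ^ n * η := by
        refine mul_le_mul_of_nonneg_right ?_ hη0
        have := Finset.card_le_univ (properSubsets n)
        rw [Fintype.card_finset, Fintype.card_fin] at this
        exact_mod_cast this

/-- The probability, in the model without a lock, that a policy plays a given secret. -/
def playProb [DecidableEq 𝒜] (Q : LockData L K n H₁ 𝓝) (enc : 𝒮 ≃ Core n H₁ 𝓝 × Innov K)
    (π : Policy 𝒮 𝒜 (H₁ + 1 + n)) (v : Fin n → 𝒜) : ℝ :=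
  ∑ τ, (Q.model enc noLock).trajProb π τ *
    if (fun i => (τ (actTime H₁ i)).2) = v then 1 else 0

lemma playProb_nonneg [DecidableEq 𝒜] (Q : LockData L K n H₁ 𝓝)
    (enc : 𝒮 ≃ Core n H₁ 𝓝 × Innov K) (π : Policy 𝒮 𝒜 (H₁ + 1 + n)) (v : Fin n → 𝒜) :
    0 ≤ Q.playProb enc π v :=
  Finset.sum_nonneg fun τ _ => mul_nonneg (LMDP.trajProb_nonneg _ _ _) (by split_ifs <;> simp)

lemma sum_playProb [DecidableEq 𝒜] (Q : LockData L K n H₁ 𝓝)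
    (enc : 𝒮 ≃ Core n H₁ 𝓝 × Innov K) (π : Policy 𝒮 𝒜 (H₁ + 1 + n)) :
    ∑ v, Q.playProb enc π v = 1 := by
  unfold playProb
  rw [Finset.sum_comm]
  refine (Finset.sum_congr rfl fun τ _ => ?_).trans ((Q.model enc noLock).sum_trajProb π)
  rw [← Finset.mul_sum, Finset.sum_ite_eq, if_pos (Finset.mem_univ _), mul_one]

/-- The leak term depends on the states only, so by `Policy.sum_weight_mul` it costs the same for
every adaptive policy. -/
lemma sum_abs_trajProb_sub_le [DecidableEq 𝒜] (Q : LockData L K n H₁ 𝓝)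
    (enc : 𝒮 ≃ Core n H₁ 𝓝 × Innov K) (hn : 1 ≤ n) (hH : 1 ≤ H₁) {η : ℝ}
    (hη : ∀ J ∈ properSubsets n, ∑ o, |Q.leak J o| ≤ η) (hη0 : 0 ≤ η)
    (π : Policy 𝒮 𝒜 (H₁ + 1 + n)) (v : Fin n → 𝒜) :
    ∑ τ, |(Q.model enc (secretLock v)).trajProb π τ - (Q.model enc noLock).trajProb π τ| ≤
      2 ^ (n + 1) * η + 2 ^ n * Q.playProb enc π v := by
  calc _ ≤ ∑ τ : Trajectory 𝒮 𝒜 (H₁ + 1 + n),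
        (π.weight τ * Q.leakBound enc (fun h => (τ h).1) +
          2 ^ n * ((Q.model enc noLock).trajProb π τ *
            if (fun i => (τ (actTime H₁ i)).2) = v then 1 else 0)) := by
        refine Finset.sum_le_sum fun τ _ => ?_
        rw [LMDP.trajProb_eq, LMDP.trajProb_eq, ← mul_sub, abs_mul,
          abs_of_nonneg (π.weight_nonneg τ)]
        refine (mul_le_mul_of_nonneg_left (Q.abs_stateWeight_sub_le enc hn hH v τ)
          (π.weight_nonneg τ)).trans (le_of_eq ?_)
        ring
    _ = ∑ s, Q.leakBound enc s + 2 ^ n * Q.playProb enc π v := by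
        rw [Finset.sum_add_distrib, π.sum_weight_mul (Q.leakBound enc), ← Finset.mul_sum]
        rfl
    _ ≤ _ := by linarith [Q.sum_leakBound_le enc hη hη0]

/-- An `ε`-optimal policy must beat its value without a lock by `openProb / 2 - ε ≥ 3ε`. The
variation between the models has to supply this gain, and leaks account for at most `ε` of it. -/
lemma two_mul_le_playProb_of_isOptimal [Nonempty 𝒜] [DecidableEq 𝒜] (Q : LockData L K n H₁ 𝓝)
    (enc : 𝒮 ≃ Core n H₁ 𝓝 × Innov K) (hn : 1 ≤ n) (hH : 1 ≤ H₁)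
    (hu : ∀ m, Q.ρ m ≠ 0 → ∏ i, Q.u m i = 1) {η ε : ℝ}
    (hη : ∀ J ∈ properSubsets n, ∑ o, |Q.leak J o| ≤ η) (hη0 : 0 ≤ η)
    (hηε : 2 ^ (n + 1) * η ≤ ε) (hε : 8 * ε ≤ Q.openProb)
    (π : Policy 𝒮 𝒜 (H₁ + 1 + n)) (v : Fin n → 𝒜)
    (h : (Q.model enc (secretLock v)).IsOptimal ε π) :
    2 * ε ≤ 2 ^ n * Q.playProb enc π v := by
  have h1 := Q.openProb_le_optValue enc hn hH hu v
  have h2 : (Q.model enc (secretLock v)).value π ≤ (Q.model enc noLock).value π +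
      ∑ τ, |(Q.model enc (secretLock v)).trajProb π τ - (Q.model enc noLock).trajProb π τ| := by
    rw [value_model, value_model, ← Finset.sum_add_distrib]
    refine Finset.sum_le_sum fun τ _ => ?_
    have hr := finalReward_mem enc fun h => (τ h).1
    have h3 := le_abs_self ((Q.model enc (secretLock v)).trajProb π τ -
      (Q.model enc noLock).trajProb π τ)
    have h4 := abs_nonneg ((Q.model enc (secretLock v)).trajProb π τ -
      (Q.model enc noLock).trajProb π τ)
    nlinarith [mul_le_mul_of_nonneg_right h3 hr.1, mul_le_mul_of_nonneg_left hr.2 h4]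
  rw [Q.value_noLock enc hn hH] at h2
  have h3 := Q.sum_abs_trajProb_sub_le enc hn hH hη hη0 π v
  have h4 : (Q.model enc (secretLock v)).optValue - (Q.model enc (secretLock v)).value π ≤ ε := h
  linarith

/-- The number of episodes needed to learn all models of a lock. -/
theorem card_le_of_learns [Nonempty 𝒜] [DecidableEq 𝒜] (Q : LockData L K n H₁ 𝓝)
    (enc : 𝒮 ≃ Core n H₁ 𝓝 × Innov K) (hn : 1 ≤ n) (hH : 1 ≤ H₁)
    (hu : ∀ m, Q.ρ m ≠ 0 → ∏ i, Q.u m i = 1) {η ε : ℝ}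
    (hη : ∀ J ∈ properSubsets n, ∑ o, |Q.leak J o| ≤ η) (hη0 : 0 ≤ η) (hε0 : 0 < ε)
    (hηε : 2 ^ (n + 1) * η ≤ ε) (hε : 8 * ε ≤ Q.openProb)
    (P : Protocol 𝒮 𝒜 (H₁ + 1 + n))
    (hP : ∀ v, 3 / 4 ≤ P.successProb (Q.model enc (secretLock v)) ε) :
    3 / 4 * (Fintype.card 𝒜 : ℝ) ^ n ≤ 2 ^ n / (2 * ε) +
      P.episodes * ((Fintype.card 𝒜 : ℝ) ^ n * (2 ^ (n + 1) * η) + 2 ^ n) := by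
  classical
  have hcard : (Fintype.card (Fin n → 𝒜) : ℝ) = (Fintype.card 𝒜 : ℝ) ^ n := by
    rw [Fintype.card_fun, Fintype.card_fin]; push_cast; rfl
  rw [← hcard]
  refine P.card_le_of_successProb (Q.model enc noLock) (fun v => Q.model enc (secretLock v))
    (fun π => ?_) (fun π => ?_) hP
  · refine (Finset.sum_le_sum fun v _ =>
      Q.sum_abs_trajProb_sub_le enc hn hH hη hη0 π v).trans (le_of_eq ?_)
    rw [Finset.sum_add_distrib, Finset.sum_const, nsmul_eq_mul, Finset.card_univ,
      ← Finset.mul_sum, sum_playProb, mul_one]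
  -- Markov's inequality over secrets: the play probabilities sum to one, and each secret served
  -- takes at least `2ε / 2 ^ n`.
  · rw [le_div_iff₀ (by positivity), ← nsmul_eq_mul, ← Finset.sum_const]
    calc _ ≤ ∑ v ∈ Finset.univ.filter (fun v => (Q.model enc (secretLock v)).IsOptimal ε π),
          2 ^ n * Q.playProb enc π v := Finset.sum_le_sum fun v hv =>
            Q.two_mul_le_playProb_of_isOptimal enc hn hH hu hη hη0 hηε hε π v
              (Finset.mem_filter.mp hv).2
      _ ≤ ∑ v, 2 ^ n * Q.playProb enc π v :=
          Finset.sum_le_sum_of_subset_of_nonneg (Finset.filter_subset _ _)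
            fun v _ _ => mul_nonneg (by positivity) (Q.playProb_nonneg enc π v)
      _ = 2 ^ n := by rw [← Finset.mul_sum, sum_playProb, mul_one]

end LockData

/-! ### Iterated Radon partitions -/

section Radon

variable {V : Type} [AddCommGroup V] [Module ℝ V] [FiniteDimensional ℝ V] {D : ℕ}

/-- Radon's theorem in terms of weights. -/
lemma exists_radon_weights (hD : Module.finrank ℝ V = D) (p : Fin (D + 2) → V) :
    ∃ c : ℤˣ → Fin (D + 2) → ℝ, (∀ y t, 0 ≤ c y t) ∧ (∀ y, ∑ t, c y t = 1) ∧
      (∀ y y' t, y ≠ y' → c y t = 0 ∨ c y' t = 0) ∧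
      ∃ z, ∀ y, ∑ t, c y t • p t = z := by
  -- Too many vectors for dimension `D + 1`. The last coordinate makes the relation affine, so its
  -- positive and negative parts have the same mass `C` and, once normalized, the same barycentre.
  have hdep : ¬ LinearIndependent ℝ fun t => ((p t, 1) : V × ℝ) := by
    intro h
    have := h.fintype_card_le_finrank
    rw [Module.finrank_prod, hD, Module.finrank_self, Fintype.card_fin] at this
    omega
  obtain ⟨g, hg, t₀, ht₀⟩ := Fintype.not_linearIndependent_iff.mp hdep
  have hg1 : ∑ t, g t • p t = 0 := by
    have := congrArg Prod.fst hg
    simpa [Prod.fst_sum] using this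
  have hg2 : ∑ t, g t = 0 := by
    have := congrArg Prod.snd hg
    simpa [Prod.snd_sum] using this
  set C := ∑ t, max (g t) 0 with hC
  have hsub : ∀ t, max (g t) 0 - max (-g t) 0 = g t := fun t => by
    rcases le_total 0 (g t) with h | h
    · rw [max_eq_left h, max_eq_right (by linarith)]; ring
    · rw [max_eq_right h, max_eq_left (by linarith)]; ring
  have hC' : ∑ t, max (-g t) 0 = C := by
    have : ∑ t, (max (g t) 0 - max (-g t) 0) = 0 := by simp_rw [hsub]; exact hg2
    rw [Finset.sum_sub_distrib] at this
    linarith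
  have hCpos : 0 < C := by
    rcases lt_or_gt_of_ne ht₀ with h | h
    · rw [← hC']
      exact Finset.sum_pos' (fun t _ => le_max_right _ _)
        ⟨t₀, Finset.mem_univ _, lt_max_of_lt_left (by linarith)⟩
    · exact Finset.sum_pos' (fun t _ => le_max_right _ _)
        ⟨t₀, Finset.mem_univ _, lt_max_of_lt_left h⟩
  have hpm : ∑ t, max (-g t) 0 • p t = ∑ t, max (g t) 0 • p t := by
    have : ∑ t, (max (g t) 0 - max (-g t) 0) • p t = 0 := by simp_rw [hsub]; exact hg1
    simp_rw [sub_smul] at this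
    rw [Finset.sum_sub_distrib] at this
    exact (sub_eq_zero.mp this).symm
  have hdisj : ∀ t, max (g t) 0 = 0 ∨ max (-g t) 0 = 0 := fun t => by
    rcases le_total 0 (g t) with h | h
    · exact Or.inr (max_eq_right (by linarith))
    · exact Or.inl (max_eq_right h)
  refine ⟨fun y t => C⁻¹ * max (sgn y * g t) 0, fun y t =>
    mul_nonneg (inv_nonneg.mpr hCpos.le) (le_max_right _ _), fun y => ?_, fun y y' t hy => ?_,
    C⁻¹ • ∑ t, max (g t) 0 • p t, fun y => ?_⟩
  · rw [← Finset.mul_sum]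
    rcases sgn_eq_or y with h | h <;> simp only [h, one_mul, neg_mul]
    · exact inv_mul_cancel₀ hCpos.ne'
    · rw [hC']; exact inv_mul_cancel₀ hCpos.ne'
  · rcases Int.units_eq_one_or y with rfl | rfl <;> rcases Int.units_eq_one_or y' with rfl | rfl
    · exact absurd rfl hy
    · simp only [map_one, sgn_neg_one, one_mul, neg_mul]
      rcases hdisj t with h | h <;> simp [h]
    · simp only [map_one, sgn_neg_one, one_mul, neg_mul]
      rcases hdisj t with h | h <;> simp [h]
    · exact absurd rfl hy
  · simp_rw [mul_smul]
    rw [← Finset.smul_sum]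
    rcases sgn_eq_or y with h | h <;> simp only [h, one_mul, neg_mul]
    rw [hpm]

lemma sum_cons {α M : Type} [Fintype α] [AddCommMonoid M] {k : ℕ} (f : (Fin (k + 1) → α) → M) :
    ∑ x, f x = ∑ a, ∑ x : Fin k → α, f (Fin.cons a x) := by
  rw [← (Fin.consEquiv (fun _ : Fin (k + 1) => α)).sum_comp, Fintype.sum_prod_type]
  rfl

/-- Among `(D + 2) ^ k` points in dimension `D` there are `2 ^ k` disjointly supported convex
combinations that agree. -/
lemma exists_iterated_radon_weights (hD : Module.finrank ℝ V = D) (k : ℕ)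
    (f : (Fin k → Fin (D + 2)) → V) :
    ∃ w : (Fin k → ℤˣ) → (Fin k → Fin (D + 2)) → ℝ, (∀ v i, 0 ≤ w v i) ∧
      (∀ v, ∑ i, w v i = 1) ∧ (∀ v v' i, v ≠ v' → w v i = 0 ∨ w v' i = 0) ∧
      ∃ z, ∀ v, ∑ i, w v i • f i = z := by
  induction k with
  | zero =>
    refine ⟨fun _ _ => 1, fun _ _ => zero_le_one, fun v => by simp, fun v v' i h =>
      absurd (Subsingleton.elim v v') h, f 0, fun v => ?_⟩
    rw [Fintype.sum_unique, one_smul]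
    congr 1
    exact Subsingleton.elim _ _
  | succ k ih =>
    -- The first coordinate splits the points into `D + 2` blocks. Each block has a common point `z
    -- t` by induction, and one more Radon partition is applied to these; weights multiply.
    choose w hw0 hw1 hwd z hz using fun t => ih fun i => f (Fin.cons t i)
    obtain ⟨c, hc0, hc1, hcd, z', hz'⟩ := exists_radon_weights hD z
    refine ⟨fun v i => c (v 0) (i 0) * w (i 0) (Fin.tail v) (Fin.tail i), fun v i =>
      mul_nonneg (hc0 _ _) (hw0 _ _ _), fun v => ?_, fun v v' i hv => ?_, z', fun v => ?_⟩
    · rw [sum_cons]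
      simp only [Fin.cons_zero, Fin.tail_cons]
      simp_rw [← Finset.mul_sum, hw1, mul_one, hc1]
    · dsimp only
      by_cases h0 : v 0 = v' 0
      · have ht : Fin.tail v ≠ Fin.tail v' := by
          intro ht
          apply hv
          rw [← Fin.cons_self_tail v, ← Fin.cons_self_tail v', h0, ht]
        rcases hwd (i 0) _ _ (Fin.tail i) ht with h | h
        · left; rw [h, mul_zero]
        · right; rw [h, mul_zero]
      · rcases hcd _ _ (i 0) h0 with h | h
        · left; rw [h, zero_mul]
        · right; rw [h, zero_mul]
    · rw [sum_cons]
      simp only [Fin.cons_zero, Fin.tail_cons]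
      simp_rw [mul_smul, ← Finset.smul_sum, hz, hz']

end Radon

/-! ### Separated codes -/

section Codes

open Finset

/-- The sets of relative size at most `1 / s`. -/
def smallSets (K s : ℕ) : Finset (Finset (Fin K)) := univ.filter fun S => s * S.card ≤ K

/-- Chernoff bound: give `S` the weight `e^{-q|S|}`. The total is `(1 + e^{-q})^K`, and a small set
weighs at least `e^{-qK/s}`. -/
lemma card_smallSets_le (K s : ℕ) (hs : 0 < s) {q : ℝ} (hq : 0 ≤ q) :
    ((smallSets K s).card : ℝ) ≤ Real.exp (K * (q / s + Real.exp (-q))) := by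
  have h1 : ∑ S : Finset (Fin K), Real.exp (-q) ^ S.card = (1 + Real.exp (-q)) ^ K := by
    have := Finset.prod_one_add (f := fun _ : Fin K => Real.exp (-q)) (univ : Finset (Fin K))
    rw [Finset.prod_const, Finset.card_univ, Fintype.card_fin, Finset.powerset_univ] at this
    rw [this]
    simp
  have hs' : (0 : ℝ) < s := Nat.cast_pos.mpr hs
  have h2 : ∀ S ∈ smallSets K s, Real.exp (-(K * (q / s))) ≤ Real.exp (-q) ^ S.card := by
    intro S hS
    have hS' : s * S.card ≤ K := (mem_filter.mp hS).2
    have hS'' : (s : ℝ) * S.card ≤ K := by exact_mod_cast hS'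
    rw [← Real.exp_nat_mul, Real.exp_le_exp]
    have : (S.card : ℝ) ≤ K / s := by rw [le_div_iff₀ hs']; linarith
    have := mul_le_mul_of_nonneg_right this hq
    have e : (K : ℝ) / s * q = K * (q / s) := by ring
    linarith
  have h3 : ((smallSets K s).card : ℝ) * Real.exp (-(K * (q / s))) ≤
      Real.exp (K * Real.exp (-q)) := by
    calc _ = ∑ _S ∈ smallSets K s, Real.exp (-(K * (q / s))) := by
          rw [Finset.sum_const, nsmul_eq_mul]
      _ ≤ ∑ S ∈ smallSets K s, Real.exp (-q) ^ S.card := Finset.sum_le_sum h2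
      _ ≤ ∑ S : Finset (Fin K), Real.exp (-q) ^ S.card :=
          Finset.sum_le_sum_of_subset_of_nonneg (filter_subset _ _) fun _ _ _ => by positivity
      _ = (1 + Real.exp (-q)) ^ K := h1
      _ ≤ Real.exp (Real.exp (-q)) ^ K := by
          refine pow_le_pow_left₀ (by positivity) ?_ K
          linarith [Real.add_one_le_exp (Real.exp (-q))]
      _ = _ := by rw [← Real.exp_nat_mul]
  calc ((smallSets K s).card : ℝ)
      = (smallSets K s).card * Real.exp (-(K * (q / s))) * Real.exp (K * (q / s)) := by
        rw [mul_assoc, ← Real.exp_add]; simp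
    _ ≤ Real.exp (K * Real.exp (-q)) * Real.exp (K * (q / s)) :=
        mul_le_mul_of_nonneg_right h3 (Real.exp_pos _).le
    _ = _ := by rw [← Real.exp_add]; congr 1; ring

/-- A Gilbert–Varshamov code: pairwise relative distance at least `1 / 16`. -/
lemma exists_separated_code (K : ℕ) :
    ∃ X : Finset (Fin K → ℤˣ), (∀ x ∈ X, ∀ y ∈ X, x ≠ y → K ≤ 16 * hammingDist x y) ∧
      Real.exp (K / 4) ≤ X.card := by
  classical
  obtain ⟨X, hX, hmax⟩ := Finset.exists_max_image
    ((univ : Finset (Finset (Fin K → ℤˣ))).filter fun X =>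
      ∀ x ∈ X, ∀ y ∈ X, x ≠ y → K ≤ 16 * hammingDist x y) Finset.card ⟨∅, by simp⟩
  have hX' := (mem_filter.mp hX).2
  refine ⟨X, hX', ?_⟩
  -- An uncovered vector could be added to the code of maximal size.
  have hcover : ∀ y : Fin K → ℤˣ, ∃ x ∈ X, 16 * hammingDist x y ≤ K := by
    intro y
    by_contra hc
    push Not at hc
    have hy : y ∉ X := fun hy => by
      have := hc y hy
      simp at this
    have := hmax (insert y X) (mem_filter.mpr ⟨mem_univ _, ?_⟩)
    · rw [card_insert_of_notMem hy] at this
      omega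
    · intro a ha b hb hab
      rcases mem_insert.mp ha with ha' | ha' <;> rcases mem_insert.mp hb with hb' | hb'
      · exact absurd (ha'.trans hb'.symm) hab
      · rw [hammingDist_comm, ha']; exact (hc b hb').le
      · rw [hb']; exact (hc a ha').le
      · exact hX' a ha' b hb' hab
  have hball : ∀ x : Fin K → ℤˣ,
      (univ.filter fun y : Fin K → ℤˣ => 16 * hammingDist x y ≤ K).card ≤
        (smallSets K 16).card := by
    intro x
    refine Finset.card_le_card_of_injOn (fun y => univ.filter fun j => x j ≠ y j) ?_ ?_
    · intro y hy
      exact mem_filter.mpr ⟨mem_univ _, (mem_filter.mp hy).2⟩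
    · intro y _ y' _ h
      funext j
      have hj := Finset.ext_iff.mp h j
      simp only [mem_filter, mem_univ, true_and] at hj
      rcases Int.units_eq_one_or (x j) with hx | hx <;>
        rcases Int.units_eq_one_or (y j) with hy | hy <;>
        rcases Int.units_eq_one_or (y' j) with hy' | hy' <;> simp_all
  have hcount : (2 : ℕ) ^ K ≤ X.card * (smallSets K 16).card := by
    have h1 : (univ : Finset (Fin K → ℤˣ)) ⊆
        X.biUnion fun x => univ.filter fun y => 16 * hammingDist x y ≤ K := by
      intro y _
      obtain ⟨x, hx, hxy⟩ := hcover y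
      exact mem_biUnion.mpr ⟨x, hx, mem_filter.mpr ⟨mem_univ _, hxy⟩⟩
    have h2 := (card_le_card h1).trans (card_biUnion_le_card_mul X _ _ fun x _ => hball x)
    rwa [Finset.card_univ, Fintype.card_fun, Fintype.card_fin, Fintype.card_units_int] at h2
  have hcount' : (2 : ℝ) ^ K ≤ X.card * (smallSets K 16).card := by exact_mod_cast hcount
  -- With `q = 3` the exponent is `3/16 + e^{-3} ≤ 1/4`; as `2^K ≥ e^{K/2}`, at least `e^{K/4}`
  -- balls are needed.
  have hsmall := card_smallSets_le K 16 (by norm_num) (q := 3) (by norm_num)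
  have he3 : Real.exp (-3) ≤ 1 / 16 := by
    have h2 : (20 : ℝ) ≤ Real.exp 3 := by
      have h3 : Real.exp 3 = Real.exp 1 ^ 3 := by rw [← Real.exp_nat_mul]; norm_num
      rw [h3]
      have h4 := Real.exp_one_gt_d9
      calc (20 : ℝ) ≤ 2.7182818283 ^ 3 := by norm_num
        _ ≤ _ := pow_le_pow_left₀ (by norm_num) h4.le 3
    rw [Real.exp_neg, inv_le_comm₀ (by positivity) (by norm_num)]
    linarith
  have h2 : Real.exp (K * Real.log 2) = 2 ^ K := by
    rw [Real.exp_nat_mul, Real.exp_log (by norm_num)]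
  have hKK : (0 : ℝ) ≤ K := Nat.cast_nonneg K
  have h4 : Real.exp (K / 4) * Real.exp (K / 4) ≤ X.card * Real.exp (K / 4) := by
    calc _ = Real.exp (K / 2) := by rw [← Real.exp_add]; congr 1; ring
      _ ≤ Real.exp (K * Real.log 2) := by
          rw [Real.exp_le_exp]
          nlinarith [Real.log_two_gt_d9]
      _ = 2 ^ K := h2
      _ ≤ _ := hcount'
      _ ≤ X.card * Real.exp (K / 4) := by
          refine mul_le_mul_of_nonneg_left (hsmall.trans ?_) (Nat.cast_nonneg _)
          rw [Real.exp_le_exp]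
          push_cast
          nlinarith
  exact le_of_mul_le_mul_right h4 (Real.exp_pos _)

/-- The number of points needed for the iterated Radon partition of moment vectors is small. -/
lemma card_smallSets_add_two_pow_le (k K : ℕ) (hK : 16 * (k + 1) ≤ K) :
    (((smallSets K (256 * (k + 1) ^ 2)).card + 2 : ℕ) : ℝ) ^ k ≤ Real.exp (K / 4) := by
  obtain ⟨s, hs⟩ : ∃ s, s = 256 * (k + 1) ^ 2 := ⟨_, rfl⟩
  rw [← hs]
  have hspos : 0 < s := by rw [hs]; positivity
  obtain ⟨D, hD⟩ : ∃ D, D = (smallSets K s).card := ⟨_, rfl⟩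
  rw [← hD]
  have hD1 : 1 ≤ D := hD ▸ Finset.card_pos.mpr ⟨∅, by simp [smallSets]⟩
  -- Here `s = q²`, so both terms of the Chernoff exponent are at most `1 / q`. Then `2k ≤ K/8` and
  -- `k · 2K/q ≤ K/8` add up to `K / 4`.
  obtain ⟨q, hq⟩ : ∃ q : ℝ, q = 16 * (k + 1) := ⟨_, rfl⟩
  have hqpos : 0 < q := by rw [hq]; positivity
  have h1 := card_smallSets_le K s hspos hqpos.le
  rw [← hD] at h1
  have h2 : Real.exp (-q) ≤ 1 / q := by
    rw [Real.exp_neg, ← one_div]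
    exact one_div_le_one_div_of_le hqpos (by linarith [Real.add_one_le_exp q])
  have h3 : q / (s : ℝ) = 1 / q := by
    rw [hs, hq]
    push_cast
    field_simp
    ring
  have hKr : (16 : ℝ) * (k + 1) ≤ K := by exact_mod_cast hK
  have h4 : ((D + 2 : ℕ) : ℝ) ≤ Real.exp (2 + K * (2 / q)) := by
    have h5 : (1 + 2 : ℝ) ≤ Real.exp 2 := by linarith [Real.add_one_le_exp 2]
    have h6 : (D : ℝ) ≤ Real.exp (K * (2 / q)) := by
      refine h1.trans (Real.exp_le_exp.mpr (mul_le_mul_of_nonneg_left ?_ (Nat.cast_nonneg _)))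
      rw [h3]
      calc 1 / q + Real.exp (-q) ≤ 1 / q + 1 / q := by linarith
        _ = 2 / q := by ring
    have h7 : (1 : ℝ) ≤ D := by exact_mod_cast hD1
    rw [Real.exp_add]
    push_cast
    have h8 := Real.exp_pos (K * (2 / q))
    nlinarith
  calc ((D + 2 : ℕ) : ℝ) ^ k ≤ Real.exp (2 + K * (2 / q)) ^ k :=
        pow_le_pow_left₀ (Nat.cast_nonneg _) h4 k
    _ = Real.exp (k * (2 + K * (2 / q))) := by rw [← Real.exp_nat_mul]
    _ ≤ Real.exp (K / 4) := by
        rw [Real.exp_le_exp]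
        have h9 : (k : ℝ) * (2 / q) ≤ 1 / 8 := by
          rw [hq, mul_div_assoc', div_le_iff₀ (by positivity)]
          nlinarith
        have hk0 : (0 : ℝ) ≤ K := Nat.cast_nonneg _
        nlinarith [mul_le_mul_of_nonneg_left h9 hk0]

/-- Nontrivial characters of the parity-one signs have mean zero. -/
lemma sum_prod_cons_eq_zero {k : ℕ} {J : Finset (Fin (k + 1))}
    (hJ : J ∈ LockData.properSubsets (k + 1)) :
    ∑ v : Fin k → ℤˣ, ∏ i ∈ J, sgn ((Fin.cons (∏ j, v j) v : Fin (k + 1) → ℤˣ) i) = 0 := by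
  classical
  obtain ⟨-, hJ0, hJ1⟩ := mem_filter.mp hJ
  have key : ∀ I : Finset (Fin k), I.Nonempty → ∑ v : Fin k → ℤˣ, ∏ i ∈ I, sgn (v i) = 0 := by
    rintro I ⟨i₀, hi₀⟩
    have h1 : ∀ v : Fin k → ℤˣ, ∏ i ∈ I, sgn (v i) = ∏ i, if i ∈ I then sgn (v i) else 1 := by
      intro v
      rw [Finset.prod_ite_mem, Finset.univ_inter]
    simp_rw [h1]
    have h2 := Finset.prod_univ_sum (fun _ : Fin k => (univ : Finset ℤˣ))
      (fun i y => if i ∈ I then sgn y else 1)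
    rw [Fintype.piFinset_univ] at h2
    rw [← h2]
    refine Finset.prod_eq_zero (mem_univ i₀) ?_
    rw [sum_units, if_pos hi₀, if_pos hi₀]
    simp
  have h1 : ∀ v : Fin k → ℤˣ,
      ∏ i ∈ J, sgn ((Fin.cons (∏ j, v j) v : Fin (k + 1) → ℤˣ) i) =
      (if (0 : Fin (k + 1)) ∈ J then ∏ i, sgn (v i) else 1) *
        ∏ i ∈ univ.filter (fun i : Fin k => i.succ ∈ J), sgn (v i) := by
    intro v
    have : ∀ φ : Fin (k + 1) → ℝ, ∏ i ∈ J, φ i = ∏ i, if i ∈ J then φ i else 1 := by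
      intro φ
      rw [Finset.prod_ite_mem, Finset.univ_inter]
    rw [this, Fin.prod_univ_succ]
    simp only [Fin.cons_zero, Fin.cons_succ, map_prod]
    rw [Finset.prod_filter]
  simp_rw [h1]
  by_cases h0 : (0 : Fin (k + 1)) ∈ J
  · simp only [h0, if_true]
    -- Coordinate `0` is the product of the others, so squares cancel and the character of the
    -- complement of `J` remains; it is nontrivial because `J` is proper.
    have h2 : ∀ v : Fin k → ℤˣ, (∏ i, sgn (v i)) *
        ∏ i ∈ univ.filter (fun i : Fin k => i.succ ∈ J), sgn (v i) =
        ∏ i ∈ univ.filter (fun i : Fin k => i.succ ∉ J), sgn (v i) := by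
      intro v
      rw [← Finset.prod_filter_mul_prod_filter_not univ (fun i : Fin k => i.succ ∈ J),
        mul_right_comm, ← Finset.prod_mul_distrib]
      rw [Finset.prod_eq_one, one_mul]
      intro i _
      rcases sgn_eq_or (v i) with h | h <;> simp [h]
    simp_rw [h2]
    refine key _ ?_
    by_contra hne
    rw [Finset.not_nonempty_iff_eq_empty] at hne
    apply hJ1
    refine Finset.eq_univ_iff_forall.mpr fun i => ?_
    refine Fin.cases h0 (fun j => ?_) i
    by_contra hj
    have : j ∈ univ.filter (fun i : Fin k => i.succ ∉ J) := mem_filter.mpr ⟨mem_univ _, hj⟩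
    rw [hne] at this
    simp at this
  · simp only [h0, if_false, one_mul]
    refine key _ ?_
    obtain ⟨i, hi⟩ := Finset.nonempty_iff_ne_empty.mpr hJ0
    induction i using Fin.cases with
    | zero => exact absurd hi h0
    | succ j => exact ⟨j, mem_filter.mpr ⟨mem_univ _, hi⟩⟩

/-- A weighted separated code with roles of parity one that are uncorrelated with the low-degree
moments of the codewords. -/
theorem exists_role_code (k K L : ℕ) (hK : 16 * (k + 1) ≤ K) (hL : 2 ^ K ≤ L) :
    ∃ (ρ : stdSimplex ℝ (Fin L)) (x : Fin L → Fin K → ℤˣ) (u : Fin L → Fin (k + 1) → ℤˣ),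
      (∀ m l, ρ m ≠ 0 → ρ l ≠ 0 → m ≠ l → K ≤ 16 * hammingDist (x m) (x l)) ∧
      (∀ m, ∏ i, u m i = 1) ∧
      ∀ J ∈ LockData.properSubsets (k + 1), ∀ S ∈ smallSets K (256 * (k + 1) ^ 2),
        ∑ m, ρ m * ((∏ i ∈ J, sgn (u m i)) * ∏ j ∈ S, sgn (x m j)) = 0 := by
  classical
  set s := 256 * (k + 1) ^ 2 with hs
  set D := (smallSets K s).card with hD
  obtain ⟨X, hXsep, hXcard⟩ := exists_separated_code K
  have hcard : (D + 2) ^ k ≤ X.card := by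
    have := (card_smallSets_add_two_pow_le k K hK).trans hXcard
    exact_mod_cast this
  have hcardI : Fintype.card (Fin k → Fin (D + 2)) = (D + 2) ^ k := by simp
  obtain ⟨cw⟩ := Function.Embedding.nonempty_of_card_le
    (show Fintype.card (Fin k → Fin (D + 2)) ≤ Fintype.card X by
      rw [hcardI, Fintype.card_coe]; exact hcard)
  have hXL : X.card ≤ L := by
    refine le_trans ?_ hL
    have := Finset.card_le_univ X
    rwa [Fintype.card_fun, Fintype.card_fin, Fintype.card_units_int] at this
  obtain ⟨emb⟩ := Function.Embedding.nonempty_of_card_le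
    (show Fintype.card (Fin k → Fin (D + 2)) ≤ Fintype.card (Fin L) by
      rw [hcardI, Fintype.card_fin]; exact hcard.trans hXL)
  -- The points are the vectors of all low-degree monomials of the codewords; the common barycentre
  -- `z` says that the conditional moments do not depend on the role.
  obtain ⟨w, hw0, hw1, hwd, z, hz⟩ := exists_iterated_radon_weights
    (V := smallSets K s → ℝ) (D := D) (by simp [hD]) k
    (fun i S => ∏ j ∈ S.1, sgn ((cw i).1 j))
  -- Disjoint supports let the codeword determine its role; a codeword of weight zero gets an
  -- arbitrary one.
  have hrole : ∀ i, ∃ v, ∀ v', w v' i ≠ 0 → v' = v := by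
    intro i
    by_cases h : ∃ v, w v i ≠ 0
    · obtain ⟨v, hv⟩ := h
      refine ⟨v, fun v' hv' => ?_⟩
      by_contra hne
      rcases hwd v' v i hne with h | h
      · exact hv' h
      · exact hv h
    · push Not at h
      exact ⟨1, fun v' hv' => absurd (h v') hv'⟩
  choose role hrole using hrole
  set r : (Fin k → Fin (D + 2)) → ℝ := fun i => (1 / 2) ^ k * ∑ v, w v i with hr
  have hr0 : ∀ i, 0 ≤ r i := fun i =>
    mul_nonneg (by positivity) (Finset.sum_nonneg fun v _ => hw0 v i)
  have hr1 : ∑ i, r i = 1 := by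
    rw [hr, ← Finset.mul_sum, Finset.sum_comm]
    simp_rw [hw1]
    rw [Finset.sum_const, nsmul_eq_mul, mul_one, Finset.card_univ, Fintype.card_fun,
      Fintype.card_fin, Fintype.card_units_int]
    push_cast
    rw [← mul_pow]
    norm_num
  have : Nonempty (Fin k → Fin (D + 2)) := ⟨0⟩
  -- Indices outside the range of `emb` have weight zero, so the value of `inv` there is irrelevant.
  set inv : Fin L → (Fin k → Fin (D + 2)) := Function.invFun emb with hinv
  have hinv' : ∀ i, inv (emb i) = i := Function.leftInverse_invFun emb.injective
  have hpush : ∀ F : Fin L → ℝ,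
      ∑ m, (∑ i, if emb i = m then r i else 0) * F m = ∑ i, r i * F (emb i) := by
    intro F
    simp_rw [Finset.sum_mul]
    rw [Finset.sum_comm]
    refine Finset.sum_congr rfl fun i _ => ?_
    simp
  refine ⟨⟨fun m => ∑ i, if emb i = m then r i else 0, fun m =>
    Finset.sum_nonneg fun i _ => by split_ifs <;> simp [hr0], by
      have := hpush fun _ => 1
      simpa [hr1] using this⟩, fun m => (cw (inv m)).1,
    fun m => Fin.cons (∏ j, role (inv m) j) (role (inv m)), ?_, ?_, ?_⟩
  · have hmem : ∀ m, (∑ i, if emb i = m then r i else 0) ≠ 0 → ∃ i, emb i = m := by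
      intro m hm
      by_contra hc
      push Not at hc
      exact hm (Finset.sum_eq_zero fun i _ => if_neg (hc i))
    intro m l hm hl hml
    obtain ⟨i, rfl⟩ := hmem m hm
    obtain ⟨j, rfl⟩ := hmem l hl
    dsimp only
    rw [hinv', hinv']
    refine hXsep _ (cw i).2 _ (cw j).2 fun h => hml ?_
    rw [cw.injective (Subtype.ext h)]
  · intro m
    rw [Fin.prod_univ_succ]
    simp only [Fin.cons_zero, Fin.cons_succ]
    exact Int.units_mul_self _
  · intro J hJ S hS
    have h1 := hpush fun m => (∏ i ∈ J, sgn ((Fin.cons (∏ j, role (inv m) j) (role (inv m)) :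
      Fin (k + 1) → ℤˣ) i)) * ∏ j ∈ S, sgn ((cw (inv m)).1 j)
    refine Eq.trans h1 ?_
    simp only [hinv']
    have h2 : ∀ i, r i * ((∏ a ∈ J, sgn ((Fin.cons (∏ j, role i j) (role i) :
        Fin (k + 1) → ℤˣ) a)) * ∏ j ∈ S, sgn ((cw i).1 j)) =
        ∑ v, (1 / 2) ^ k * (∏ a ∈ J, sgn ((Fin.cons (∏ j, v j) v : Fin (k + 1) → ℤˣ) a)) *
          (w v i * ∏ j ∈ S, sgn ((cw i).1 j)) := by
      intro i
      rw [hr]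
      dsimp only
      rw [Finset.mul_sum, Finset.sum_mul]
      refine Finset.sum_congr rfl fun v _ => ?_
      by_cases hv : w v i = 0
      · rw [hv]; ring
      · rw [hrole i v hv]; ring
    simp_rw [h2]
    rw [Finset.sum_comm]
    -- The moment factors out of the sum over roles, leaving the mean of a nontrivial character.
    have h3 : ∀ v, ∑ i, w v i * ∏ j ∈ S, sgn ((cw i).1 j) = z ⟨S, hS⟩ := by
      intro v
      have := congrFun (hz v) ⟨S, hS⟩
      simpa using this
    simp_rw [← Finset.mul_sum, h3]
    rw [← Finset.sum_mul, ← Finset.mul_sum, sum_prod_cons_eq_zero hJ]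
    ring

end Codes

/-! ### Polynomials of low degree in the codeword do not see the roles -/

/-- Monomials of low degree in the codeword are uncorrelated with the roles. -/
def RolesHidden {L K n : ℕ} (ρ : stdSimplex ℝ (Fin L)) (x : Fin L → Fin K → ℤˣ)
    (u : Fin L → Fin n → ℤˣ) (s : ℕ) : Prop :=
  ∀ J ∈ LockData.properSubsets n, ∀ S ∈ smallSets K s,
    ∑ m, ρ m * ((∏ i ∈ J, sgn (u m i)) * ∏ j ∈ S, sgn (x m j)) = 0

/-- Signs square to one, so repeated coordinates cancel in pairs. This carries `RolesHidden` over to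
monomials with repetitions. -/
lemma exists_multilinear {K : ℕ} {ι : Type} (T : Finset ι) (j : ι → Fin K) :
    ∃ S : Finset (Fin K), S.card ≤ T.card ∧
      ∀ x : Fin K → ℤˣ, ∏ h ∈ T, sgn (x (j h)) = ∏ i ∈ S, sgn (x i) := by
  classical
  induction T using Finset.induction_on with
  | empty => exact ⟨∅, le_rfl, fun x => rfl⟩
  | insert a T ha ih =>
    obtain ⟨S, hS, hx⟩ := ih
    by_cases haS : j a ∈ S
    · refine ⟨S.erase (j a), ?_, fun x => ?_⟩
      · have := Finset.card_erase_le (s := S) (a := j a)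
        have := Finset.card_le_card (Finset.subset_insert a T)
        omega
      · rw [Finset.prod_insert ha, hx x, ← Finset.mul_prod_erase S _ haS, ← mul_assoc, ← map_mul,
          Int.units_mul_self, map_one, one_mul]
    · refine ⟨insert (j a) S, ?_, fun x => ?_⟩
      · rw [Finset.card_insert_of_notMem haS, Finset.card_insert_of_notMem ha]
        omega
      · rw [Finset.prod_insert ha, hx x, Finset.prod_insert haS]

lemma RolesHidden.sum_eq_zero {L K n : ℕ} {ρ : stdSimplex ℝ (Fin L)} {x : Fin L → Fin K → ℤˣ}
    {u : Fin L → Fin n → ℤˣ} {s : ℕ} (h : RolesHidden ρ x u s) {J : Finset (Fin n)}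
    (hJ : J ∈ LockData.properSubsets n) {ι : Type} (T : Finset ι) (hT : s * T.card ≤ K)
    (j : ι → Fin K) :
    ∑ m, ρ m * ((∏ i ∈ J, sgn (u m i)) * ∏ h ∈ T, sgn (x m (j h))) = 0 := by
  obtain ⟨S, hS, hx⟩ := exists_multilinear T j
  simp_rw [hx]
  exact h J hJ S (Finset.mem_filter.mpr ⟨Finset.mem_univ _,
    (Nat.mul_le_mul_left s hS).trans hT⟩)

lemma sum_prod_fun {α : Type} [Fintype α] {n : ℕ} (φ : Fin n → α → ℝ) :
    ∑ f : Fin n → α, ∏ i, φ i (f i) = ∏ i, ∑ a, φ i a := by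
  classical
  rw [Finset.prod_univ_sum, Fintype.piFinset_univ]

namespace LockData

variable {L K n H₁ : ℕ} [NeZero K]

/-! ### The gate that is always open -/

/-- Lock data whose gate is always open. -/
def openGate (H₁ : ℕ) (ρ : stdSimplex ℝ (Fin L)) (x : Fin L → Fin K → ℤˣ)
    (u : Fin L → Fin n → ℤˣ) (b : ℝ) (hb : |b| ≤ 1) : LockData L K n H₁ Unit where
  ρ := ρ
  x := x
  u := u
  b := b
  abs_b_le := hb
  init := ()
  upd _ _ _ := ()
  g _ _ := 1
  g_mem _ _ := by simp

lemma sum_obsWeight {𝓝 : Type} (Q : LockData L K n H₁ 𝓝) (m : Fin L) :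
    ∑ o, Q.obsWeight m o = 1 := by
  unfold obsWeight
  rw [sum_prod_fun (fun _ o => Q.obs m o)]
  simp

lemma openProb_openGate (ρ : stdSimplex ℝ (Fin L)) (x : Fin L → Fin K → ℤˣ)
    (u : Fin L → Fin n → ℤˣ) (b : ℝ) (hb : |b| ≤ 1) :
    (openGate H₁ ρ x u b hb).openProb = 1 := by
  unfold openProb
  have : ∀ m o, (openGate H₁ ρ x u b hb).gateProb m o = 1 := fun _ _ => rfl
  simp_rw [this, mul_one, sum_obsWeight, mul_one]
  exact sum_simplex ρ

/-- The normalized inner product of two codewords. -/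
def overlap (x y : Fin K → ℤˣ) : ℝ := (∑ j, sgn (x j * y j)) / K

lemma abs_overlap_le (x y : Fin K → ℤˣ) : |overlap x y| ≤ 1 := by
  have hK : (0 : ℝ) < K := Nat.cast_pos.mpr (NeZero.pos K)
  rw [overlap, abs_div, abs_of_pos hK, div_le_one hK]
  refine (Finset.abs_sum_le_sum_abs _ _).trans (le_of_eq ?_)
  simp [abs_sgn]

/-- The terms linear in `b` cancel between the two signs; this is the one-step factor of the second
moment. -/
lemma sum_obsDist_mul (b : ℝ) (hb : |b| ≤ 1) (x y : Fin K → ℤˣ) :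
    ∑ o, obsDist b hb x o * obsDist b hb y o = (1 + b ^ 2 * overlap x y) / (2 * K) := by
  have hK : (K : ℝ) ≠ 0 := NeZero.ne _
  rw [Fintype.sum_prod_type]
  have h1 : ∀ j, ∑ z : ℤˣ, obsDist b hb x (j, z) * obsDist b hb y (j, z) =
      (1 / (2 * K ^ 2)) * (1 + b ^ 2 * sgn (x j * y j)) := by
    intro j
    rw [sum_units]
    simp only [obsDist_apply, map_mul, map_one, sgn_neg_one]
    field_simp
    ring
  simp_rw [h1]
  rw [← Finset.mul_sum, Finset.sum_add_distrib, ← Finset.mul_sum, overlap]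
  simp only [Finset.sum_const, Finset.card_univ, Fintype.card_fin, nsmul_eq_mul, mul_one]
  field_simp

/-- For fixed `y`, the `k`-th power of the overlap is a polynomial of degree at most `k` in the
codeword. -/
lemma sum_mul_overlap_pow_eq_zero {ρ : stdSimplex ℝ (Fin L)} {x : Fin L → Fin K → ℤˣ}
    {u : Fin L → Fin n → ℤˣ} {s : ℕ} (h : RolesHidden ρ x u s) {J : Finset (Fin n)}
    (hJ : J ∈ properSubsets n) {k : ℕ} (hk : s * k ≤ K) (y : Fin K → ℤˣ) :
    ∑ m, ρ m * ((∏ i ∈ J, sgn (u m i)) * overlap (x m) y ^ k) = 0 := by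
  have h1 : ∀ m, overlap (x m) y ^ k = ∑ j : Fin k → Fin K,
      (∏ t, sgn (y (j t)) / K) * ∏ t, sgn (x m (j t)) := by
    intro m
    have h2 : ∏ _t : Fin k, ∑ j, sgn (x m j * y j) / (K : ℝ) = overlap (x m) y ^ k := by
      rw [Finset.prod_const, Finset.card_univ, Fintype.card_fin, overlap, Finset.sum_div]
    rw [← h2, ← sum_prod_fun (fun _ j => sgn (x m j * y j) / (K : ℝ))]
    refine Finset.sum_congr rfl fun j _ => ?_
    rw [← Finset.prod_mul_distrib]
    refine Finset.prod_congr rfl fun t _ => ?_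
    rw [map_mul]
    ring
  simp_rw [h1, Finset.mul_sum]
  rw [Finset.sum_comm]
  refine Finset.sum_eq_zero fun j _ => ?_
  have h3 := h.sum_eq_zero hJ (Finset.univ : Finset (Fin k)) (by simpa using hk) j
  calc _ = (∏ t, sgn (y (j t)) / (K : ℝ)) *
        ∑ m, ρ m * ((∏ i ∈ J, sgn (u m i)) * ∏ t, sgn (x m (j t))) := by
        rw [Finset.mul_sum]
        refine Finset.sum_congr rfl fun m _ => ?_
        ring
    _ = 0 := by rw [h3, mul_zero]

lemma abs_sum_mul_le (ρ : stdSimplex ℝ (Fin L)) (F : Fin L → ℝ) {C : ℝ} (hF : ∀ m, |F m| ≤ C) :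
    |∑ m, ρ m * F m| ≤ C := by
  calc _ ≤ ∑ m, |(ρ m : ℝ) * F m| := Finset.abs_sum_le_sum_abs _ _
    _ ≤ ∑ m, ρ m * C := by
        refine Finset.sum_le_sum fun m _ => ?_
        have h0 : (0 : ℝ) ≤ ρ m := ρ.2.1 m
        rw [abs_mul, abs_of_nonneg h0]
        exact mul_le_mul_of_nonneg_left (hF m) h0
    _ = C := by rw [← Finset.sum_mul, sum_simplex, one_mul]

lemma abs_prod_sgn (J : Finset (Fin n)) (v : Fin n → ℤˣ) : |∏ i ∈ J, sgn (v i)| = 1 := by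
  rw [Finset.abs_prod]
  exact Finset.prod_eq_one fun i _ => abs_sgn _

/-- In the binomial expansion the degrees `k ≤ K / s` vanish. The others are multiplied by `e^{q(k -
K/s)} ≥ 1` and resummed to `e^{-qK/s} (1 + b² e^q)^H`. -/
lemma sum_role_mul_one_add_pow_le {ρ : stdSimplex ℝ (Fin L)} {x : Fin L → Fin K → ℤˣ}
    {u : Fin L → Fin n → ℤˣ} {s : ℕ} (hs : 0 < s) (h : RolesHidden ρ x u s)
    {J : Finset (Fin n)} (hJ : J ∈ properSubsets n) (b : ℝ) {q : ℝ} (hq : 0 ≤ q) (H : ℕ)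
    (y : Fin K → ℤˣ) :
    |∑ m, ρ m * ((∏ i ∈ J, sgn (u m i)) * (1 + b ^ 2 * overlap (x m) y) ^ H)| ≤
      Real.exp (b ^ 2 * Real.exp q * H - q * (K / s)) := by
  have hs' : (0 : ℝ) < s := Nat.cast_pos.mpr hs
  have h1 : ∑ m, ρ m * ((∏ i ∈ J, sgn (u m i)) * (1 + b ^ 2 * overlap (x m) y) ^ H) =
      ∑ k ∈ Finset.range (H + 1), (b ^ 2) ^ k * (H.choose k : ℝ) *
        ∑ m, ρ m * ((∏ i ∈ J, sgn (u m i)) * overlap (x m) y ^ k) := by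
    simp_rw [Finset.mul_sum]
    rw [Finset.sum_comm]
    refine Finset.sum_congr rfl fun m _ => ?_
    rw [add_comm, add_pow, Finset.mul_sum, Finset.mul_sum]
    refine Finset.sum_congr rfl fun k _ => ?_
    rw [one_pow, mul_pow]
    ring
  have h2 : ∀ k, |(b ^ 2) ^ k * (H.choose k : ℝ) *
      ∑ m, ρ m * ((∏ i ∈ J, sgn (u m i)) * overlap (x m) y ^ k)| ≤
      Real.exp (-(q * (K / s))) * ((b ^ 2 * Real.exp q) ^ k * 1 ^ (H - k) * (H.choose k : ℝ)) := by
    intro k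
    by_cases hk : s * k ≤ K
    · rw [sum_mul_overlap_pow_eq_zero h hJ hk, mul_zero, abs_zero]
      positivity
    · rw [abs_mul, abs_of_nonneg (by positivity : 0 ≤ (b ^ 2) ^ k * (H.choose k : ℝ))]
      have h3 : |∑ m, ρ m * ((∏ i ∈ J, sgn (u m i)) * overlap (x m) y ^ k)| ≤ 1 := by
        refine abs_sum_mul_le ρ _ fun m => ?_
        rw [abs_mul, abs_prod_sgn, one_mul, abs_pow]
        exact pow_le_one₀ (abs_nonneg _) (abs_overlap_le _ _)
      have h4 : (1 : ℝ) ≤ Real.exp (-(q * (K / s))) * Real.exp q ^ k := by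
        rw [← Real.exp_nat_mul, ← Real.exp_add]
        refine Real.one_le_exp ?_
        have h5 : (K : ℝ) / s ≤ k := by
          rw [div_le_iff₀ hs']
          have : K ≤ k * s := by rw [mul_comm]; omega
          exact_mod_cast this
        nlinarith
      have h6 : 0 ≤ (b ^ 2) ^ k * (H.choose k : ℝ) := by positivity
      calc _ ≤ (b ^ 2) ^ k * (H.choose k : ℝ) * 1 := mul_le_mul_of_nonneg_left h3 h6
        _ ≤ (b ^ 2) ^ k * (H.choose k : ℝ) *
            (Real.exp (-(q * (K / s))) * Real.exp q ^ k) := mul_le_mul_of_nonneg_left h4 h6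
        _ = _ := by rw [mul_pow, one_pow]; ring
  rw [h1]
  refine (Finset.abs_sum_le_sum_abs _ _).trans ((Finset.sum_le_sum fun k _ => h2 k).trans ?_)
  rw [← Finset.mul_sum, ← add_pow]
  calc _ ≤ Real.exp (-(q * (K / s))) * Real.exp (b ^ 2 * Real.exp q) ^ H := by
        refine mul_le_mul_of_nonneg_left (pow_le_pow_left₀ (by positivity)
          (Real.add_one_le_exp _) H) (Real.exp_pos _).le
    _ = _ := by
        rw [← Real.exp_nat_mul, ← Real.exp_add]
        congr 1
        ring

/-- Second moment bound for the leak through the observations of a whole episode. -/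
lemma sum_abs_leak_openGate_le {ρ : stdSimplex ℝ (Fin L)} {x : Fin L → Fin K → ℤˣ}
    {u : Fin L → Fin n → ℤˣ} {s : ℕ} (hs : 0 < s) (h : RolesHidden ρ x u s)
    (b : ℝ) (hb : |b| ≤ 1) {q : ℝ} (hq : 0 ≤ q) {J : Finset (Fin n)}
    (hJ : J ∈ properSubsets n) :
    ∑ o, |(openGate H₁ ρ x u b hb).leak J o| ≤
      Real.exp ((b ^ 2 * Real.exp q * (H₁ + 1 + n : ℕ) - q * (K / s)) / 2) := by
  set H := H₁ + 1 + n with hH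
  have hK : (0 : ℝ) < K := Nat.cast_pos.mpr (NeZero.pos K)
  set Q := openGate H₁ ρ x u b hb with hQ
  set E : ℝ := b ^ 2 * Real.exp q * (H : ℕ) - q * (K / s) with hE
  have hleak : ∀ o, Q.leak J o =
      ∑ m, ρ m * ((∏ i ∈ J, sgn (u m i)) * ∏ h, obsDist b hb (x m) (o h)) := by
    intro o
    refine Finset.sum_congr rfl fun m _ => ?_
    change (ρ m : ℝ) * ((∏ h, obsDist b hb (x m) (o h)) * 1 * ∏ i ∈ J, sgn (u m i)) = _
    ring
  -- Two replicas `m`, `m'` of the instance: summing over the observations leaves a power of `1 + b²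
  -- overlap`, bounded for each fixed `m'`.
  have hsq : ∑ o, Q.leak J o ^ 2 ≤ (1 / (2 * K) : ℝ) ^ H * Real.exp E := by
    have h1 : ∑ o, Q.leak J o ^ 2 = ∑ m', ρ m' * ((∏ i ∈ J, sgn (u m' i)) *
        ((1 / (2 * K) : ℝ) ^ H * ∑ m, ρ m * ((∏ i ∈ J, sgn (u m i)) *
          (1 + b ^ 2 * overlap (x m) (x m')) ^ H))) := by
      have h2 : ∀ m m', (1 / (2 * K) : ℝ) ^ H * (1 + b ^ 2 * overlap (x m) (x m')) ^ H =
          ∑ o : Fin H → Fin K × ℤˣ,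
            (∏ h, obsDist b hb (x m) (o h)) * ∏ h, obsDist b hb (x m') (o h) := by
        intro m m'
        simp_rw [← Finset.prod_mul_distrib]
        rw [sum_prod_fun (fun _ o => obsDist b hb (x m) o * obsDist b hb (x m') o)]
        simp_rw [sum_obsDist_mul]
        rw [Finset.prod_const, Finset.card_univ, Fintype.card_fin, ← mul_pow]
        congr 1
        ring
      have h3 : ∀ m', (∏ i ∈ J, sgn (u m' i)) *
        ((1 / (2 * K) : ℝ) ^ H * ∑ m, ρ m * ((∏ i ∈ J, sgn (u m i)) *
          (1 + b ^ 2 * overlap (x m) (x m')) ^ H)) = ∑ m, ρ m * ((∏ i ∈ J, sgn (u m' i)) *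
            (∏ i ∈ J, sgn (u m i)) * ∑ o : Fin H → Fin K × ℤˣ,
            (∏ h, obsDist b hb (x m) (o h)) * ∏ h, obsDist b hb (x m') (o h)) := by
        intro m'
        rw [Finset.mul_sum, Finset.mul_sum]
        refine Finset.sum_congr rfl fun m _ => ?_
        rw [← h2]
        ring
      simp_rw [h3, hleak, sq, Finset.sum_mul_sum, Finset.mul_sum]
      rw [Finset.sum_comm]
      refine Finset.sum_congr rfl fun m' _ => ?_
      rw [Finset.sum_comm]
      refine Finset.sum_congr rfl fun m _ => Finset.sum_congr rfl fun o _ => ?_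
      ring
    rw [h1]
    refine (le_abs_self _).trans (abs_sum_mul_le ρ _ fun m' => ?_)
    rw [abs_mul, abs_prod_sgn, one_mul, abs_mul, abs_of_nonneg (by positivity)]
    exact mul_le_mul_of_nonneg_left (sum_role_mul_one_add_pow_le hs h hJ b hq H _)
      (by positivity)
  -- Cauchy–Schwarz over `(2K)^H` observation sequences, which cancels the prefactor.
  have hcs : (∑ o, |Q.leak J o|) ^ 2 ≤ Real.exp E := by
    have h1 := sq_sum_le_card_mul_sum_sq (s := (Finset.univ : Finset (Fin H → Fin K × ℤˣ)))
      (f := fun o => |Q.leak J o|)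
    simp_rw [sq_abs] at h1
    rw [Finset.card_univ, Fintype.card_fun, Fintype.card_prod, Fintype.card_fin, Fintype.card_fin,
      Fintype.card_units_int] at h1
    refine h1.trans ((mul_le_mul_of_nonneg_left hsq (by positivity)).trans (le_of_eq ?_))
    push_cast
    rw [← mul_assoc, ← mul_pow]
    have : (K : ℝ) * 2 * (1 / (2 * K)) = 1 := by field_simp
    rw [this, one_pow, one_mul]
  have h0 : 0 ≤ ∑ o, |Q.leak J o| := Finset.sum_nonneg fun _ _ => abs_nonneg _
  refine le_of_sq_le_sq ?_ (Real.exp_pos _).le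
  rw [← Real.exp_nat_mul]
  refine hcs.trans (le_of_eq ?_)
  congr 1
  push_cast
  ring

end LockData

namespace LockData

variable {L K n H₁ : ℕ} [NeZero K]

/-! ### The gate that equalizes the likelihoods -/

/-- The likelihood of observations under a codeword, relative to the uniform distribution. -/
def likelihood (b : ℝ) (x : Fin K → ℤˣ) (ν : Fin H₁ → Fin K × ℤˣ) : ℝ :=
  ∏ i, (1 + sgn (x (ν i).1 * (ν i).2) * b)

lemma one_add_sgn_mul_pos {b : ℝ} (hb : |b| < 1) (y : ℤˣ) : 0 < 1 + sgn y * b := by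
  have h : |sgn y * b| < 1 := by rwa [abs_mul, abs_sgn, one_mul]
  linarith [(abs_lt.mp h).1]

lemma likelihood_pos {b : ℝ} (hb : |b| < 1) (x : Fin K → ℤˣ) (ν : Fin H₁ → Fin K × ℤˣ) :
    0 < likelihood b x ν :=
  Finset.prod_pos fun _ _ => one_add_sgn_mul_pos hb _

/-- The sum of the inverse likelihoods over all sign vectors. -/
def inverseSum (b : ℝ) (ν : Fin H₁ → Fin K × ℤˣ) : ℝ := ∑ x : Fin K → ℤˣ, (likelihood b x ν)⁻¹

lemma inverseSum_pos {b : ℝ} (hb : |b| < 1) (ν : Fin H₁ → Fin K × ℤˣ) : 0 < inverseSum b ν :=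
  Finset.sum_pos (fun x _ => inv_pos.mpr (likelihood_pos hb x ν)) ⟨1, Finset.mem_univ _⟩

lemma one_le_likelihood_mul_inverseSum {b : ℝ} (hb : |b| < 1) (x : Fin K → ℤˣ)
    (ν : Fin H₁ → Fin K × ℤˣ) : 1 ≤ likelihood b x ν * inverseSum b ν := by
  have h := likelihood_pos hb x ν
  calc 1 = likelihood b x ν * (likelihood b x ν)⁻¹ := (mul_inv_cancel₀ h.ne').symm
    _ ≤ _ := mul_le_mul_of_nonneg_left
        (Finset.single_le_sum (f := fun x : Fin K → ℤˣ => (likelihood b x ν)⁻¹)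
          (fun x _ => (inv_pos.mpr (likelihood_pos hb x ν)).le) (Finset.mem_univ x)) h.le

/-- Lock data whose gate opens with probability inversely proportional to the likelihood of the
observations made before, so that an open gate is uninformative. -/
def equalizingGate (H₁ : ℕ) (ρ : stdSimplex ℝ (Fin L)) (x : Fin L → Fin K → ℤˣ)
    (u : Fin L → Fin n → ℤˣ) (b : ℝ) (hb : |b| < 1) :
    LockData L K n H₁ (Fin H₁ → Fin K × ℤˣ) where
  ρ := ρ
  x := x
  u := u
  b := b
  abs_b_le := hb.le
  init := fun _ => (0, 1)
  upd k ν o := if hk : k < H₁ then Function.update ν ⟨k, hk⟩ o else ν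
  -- The normalizer is the same for all instances, and containing the inverse likelihood of `x m` it
  -- keeps the value at most one.
  g m ν := (likelihood b (x m) ν * inverseSum b ν)⁻¹
  g_mem m ν := ⟨inv_nonneg.mpr (zero_le_one.trans (one_le_likelihood_mul_inverseSum hb (x m) ν)),
    inv_le_one_of_one_le₀ (one_le_likelihood_mul_inverseSum hb (x m) ν)⟩

variable {ρ : stdSimplex ℝ (Fin L)} {x : Fin L → Fin K → ℤˣ} {u : Fin L → Fin n → ℤˣ} {b : ℝ}

lemma obsMem_equalizingGate (hb : |b| < 1) (o : Fin (H₁ + 1 + n) → Fin K × ℤˣ) :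
    (equalizingGate H₁ ρ x u b hb).obsMem o H₁ = fun i : Fin H₁ => o ⟨i, by omega⟩ := by
  have key : ∀ k ≤ H₁, ∀ i : Fin H₁, (i : ℕ) < k →
      (equalizingGate H₁ ρ x u b hb).obsMem o k i = o ⟨i, by omega⟩ := by
    intro k
    induction k with
    | zero => intro _ i hi; omega
    | succ k ih =>
      intro hk i hi
      have hk1 : k < H₁ + 1 + n := by omega
      have hk2 : k < H₁ := by omega
      simp only [obsMem, hk1, dif_pos]
      simp only [equalizingGate, hk2, dif_pos]
      by_cases hik : (i : ℕ) = k
      · have hik' : i = ⟨k, hk2⟩ := Fin.ext hik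
        subst hik'
        rw [Function.update_self]
      · rw [Function.update_of_ne (fun h => hik (by rw [h]))]
        exact ih (by omega) i (by omega)
  funext i
  exact key H₁ le_rfl i i.2

lemma gateProb_equalizingGate (hb : |b| < 1) (m : Fin L)
    (o : Fin (H₁ + 1 + n) → Fin K × ℤˣ) :
    (equalizingGate H₁ ρ x u b hb).gateProb m o =
      (likelihood b (x m) (fun i : Fin H₁ => o ⟨i, by omega⟩) *
        inverseSum b (fun i : Fin H₁ => o ⟨i, by omega⟩))⁻¹ := by
  unfold gateProb
  rw [obsMem_equalizingGate]
  rfl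

lemma prod_obsDist_mul_inv (hb : |b| < 1) (y : Fin K → ℤˣ) (ν : Fin H₁ → Fin K × ℤˣ) :
    (∏ i, obsDist b hb.le y (ν i)) * (likelihood b y ν * inverseSum b ν)⁻¹ =
      (1 / (2 * K) : ℝ) ^ H₁ * (inverseSum b ν)⁻¹ := by
  have h1 : ∏ i, obsDist b hb.le y (ν i) = (1 / (2 * K) : ℝ) ^ H₁ * likelihood b y ν := by
    simp only [obsDist_apply, likelihood, div_eq_mul_inv, Finset.prod_mul_distrib,
      Finset.prod_const, Finset.card_univ, Fintype.card_fin, one_mul]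
    ring
  have h2 := (likelihood_pos hb y ν).ne'
  rw [h1, mul_inv]
  field_simp

/-- Behind the equalizing gate nothing leaks. -/
lemma leak_equalizingGate (hb : |b| < 1) {s : ℕ} (h : RolesHidden ρ x u s)
    (hs : s * (n + 1) ≤ K) {J : Finset (Fin n)} (hJ : J ∈ properSubsets n)
    (o : Fin (H₁ + 1 + n) → Fin K × ℤˣ) :
    (equalizingGate H₁ ρ x u b hb).leak J o = 0 := by
  classical
  set ν : Fin H₁ → Fin K × ℤˣ := fun i => o ⟨i, by omega⟩ with hν
  -- The observations at the gate and in the lock are not in the memory and stay informative, but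
  -- their likelihood has degree at most `n + 1`, which `hs` allows.
  set o' : Fin (n + 1) → Fin K × ℤˣ := Fin.cons (o (gateTime n H₁)) fun i => o (lockTime H₁ i)
    with ho'
  have h1 : ∀ m, (equalizingGate H₁ ρ x u b hb).obsWeight m o *
      (equalizingGate H₁ ρ x u b hb).gateProb m o =
      ((1 / (2 * K) : ℝ) ^ H₁ * (inverseSum b ν)⁻¹) * ∏ i, obsDist b hb.le (x m) (o' i) := by
    intro m
    rw [gateProb_equalizingGate, obsWeight, prod_three, ← prod_obsDist_mul_inv hb (x m) ν,
      Fin.prod_univ_succ]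
    simp only [ho', Fin.cons_zero, Fin.cons_succ]
    change (∏ i, obsDist b hb.le (x m) (ν i)) * obsDist b hb.le (x m) (o (gateTime n H₁)) *
      (∏ i, obsDist b hb.le (x m) (o (lockTime H₁ i))) * _ = _
    ring
  have h2 : ∀ m, ∏ i, obsDist b hb.le (x m) (o' i) = (1 / (2 * K) : ℝ) ^ (n + 1) *
      ∑ T : Finset (Fin (n + 1)), (∏ i ∈ T, sgn (o' i).2 * b) *
        ∏ i ∈ T, sgn (x m (o' i).1) := by
    intro m
    simp only [obsDist_apply, div_eq_mul_inv, Finset.prod_mul_distrib, Finset.prod_const,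
      Finset.card_univ, Fintype.card_fin, one_mul]
    rw [Finset.prod_one_add, Finset.powerset_univ, mul_comm]
    congr 1
    refine Finset.sum_congr rfl fun T _ => ?_
    simp only [map_mul, Finset.prod_mul_distrib, Finset.prod_const]
    ring
  unfold leak
  set C := ((1 / (2 * K) : ℝ) ^ H₁ * (inverseSum b ν)⁻¹) * (1 / (2 * K) : ℝ) ^ (n + 1) with hC
  have h3 : ∀ m, (ρ m : ℝ) * ((equalizingGate H₁ ρ x u b hb).obsWeight m o *
      (equalizingGate H₁ ρ x u b hb).gateProb m o * ∏ i ∈ J, sgn (u m i)) =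
      ∑ T : Finset (Fin (n + 1)), (C * ∏ i ∈ T, sgn (o' i).2 * b) *
        (ρ m * ((∏ i ∈ J, sgn (u m i)) * ∏ i ∈ T, sgn (x m (o' i).1))) := by
    intro m
    rw [h1, h2, Finset.mul_sum, Finset.mul_sum, Finset.sum_mul, Finset.mul_sum]
    refine Finset.sum_congr rfl fun T _ => ?_
    rw [hC]
    ring
  refine (Finset.sum_congr rfl fun m _ => h3 m).trans ?_
  rw [Finset.sum_comm]
  refine Finset.sum_eq_zero fun T _ => ?_
  rw [← Finset.mul_sum, h.sum_eq_zero hJ T ?_ (fun i => (o' i).1), mul_zero]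
  refine le_trans (Nat.mul_le_mul_left s ?_) hs
  have := Finset.card_le_univ T
  rwa [Fintype.card_fin] at this

/-- For each sign vector the sum factorizes over steps, with `(1 + b)⁻¹ + (1 - b)⁻¹ = 2(1 - b²)⁻¹`
from each coordinate. -/
lemma sum_inverseSum (hb : |b| < 1) :
    ∑ ν : Fin H₁ → Fin K × ℤˣ, inverseSum b ν = 2 ^ K * (2 * K * (1 - b ^ 2)⁻¹) ^ H₁ := by
  unfold inverseSum
  rw [Finset.sum_comm]
  have h1 : ∀ y : Fin K → ℤˣ, ∑ ν : Fin H₁ → Fin K × ℤˣ, (likelihood b y ν)⁻¹ =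
      (2 * K * (1 - b ^ 2)⁻¹) ^ H₁ := by
    intro y
    simp_rw [likelihood, ← Finset.prod_inv_distrib]
    rw [sum_prod_fun (fun _ (o : Fin K × ℤˣ) => (1 + sgn (y o.1 * o.2) * b)⁻¹), Finset.prod_const,
      Finset.card_univ, Fintype.card_fin]
    congr 1
    have hb' := abs_lt.mp hb
    have hp : (1 + b) ≠ 0 := by linarith
    have hm : (1 - b) ≠ 0 := by linarith
    rw [Fintype.sum_prod_type]
    have h2 : ∀ j, ∑ z : ℤˣ, (1 + sgn (y j * z) * b)⁻¹ = 2 * (1 - b ^ 2)⁻¹ := by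
      intro j
      have h3 : (1 + b)⁻¹ + (1 - b)⁻¹ = 2 * (1 - b ^ 2)⁻¹ := by
        rw [show 1 - b ^ 2 = (1 + b) * (1 - b) by ring]
        field_simp
        ring
      rw [sum_units, map_mul, map_mul, map_one, sgn_neg_one, ← h3]
      rcases sgn_eq_or (y j) with h | h <;> rw [h]
      · ring_nf
      · ring_nf
    simp only [h2]
    rw [Finset.sum_const, Finset.card_univ, Fintype.card_fin, nsmul_eq_mul]
    ring
  simp_rw [h1]
  rw [Finset.sum_const, nsmul_eq_mul, Finset.card_univ, Fintype.card_fun, Fintype.card_fin,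
    Fintype.card_units_int]
  push_cast
  rfl

lemma openProb_equalizingGate (hb : |b| < 1) :
    (equalizingGate H₁ ρ x u b hb).openProb =
      ∑ ν : Fin H₁ → Fin K × ℤˣ, (1 / (2 * K) : ℝ) ^ H₁ * (inverseSum b ν)⁻¹ := by
  unfold openProb
  have h1 : ∀ m, ∑ o, (equalizingGate H₁ ρ x u b hb).obsWeight m o *
      (equalizingGate H₁ ρ x u b hb).gateProb m o =
      ∑ ν : Fin H₁ → Fin K × ℤˣ, (1 / (2 * K) : ℝ) ^ H₁ * (inverseSum b ν)⁻¹ := by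
    intro m
    rw [sum_three]
    refine Finset.sum_congr rfl fun ν _ => ?_
    have h2 : ∀ (y : Fin K × ℤˣ) (o₂ : Fin n → Fin K × ℤˣ),
        (equalizingGate H₁ ρ x u b hb).obsWeight m
          (Fin.append (Fin.snoc ν y : Fin (H₁ + 1) → Fin K × ℤˣ) o₂) *
        (equalizingGate H₁ ρ x u b hb).gateProb m
          (Fin.append (Fin.snoc ν y : Fin (H₁ + 1) → Fin K × ℤˣ) o₂) =
        ((1 / (2 * K) : ℝ) ^ H₁ * (inverseSum b ν)⁻¹) *
          (obsDist b hb.le (x m) y * ∏ i, obsDist b hb.le (x m) (o₂ i)) := by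
      intro y o₂
      have e1 : ∀ i : Fin H₁, Fin.append (Fin.snoc ν y : Fin (H₁ + 1) → Fin K × ℤˣ) o₂
          ⟨i, by omega⟩ = ν i := by
        intro i
        have := Fin.append_left (Fin.snoc ν y : Fin (H₁ + 1) → Fin K × ℤˣ) o₂ i.castSucc
        rw [Fin.snoc_castSucc] at this
        exact this
      have e2 : Fin.append (Fin.snoc ν y : Fin (H₁ + 1) → Fin K × ℤˣ) o₂ ⟨H₁, by omega⟩ = y := by
        have := Fin.append_left (Fin.snoc ν y : Fin (H₁ + 1) → Fin K × ℤˣ) o₂ (Fin.last H₁)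
        rw [Fin.snoc_last] at this
        exact this
      have e3 : ∀ i : Fin n, Fin.append (Fin.snoc ν y : Fin (H₁ + 1) → Fin K × ℤˣ) o₂
          ⟨H₁ + 1 + i, by omega⟩ = o₂ i := fun i =>
        Fin.append_right (Fin.snoc ν y : Fin (H₁ + 1) → Fin K × ℤˣ) o₂ i
      rw [gateProb_equalizingGate, obsWeight, prod_three]
      simp only [e1, e2, e3]
      rw [← prod_obsDist_mul_inv hb (x m) ν]
      change (∏ i, obsDist b hb.le (x m) (ν i)) * obsDist b hb.le (x m) y *
        (∏ i, obsDist b hb.le (x m) (o₂ i)) * _ = _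
      ring
    simp_rw [h2, ← Finset.mul_sum]
    rw [sum_prod_fun (fun _ o => obsDist b hb.le (x m) o)]
    have h3 := sum_simplex (obsDist b hb.le (x m))
    simp_rw [h3]
    simp [h3]
  simp_rw [h1]
  rw [← Finset.sum_mul]
  exact (congrArg (· * _) (sum_simplex ρ)).trans (one_mul _)

/-- By Cauchy–Schwarz the mean of the reciprocals of `inverseSum` is at least the reciprocal of its
mean, which `sum_inverseSum` evaluates. -/
lemma le_openProb_equalizingGate (hb : |b| < 1) :
    (1 / 2) ^ K * (1 - b ^ 2) ^ H₁ ≤ (equalizingGate H₁ ρ x u b hb).openProb := by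
  have hK : (0 : ℝ) < K := Nat.cast_pos.mpr (NeZero.pos K)
  have hb2 : 0 < 1 - b ^ 2 := by
    have := (sq_lt_one_iff_abs_lt_one b).mpr hb
    linarith
  rw [openProb_equalizingGate, ← Finset.mul_sum]
  have h1 := Finset.sum_sq_le_sum_mul_sum_of_sq_le_mul
    (Finset.univ : Finset (Fin H₁ → Fin K × ℤˣ)) (r := fun _ => (1 : ℝ))
    (f := fun ν => inverseSum b ν) (g := fun ν => (inverseSum b ν)⁻¹)
    (fun ν _ => (inverseSum_pos hb ν).le) (fun ν _ => (inv_pos.mpr (inverseSum_pos hb ν)).le)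
    (fun ν _ => by rw [one_pow, mul_inv_cancel₀ (inverseSum_pos hb ν).ne'])
  rw [sum_inverseSum hb, Finset.sum_const, nsmul_eq_mul, mul_one, Finset.card_univ,
    Fintype.card_fun, Fintype.card_prod, Fintype.card_fin, Fintype.card_fin,
    Fintype.card_units_int] at h1
  push_cast at h1
  set I := ∑ ν : Fin H₁ → Fin K × ℤˣ, (inverseSum b ν)⁻¹
  have hP : (0 : ℝ) < (2 * K) ^ H₁ := by positivity
  have hB : 0 < (1 - b ^ 2) ^ H₁ := by positivity
  have h2 : ((2 * K : ℝ) ^ H₁) ^ 2 ≤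
      2 ^ K * ((2 * K : ℝ) ^ H₁ * ((1 - b ^ 2) ^ H₁)⁻¹) * I := by
    rw [mul_comm (K : ℝ) 2, mul_pow (2 * (K : ℝ)), inv_pow] at h1
    exact h1
  have h3 : (2 * K : ℝ) ^ H₁ * (1 - b ^ 2) ^ H₁ ≤ 2 ^ K * I := by
    have h4 : ((2 * K : ℝ) ^ H₁ * (1 - b ^ 2) ^ H₁) * (2 * K : ℝ) ^ H₁ ≤
        (2 ^ K * I) * (2 * K : ℝ) ^ H₁ := by
      have h5 := mul_le_mul_of_nonneg_right h2 hB.le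
      calc _ = ((2 * K : ℝ) ^ H₁) ^ 2 * (1 - b ^ 2) ^ H₁ := by ring
        _ ≤ _ := h5
        _ = _ := by field_simp
    exact le_of_mul_le_mul_right h4 hP
  rw [one_div, inv_pow, one_div, inv_pow, inv_mul_le_iff₀ (by positivity), ← mul_assoc,
    mul_comm ((2 : ℝ) ^ K), mul_assoc, ← div_eq_inv_mul, le_div_iff₀ hP]
  linarith

end LockData

/-! ### The lower bound -/

namespace LockData

variable {L K d H₁ : ℕ} {𝓝 : Type} [NeZero K] [Fintype 𝓝]

/-- No algorithm with polynomially many episodes learns a lock of length `d + 1` in the presence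
of sufficiently many actions. -/
theorem not_learns (Q : LockData L K (d + 1) H₁ 𝓝) (hd : 1 ≤ d) (hH : 1 ≤ H₁)
    {𝔄 : Algorithm} {Hthre : ℕ → ℝ → ℝ → EReal} (hlearn : LearnsSeparated 𝔄 d Hthre)
    {ε δ η : ℝ} (hε : 0 < ε) (hδ : 0 < δ)
    (hthre : Hthre L ε δ ≤ (((H₁ + 1 + (d + 1) : ℕ) : ℝ) : EReal)) (hb : 0 ≤ Q.b)
    (hsep : ∀ m l, Q.ρ m ≠ 0 → Q.ρ l ≠ 0 → m ≠ l →
      δ ≤ Q.b * hammingDist (Q.x m) (Q.x l) / K)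
    (hu : ∀ m, ∏ i, Q.u m i = 1)
    (hη : ∀ J ∈ properSubsets (d + 1), ∑ o, |Q.leak J o| ≤ η) (hη0 : 0 ≤ η)
    (hηε : 2 ^ (d + 2) * η ≤ ε) (hopen : 8 * ε ≤ Q.openProb)
    (A : ℕ) (hAS : (H₁ + 1 + (d + 1)) * (Fintype.card 𝓝 * 4) * (K * 4) ≤ A)
    (hAL : L ≤ A) (hAε : ε⁻¹ ≤ A) (hAδ : δ⁻¹ ≤ A) (hA2 : 2 ^ (d + 5) ≤ A)
    (hAη : (A : ℝ) ^ d * (2 ^ (d + 2) * η) ≤ 1 / 8) : False := by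
  set S := Fintype.card (Core (d + 1) H₁ 𝓝 × Innov K) with hS
  have hScard : S = (H₁ + 1 + (d + 1)) * (Fintype.card 𝓝 * 4) * (K * 4) := by
    rw [hS]
    simp only [Fintype.card_prod, Fintype.card_fin, Fintype.card_units_int]
    ring
  have : Nonempty 𝓝 := ⟨Q.init⟩
  have hNpos : 0 < Fintype.card 𝓝 := Fintype.card_pos
  have hKpos : 0 < K := NeZero.pos K
  have hSpos : 0 < S := by rw [hScard]; positivity
  have hApos : 0 < A := lt_of_lt_of_le (by positivity) hA2
  have : NeZero S := ⟨hSpos.ne'⟩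
  have : NeZero A := ⟨hApos.ne'⟩
  have hHA : H₁ + 1 + (d + 1) ≤ A := by
    refine le_trans ?_ hAS
    rw [mul_assoc]
    exact Nat.le_mul_of_pos_right _ (by positivity)
  set enc : Fin S ≃ Core (d + 1) H₁ 𝓝 × Innov K := (Fintype.equivFin _).symm
  have hrun := fun v : Fin (d + 1) → Fin A =>
    hlearn S A (H₁ + 1 + (d + 1)) L ε δ (by omega) hε hδ hthre (Q.model enc (secretLock v))
      (Q.model_stronglySeparated enc _ hb hsep)
  -- The reward does not reveal the secret, so one protocol must serve all `v`.
  set P := 𝔄 S A (H₁ + 1 + (d + 1)) L ε δ (lockReward enc) with hP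
  have hmain := Q.card_le_of_learns enc (by omega) hH (fun m _ => hu m) hη hη0 hε hηε hopen P
    (fun v => (hrun v).2)
  have hAr : (0 : ℝ) < A := Nat.cast_pos.mpr hApos
  have hN : (P.episodes : ℝ) ≤ (A : ℝ) ^ d := by
    refine (hrun fun _ => 0).1.trans (pow_le_pow_left₀ ?_ ?_ d)
    · exact le_max_of_le_left (Nat.cast_nonneg _)
    · refine max_le ?_ (max_le le_rfl (max_le ?_ (max_le ?_ (max_le hAε hAδ))))
      · exact_mod_cast hScard.le.trans hAS
      · exact_mod_cast hHA
      · exact_mod_cast hAL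
  rw [Fintype.card_fin] at hmain
  have hA2' : (2 : ℝ) ^ (d + 1) * 16 ≤ A := by
    have : (2 : ℝ) ^ (d + 5) ≤ A := by exact_mod_cast hA2
    calc (2 : ℝ) ^ (d + 1) * 16 = 2 ^ (d + 5) := by rw [pow_add, pow_add]; ring
      _ ≤ A := this
  have hAd : (A : ℝ) ≤ A ^ d := le_self_pow₀ (by exact_mod_cast hApos) (by omega)
  have hAn : (A : ℝ) ^ (d + 1) = A ^ d * A := pow_succ _ _
  -- The right side of `hmain` is at most `1/32 + 1/8 + 1/16` of `A ^ (d + 1)`, short of the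
  -- required `3/4`.
  have h1 : (2 : ℝ) ^ (d + 1) / (2 * ε) ≤ A ^ (d + 1) / 32 := by
    have : (2 : ℝ) ^ (d + 1) / (2 * ε) = 2 ^ (d + 1) / 2 * ε⁻¹ := by field_simp
    rw [this, hAn]
    calc (2 : ℝ) ^ (d + 1) / 2 * ε⁻¹ ≤ 2 ^ (d + 1) / 2 * A :=
          mul_le_mul_of_nonneg_left hAε (by positivity)
      _ ≤ A / 32 * A := mul_le_mul_of_nonneg_right (by linarith) hAr.le
      _ ≤ A ^ d / 32 * A := mul_le_mul_of_nonneg_right (by linarith) hAr.le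
      _ = _ := by ring
  have h2 : (P.episodes : ℝ) * ((A : ℝ) ^ (d + 1) * (2 ^ (d + 1 + 1) * η) + 2 ^ (d + 1)) ≤
      A ^ (d + 1) / 8 + A ^ (d + 1) / 16 := by
    calc _ ≤ (A : ℝ) ^ d * ((A : ℝ) ^ (d + 1) * (2 ^ (d + 1 + 1) * η) + 2 ^ (d + 1)) :=
          mul_le_mul_of_nonneg_right hN (by positivity)
      _ = (A : ℝ) ^ (d + 1) * (A ^ d * (2 ^ (d + 2) * η)) + A ^ d * 2 ^ (d + 1) := by ring
      _ ≤ (A : ℝ) ^ (d + 1) * (1 / 8) + A ^ d * (A / 16) := by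
          refine add_le_add (mul_le_mul_of_nonneg_left hAη (by positivity))
            (mul_le_mul_of_nonneg_left (by linarith) (by positivity))
      _ = _ := by rw [hAn]; ring
  have hApow : (0 : ℝ) < A ^ (d + 1) := by positivity
  linarith

end LockData

/-- The relative separation of a code translates into separation of the models. -/
lemma le_mul_hammingDist_div {K : ℕ} [NeZero K] {δ : ℝ} (hδ : 0 < δ) {x y : Fin K → ℤˣ}
    (h : K ≤ 16 * hammingDist x y) : δ ≤ 16 * δ * hammingDist x y / K := by
  have hK : (0 : ℝ) < K := Nat.cast_pos.mpr (NeZero.pos K)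
  rw [le_div_iff₀ hK]
  have : (K : ℝ) ≤ 16 * hammingDist x y := by exact_mod_cast h
  nlinarith

/-- Many instances cannot be told apart within a short horizon. -/
lemma not_learns_of_many_instances {L d H₁ : ℕ} (hd : 1 ≤ d) (hH : 1 ≤ H₁)
    {𝔄 : Algorithm} {Hthre : ℕ → ℝ → ℝ → EReal} (hlearn : LearnsSeparated 𝔄 d Hthre)
    {ε δ q : ℝ} (hε : 0 < ε) (hδ : 0 < δ) (hδ1 : δ ≤ 1 / 32) (hε8 : ε ≤ 1 / 8)
    (hthre : Hthre L ε δ ≤ (((H₁ + 1 + (d + 1) : ℕ) : ℝ) : EReal))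
    (hLε : ε⁻¹ ≤ L) (hLδ : δ⁻¹ ≤ L) (hL : 2 ^ (16 * (d + 1)) ≤ L)
    (hq : q = 4 * (256 * (d + 1) ^ 2) * (6 * d + 2)) (hHL : H₁ + 1 + (d + 1) ≤ L ^ 3)
    (hHq : (16 * δ) ^ 2 * Real.exp q * (H₁ + 1 + (d + 1) : ℕ) ≤ 2 * Real.log L) : False := by
  have hL0 : L ≠ 0 := by
    have : 0 < 2 ^ (16 * (d + 1)) := by positivity
    omega
  have hL16 : 16 ≤ L := by
    refine le_trans ?_ hL
    calc 16 = 2 ^ 4 := by norm_num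
      _ ≤ 2 ^ (16 * (d + 1)) := Nat.pow_le_pow_right (by norm_num) (by omega)
  have hLr : (1 : ℝ) ≤ L := by exact_mod_cast (by omega : 1 ≤ L)
  set K := Nat.log 2 L with hKdef
  have hK16 : 16 * (d + 1) ≤ K := by
    rw [hKdef, ← Nat.log_pow (b := 2) (by norm_num) (16 * (d + 1))]
    exact Nat.log_mono_right hL
  have : NeZero K := ⟨by omega⟩
  have hKL : 2 ^ K ≤ L := Nat.pow_log_le_self 2 hL0
  obtain ⟨ρ, x, u, hsep, hu, hhid⟩ := exists_role_code d K L hK16 hKL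
  have hb : |16 * δ| ≤ 1 := by rw [abs_of_pos (by positivity)]; linarith
  obtain ⟨s, hs⟩ : ∃ s, s = 256 * (d + 1) ^ 2 := ⟨_, rfl⟩
  rw [← hs] at hhid
  have hspos : 0 < s := by rw [hs]; positivity
  have hsr : (s : ℝ) = 256 * (d + 1) ^ 2 := by rw [hs]; push_cast; rfl
  have hs' : (0 : ℝ) < s := Nat.cast_pos.mpr hspos
  have hq0 : 0 ≤ q := by rw [hq]; positivity
  have hlogL : 0 ≤ Real.log L := Real.log_nonneg hLr
  have hKlog : Real.log L ≤ 2 * K := by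
    have h1 : L < 2 ^ (K + 1) := Nat.lt_pow_succ_log_self (by norm_num) L
    have h2 : (L : ℝ) ≤ 2 ^ (K + 1) := by exact_mod_cast h1.le
    have h3 := Real.log_le_log (by linarith) h2
    rw [Real.log_pow] at h3
    have h4 : ((K + 1 : ℕ) : ℝ) ≤ 2 * K := by
      have : K + 1 ≤ 2 * K := by omega
      exact_mod_cast this
    have h5 : Real.log 2 ≤ 1 := by linarith [Real.log_two_lt_d9]
    have h6 : (0 : ℝ) ≤ ((K + 1 : ℕ) : ℝ) := Nat.cast_nonneg _
    nlinarith
  set η := Real.exp (((16 * δ) ^ 2 * Real.exp q * (H₁ + 1 + (d + 1) : ℕ) - q * (K / s)) / 2)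
    with hη
  -- The choice of `q` gives `qK/s = 4(6d + 2)K ≥ 2(6d + 2) log L`; subtracting this from `2 log L`
  -- and halving gives `-(6d + 1) log L`.
  have hηL : η ≤ ((L : ℝ) ^ (6 * d + 1))⁻¹ := by
    have h1 : ((L : ℝ) ^ (6 * d + 1))⁻¹ = Real.exp (-((6 * d + 1 : ℕ) * Real.log L)) := by
      rw [Real.exp_neg, Real.exp_nat_mul, Real.exp_log (by linarith)]
    rw [h1, hη, Real.exp_le_exp]
    have h2 : q * (K / s) = 4 * (6 * d + 2) * K := by
      rw [hq, ← hsr]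
      field_simp
    have h3 : ((6 * d + 1 : ℕ) : ℝ) = 6 * d + 1 := by push_cast; rfl
    rw [h2, h3]
    linarith [mul_le_mul_of_nonneg_left hKlog (by positivity : (0 : ℝ) ≤ 6 * d + 2)]
  have hpow : (2 : ℕ) ^ (d + 5) ≤ L := (Nat.pow_le_pow_right (by norm_num) (by omega)).trans hL
  have hpowr : (2 : ℝ) ^ (d + 2) * 8 ≤ L := by
    have : (2 : ℝ) ^ (d + 5) ≤ L := by exact_mod_cast hpow
    calc (2 : ℝ) ^ (d + 2) * 8 = 2 ^ (d + 5) := by rw [pow_add, pow_add]; ring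
      _ ≤ L := this
  have hη0 : 0 ≤ η := (Real.exp_pos _).le
  have hLpos : (0 : ℝ) < L := by linarith
  have hLL6 : L ≤ L ^ 6 := Nat.le_self_pow (by norm_num) L
  have hLL6r : (L : ℝ) ≤ (L ^ 6 : ℕ) := by exact_mod_cast hLL6
  have hηpow : (L : ℝ) ^ (6 * d) * (2 ^ (d + 2) * η) ≤ 1 / 8 := by
    have h1 : (L : ℝ) ^ (6 * d) * L * η ≤ 1 := by
      rw [← pow_succ]
      calc _ ≤ (L : ℝ) ^ (6 * d + 1) * ((L : ℝ) ^ (6 * d + 1))⁻¹ :=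
            mul_le_mul_of_nonneg_left hηL (by positivity)
        _ = 1 := mul_inv_cancel₀ (by positivity)
    have h2 : (L : ℝ) ^ (6 * d) * η * (2 ^ (d + 2) * 8) ≤ (L : ℝ) ^ (6 * d) * η * L :=
      mul_le_mul_of_nonneg_left hpowr (by positivity)
    linarith
  -- `A = L ^ 6` exceeds the number of states, of order at most `L ^ 4`, while `A ^ d = L ^ (6d)` is
  -- beaten by `η`.
  refine (LockData.openGate H₁ ρ x u (16 * δ) hb).not_learns hd hH hlearn hε hδ hthre
    (by change 0 ≤ 16 * δ; positivity)
    (fun m l hm hl hml => le_mul_hammingDist_div hδ (hsep m l hm hl hml)) hu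
    (fun J hJ => LockData.sum_abs_leak_openGate_le hspos hhid _ hb hq0 hJ) hη0 ?_ ?_ (L ^ 6) ?_
    hLL6 (hLε.trans hLL6r) (hLδ.trans hLL6r) (hpow.trans hLL6) ?_
  · have h1 : (L : ℝ) ≤ L ^ (6 * d) := le_self_pow₀ hLr (by omega)
    have h2 : (L : ℝ) * (2 ^ (d + 2) * η) ≤ 1 / 8 :=
      (mul_le_mul_of_nonneg_right h1 (by positivity)).trans hηpow
    have h3 : 1 ≤ ε * L := by
      rw [inv_le_iff_one_le_mul₀ hε] at hLε
      linarith
    have h4 : (L : ℝ) * (2 ^ (d + 2) * η) ≤ L * ε := by linarith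
    exact le_of_mul_le_mul_left h4 hLpos
  · rw [LockData.openProb_openGate]
    linarith
  · have hKL' : K ≤ L := Nat.log_le_self 2 L
    simp only [Fintype.card_unit, one_mul]
    calc (H₁ + 1 + (d + 1)) * 4 * (K * 4) ≤ L ^ 3 * 4 * (L * 4) := by gcongr
      _ = 16 * L ^ 4 := by ring
      _ ≤ L * L ^ 4 := Nat.mul_le_mul_right _ hL16
      _ = L ^ 5 := by ring
      _ ≤ L ^ 6 := Nat.pow_le_pow_right (by omega) (by norm_num)
  · rw [Nat.cast_pow, ← pow_mul]
    exact hηpow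

/-- High accuracy cannot be reached within a short horizon. -/
lemma not_learns_of_high_accuracy {L d H₁ s : ℕ} (hd : 1 ≤ d) (hH : 1 ≤ H₁)
    {𝔄 : Algorithm} {Hthre : ℕ → ℝ → ℝ → EReal} (hlearn : LearnsSeparated 𝔄 d Hthre)
    {ε δ : ℝ} (hε : 0 < ε) (hδ : 0 < δ) (hδ1 : δ ≤ 1 / 32)
    (hthre : Hthre L ε δ ≤ (((H₁ + 1 + (d + 1) : ℕ) : ℝ) : EReal))
    (hs : s = 256 * (d + 1) ^ 2) (hL : 2 ^ (s * (d + 2)) ≤ L)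
    (hεs : 2 * (s * (d + 2) : ℕ) + 8 ≤ Real.log ε⁻¹)
    (hHε : 2 * (16 * δ) ^ 2 * (H₁ + 1 + (d + 1) : ℕ) ≤ Real.log ε⁻¹ / 2 + 1 / 2) : False := by
  -- The least `K` for which degree `d + 2` is hidden: one observation at the gate and `d + 1` in
  -- the lock.
  obtain ⟨K, hK⟩ : ∃ K, K = s * (d + 2) := ⟨_, rfl⟩
  rw [← hK] at hL hεs
  have hK16 : 16 * (d + 1) ≤ K := by
    have hs16 : 16 ≤ s := by
      rw [hs]
      have : 1 ≤ (d + 1) ^ 2 := Nat.one_le_pow _ _ (by omega)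
      omega
    rw [hK]
    exact Nat.mul_le_mul hs16 (by omega)
  have : NeZero K := ⟨by omega⟩
  obtain ⟨ρ, x, u, hsep, hu, hhid⟩ := exists_role_code d K L hK16 hL
  rw [← hs] at hhid
  have hb : |16 * δ| < 1 := by rw [abs_of_pos (by positivity)]; linarith
  have hopen : 8 * ε ≤ (LockData.equalizingGate H₁ ρ x u (16 * δ) hb).openProb := by
    refine le_trans ?_ (LockData.le_openProb_equalizingGate hb)
    set t := (16 * δ) ^ 2 with ht
    have ht0 : 0 ≤ t := sq_nonneg _
    have ht1 : t ≤ 1 / 4 := by rw [ht]; nlinarith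
    have h1 : Real.exp (-(2 * t)) ≤ 1 - t := by
      rw [Real.exp_neg, inv_le_comm₀ (Real.exp_pos _) (by linarith)]
      refine le_trans ?_ (Real.add_one_le_exp (2 * t))
      rw [inv_le_iff_one_le_mul₀ (by linarith)]
      nlinarith
    have h2 : Real.exp (-(2 * t * H₁)) ≤ (1 - t) ^ H₁ := by
      have := pow_le_pow_left₀ (Real.exp_pos _).le h1 H₁
      rw [← Real.exp_nat_mul] at this
      refine le_trans (le_of_eq ?_) this
      congr 1
      ring
    have h3 : (1 / 2 : ℝ) ^ K = Real.exp (-(K * Real.log 2)) := by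
      rw [Real.exp_neg, Real.exp_nat_mul, Real.exp_log (by norm_num), one_div, inv_pow]
    have h4 : 8 * ε = Real.exp (3 * Real.log 2 - Real.log ε⁻¹) := by
      rw [Real.exp_sub, Real.exp_log (by positivity), show (3 : ℝ) * Real.log 2 =
        ((3 : ℕ) : ℝ) * Real.log 2 by norm_num, Real.exp_nat_mul, Real.exp_log (by norm_num)]
      field_simp
      norm_num
    -- Half of `log ε⁻¹` pays for the horizon, the other half for `K` and the constants.
    calc 8 * ε ≤ Real.exp (-(K * Real.log 2)) * Real.exp (-(2 * t * H₁)) := by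
          rw [h4, ← Real.exp_add, Real.exp_le_exp]
          have h5 : 2 * t * H₁ ≤ Real.log ε⁻¹ / 2 + 1 / 2 := by
            refine le_trans (mul_le_mul_of_nonneg_left ?_ (by positivity)) hHε
            exact_mod_cast (by omega : H₁ ≤ H₁ + 1 + (d + 1))
          have h6 : Real.log 2 ≤ 1 := by linarith [Real.log_two_lt_d9]
          have h7 : (0 : ℝ) ≤ K := Nat.cast_nonneg _
          have h8 : (K : ℝ) * Real.log 2 ≤ K := mul_le_of_le_one_right h7 h6
          linarith
      _ ≤ _ := by
          rw [h3]
          exact mul_le_mul_of_nonneg_left h2 (Real.exp_pos _).le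
  -- As `η = 0`, nothing bounds `A` from above, so it may absorb a memory exponential in `H₁`.
  have hmax : ∀ a b c e f : ℕ, ∃ A, a ≤ A ∧ b ≤ A ∧ c ≤ A ∧ e ≤ A ∧ f ≤ A := fun a b c e f =>
    ⟨a + b + c + e + f, by omega, by omega, by omega, by omega, by omega⟩
  obtain ⟨A, hAS, hAL, hAε, hAδ, hA2⟩ := hmax
    ((H₁ + 1 + (d + 1)) * (Fintype.card (Fin H₁ → Fin K × ℤˣ) * 4) * (K * 4)) L ⌈ε⁻¹⌉₊ ⌈δ⁻¹⌉₊
    (2 ^ (d + 5))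
  refine (LockData.equalizingGate H₁ ρ x u (16 * δ) hb).not_learns (η := 0) hd hH hlearn hε hδ
    hthre (by change 0 ≤ 16 * δ; positivity)
    (fun m l hm hl hml => le_mul_hammingDist_div hδ (hsep m l hm hl hml)) hu
    (fun J hJ => ?_) le_rfl (by simpa using hε.le) hopen A hAS hAL
    ((Nat.le_ceil _).trans (Nat.cast_le.mpr hAε)) ((Nat.le_ceil _).trans (Nat.cast_le.mpr hAδ))
    hA2 (by simp)
  refine le_of_eq (Finset.sum_eq_zero fun o _ => ?_)
  rw [LockData.leak_equalizingGate hb hhid (by rw [hK]) hJ, abs_zero]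

end LatentMDP

end

/-! ### Choice of the constants and the two regimes -/

theorem theorem3p1 :
    ∃ δ₀ : ℝ, 0 < δ₀ ∧ ∀ d : ℕ, 1 ≤ d →
      ∃ c ε_d L_d : ℝ, 0 < c ∧ 0 < ε_d ∧
        ∀ (𝔄 : LatentMDP.Algorithm) (Hthre : ℕ → ℝ → ℝ → EReal),
          LatentMDP.LearnsSeparated 𝔄 d Hthre →
          ∀ (L : ℕ) (ε δ : ℝ), 0 < δ → δ ≤ δ₀ → 0 < ε → ε ≤ ε_d → max L_d δ⁻¹ ≤ (L : ℝ) →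
            ((c * Real.log ((L : ℝ) / ε) / δ ^ 2 : ℝ) : EReal) ≤ Hthre L ε δ := by
  refine ⟨1 / 32, by norm_num, fun d hd => ?_⟩
  obtain ⟨s, hs⟩ : ∃ s, s = 256 * (d + 1) ^ 2 := ⟨_, rfl⟩
  obtain ⟨q, hq⟩ : ∃ q : ℝ, q = 4 * (256 * (d + 1) ^ 2) * (6 * d + 2) := ⟨_, rfl⟩
  have hsr : (s : ℝ) = 256 * (d + 1) ^ 2 := by rw [hs]; push_cast; rfl
  have hd0 : (1 : ℝ) ≤ d := by exact_mod_cast hd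
  have hqs : (s : ℝ) ≤ q := by rw [hq, hsr]; nlinarith [sq_nonneg ((d : ℝ) + 1)]
  have hs256 : (256 : ℝ) * (d + 1) ≤ s := by rw [hsr]; nlinarith
  have hexq : q + 1 ≤ Real.exp q := Real.add_one_le_exp q
  have hsq : (s : ℝ) ≤ Real.exp q := by linarith
  have hq256 : (256 : ℝ) ≤ Real.exp q := by linarith
  -- `c` cancels the `e^q` of the second moment bound, `ε_d` leaves room for `K = s(d + 2)`, and
  -- `L_d` makes `L` exceed the required powers of two and the horizon long enough for the lock.
  refine ⟨Real.exp (-q) / 512, Real.exp (-(2 * (s * (d + 2) : ℕ) + 8)),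
    Real.exp (Real.exp q * (d + 3)), by positivity, by positivity, ?_⟩
  intro 𝔄 Hthre hlearn L ε δ hδ hδ1 hε hεd hLmax
  by_contra hcon
  rw [not_le] at hcon
  have hLd : Real.exp (Real.exp q * (d + 3)) ≤ L := (le_max_left _ _).trans hLmax
  have hLδ : δ⁻¹ ≤ L := (le_max_right _ _).trans hLmax
  have hLpos : (0 : ℝ) < L := (Real.exp_pos _).trans_le hLd
  have hlogL : Real.exp q * (d + 3) ≤ Real.log L := (Real.le_log_iff_exp_le hLpos).mpr hLd
  have hEq : Real.exp (-q) * Real.exp q = 1 := by rw [← Real.exp_add]; simp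
  have hEqpos := Real.exp_pos q
  have hEq1 : Real.exp (-q) ≤ 1 / 256 := by
    rw [Real.exp_neg, inv_le_comm₀ hEqpos (by norm_num)]
    linarith
  have hEqpos' := Real.exp_pos (-q)
  have hlogε : 2 * (s * (d + 2) : ℕ) + 8 ≤ Real.log ε⁻¹ := by
    rw [Real.log_inv]
    have := Real.log_le_log hε hεd
    rw [Real.log_exp] at this
    linarith
  have hlogε0 : 8 ≤ Real.log ε⁻¹ := by
    have : (0 : ℝ) ≤ (s * (d + 2) : ℕ) := Nat.cast_nonneg _
    linarith
  have hlog : Real.log (L / ε) = Real.log L + Real.log ε⁻¹ := by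
    rw [div_eq_mul_inv, Real.log_mul hLpos.ne' (by positivity)]
  have hlogLpos : 0 < Real.log L := lt_of_lt_of_le (by positivity) hlogL
  obtain ⟨val, hval⟩ : ∃ val, val = Real.exp (-q) / 512 * Real.log (L / ε) / δ ^ 2 := ⟨_, rfl⟩
  rw [← hval] at hcon
  have hδ2 : (0 : ℝ) < δ ^ 2 := by positivity
  have hvalδ : val * δ ^ 2 = Real.exp (-q) / 512 * Real.log (L / ε) := by
    rw [hval]; field_simp
  have hval0 : 0 ≤ val := by
    rw [hval, hlog]; positivity
  -- Room for at least one step before the gate, the gate itself and `d + 1` lock steps.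
  have hvalge : (d : ℝ) + 3 ≤ val := by
    have h1 : δ ^ 2 ≤ 1 / 1024 := by nlinarith
    have h2 : (Real.exp (-q) / 512) * (Real.exp q * (d + 3)) ≤ val * δ ^ 2 := by
      rw [hvalδ, hlog]
      refine mul_le_mul_of_nonneg_left ?_ (by positivity)
      linarith
    have h3 : (Real.exp (-q) / 512) * (Real.exp q * (d + 3)) = (d + 3) / 512 := by
      linear_combination ((d + 3) / 512) * hEq
    have h4 : val * δ ^ 2 ≤ val * (1 / 1024) := mul_le_mul_of_nonneg_left h1 hval0
    linarith
  -- If the threshold were below `val`, learning would be promised at this horizon.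
  set H := ⌈val⌉₊ with hH
  have hHge : val ≤ H := Nat.le_ceil _
  have hHle : (H : ℝ) ≤ val + 1 := (Nat.ceil_lt_add_one hval0).le
  have hHd : d + 3 ≤ H := by
    have : (d : ℝ) + 3 ≤ H := hvalge.trans hHge
    exact_mod_cast this
  obtain ⟨H₁, hH₁⟩ : ∃ H₁, H = H₁ + 1 + (d + 1) := ⟨H - (d + 2), by omega⟩
  have hH₁1 : 1 ≤ H₁ := by omega
  have hthre : Hthre L ε δ ≤ (((H₁ + 1 + (d + 1) : ℕ) : ℝ) : EReal) := by
    rw [← hH₁]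
    exact hcon.le.trans (EReal.coe_le_coe_iff.mpr hHge)
  have hHδ : δ ^ 2 * H ≤ Real.exp (-q) / 512 * Real.log (L / ε) + δ ^ 2 := by
    rw [← hvalδ]
    linarith [mul_le_mul_of_nonneg_left hHle hδ2.le]
  have hδ21 : δ ^ 2 ≤ 1 / 1024 := by nlinarith
  have hLone : (1 : ℝ) ≤ L := by
    refine le_trans ?_ hLd
    exact Real.one_le_exp (by positivity)
  have hpow2 : ∀ k : ℕ, (k : ℝ) ≤ Real.exp q * (d + 3) → 2 ^ k ≤ L := by
    intro k hk
    have h1 : (2 : ℝ) ^ k ≤ Real.exp k := by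
      rw [show (k : ℝ) = k * 1 by ring, Real.exp_nat_mul]
      exact pow_le_pow_left₀ (by norm_num) (by linarith [Real.add_one_le_exp 1]) k
    have h2 : (2 : ℝ) ^ k ≤ L := h1.trans ((Real.exp_le_exp.mpr hk).trans hLd)
    exact_mod_cast h2
  rcases le_total (Real.log ε⁻¹) (Real.log L) with hcase | hcase
  · have hLε : ε⁻¹ ≤ L := (Real.log_le_log_iff (by positivity) hLpos).mp hcase
    have hε8 : ε ≤ 1 / 8 := by
      have h1 : Real.log 8 ≤ Real.log ε⁻¹ := by
        refine le_trans ?_ hlogε0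
        have := Real.log_le_sub_one_of_pos (show (0 : ℝ) < 8 by norm_num)
        linarith
      have h2 := (Real.log_le_log_iff (by norm_num) (by positivity)).mp h1
      rw [le_inv_comm₀ (by norm_num) hε] at h2
      linarith
    refine LatentMDP.not_learns_of_many_instances hd hH₁1 hlearn hε hδ hδ1 hε8 hthre hLε hLδ
      (hpow2 _ ?_) hq ?_ ?_
    · push_cast
      exact mul_le_mul (by linarith) (by linarith) (by linarith) hEqpos.le
    · rw [← hH₁]
      have h1 : (H : ℝ) ≤ (L : ℝ) ^ 3 := by
        have h2 : Real.log (L / ε) ≤ 2 * L := by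
          rw [hlog]
          have := Real.log_le_sub_one_of_pos hLpos
          linarith
        have h3 : val ≤ L * L ^ 2 / 256 := by
          have h4 : (δ ^ 2)⁻¹ ≤ (L : ℝ) ^ 2 := by
            rw [← inv_pow]
            exact pow_le_pow_left₀ (by positivity) hLδ 2
          rw [hval, div_eq_mul_inv _ (δ ^ 2)]
          calc _ ≤ (Real.exp (-q) / 512 * (2 * L)) * (L : ℝ) ^ 2 := by
                refine mul_le_mul (mul_le_mul_of_nonneg_left h2 (by positivity)) h4
                  (by positivity) (by positivity)
            _ ≤ (1 / 512 * (2 * L)) * (L : ℝ) ^ 2 := by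
                refine mul_le_mul_of_nonneg_right (mul_le_mul_of_nonneg_right ?_ (by positivity))
                  (by positivity)
                linarith
            _ = _ := by ring
        have h5 : (2 : ℝ) ≤ L ^ 3 := by
          have h6 : (2 : ℝ) ≤ L := by
            have := hpow2 1 (by
              rw [Nat.cast_one, ← one_mul (1 : ℝ)]
              exact mul_le_mul (by linarith) (by linarith) zero_le_one hEqpos.le)
            exact_mod_cast this
          calc (2 : ℝ) ≤ L := h6
            _ ≤ L ^ 3 := le_self_pow₀ hLone (by norm_num)
        have h7 : (L : ℝ) * L ^ 2 = L ^ 3 := by ring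
        rw [h7] at h3
        linarith
      exact_mod_cast h1
    · rw [← hH₁]
      have h1 : Real.log (L / ε) ≤ 2 * Real.log L := by rw [hlog]; linarith
      have h2 : (16 * δ) ^ 2 * Real.exp q * H = 256 * Real.exp q * (δ ^ 2 * H) := by ring
      rw [h2]
      have h3 : δ ^ 2 * H ≤ Real.exp (-q) / 512 * (2 * Real.log L) + 1 / 1024 := by
        refine hHδ.trans (add_le_add (mul_le_mul_of_nonneg_left h1 (by positivity)) hδ21)
      calc 256 * Real.exp q * (δ ^ 2 * H)
          ≤ 256 * Real.exp q * (Real.exp (-q) / 512 * (2 * Real.log L) + 1 / 1024) :=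
            mul_le_mul_of_nonneg_left h3 (by positivity)
        _ = Real.log L + Real.exp q / 4 := by
            linear_combination (Real.log L) * hEq
        _ ≤ 2 * Real.log L := by
            have : Real.exp q * 1 ≤ Real.exp q * (d + 3) :=
              mul_le_mul_of_nonneg_left (by linarith) hEqpos.le
            linarith
  · refine LatentMDP.not_learns_of_high_accuracy hd hH₁1 hlearn hε hδ hδ1 hthre hs (hpow2 _ ?_) hlogε ?_
    · push_cast
      exact mul_le_mul hsq (by linarith) (by linarith) hEqpos.le
    · rw [← hH₁]
      have h1 : Real.log (L / ε) ≤ 2 * Real.log ε⁻¹ := by rw [hlog]; linarith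
      have h2 : 2 * (16 * δ) ^ 2 * H = 512 * (δ ^ 2 * H) := by ring
      rw [h2]
      have h3 : δ ^ 2 * H ≤ (1 / 256) / 512 * (2 * Real.log ε⁻¹) + 1 / 1024 := by
        refine hHδ.trans (add_le_add ?_ hδ21)
        refine mul_le_mul (by linarith) h1 ?_ (by norm_num)
        rw [hlog]
        positivity
      linarith
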